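/- Throughout, an $n$-space group is a discrete group $\Gamma$ of isometries of Euclidean $n$-space $E^n$ with compact orbit space $E^n/\Gamma$; affinities of $E^n$ are written $a+A$ ($x\mapsto a+Ax$, $a\in E^n$, $A\in \mathrm{GL}(n,\mathbb{R})$), $N_A(\Gamma)$ is the normalizer of $\Gamma$ in the group $\mathrm{Aff}(E^n)$ of affinities of $E^n$, $Z(\Gamma)$ is the center of $\Gamma$, and $\mathrm{Span}(H)$ is the linear span of $\{a : a+I\in H\}$ for a subgroup $H$. A normal subgroup $N$ of an $n$-space group $\Gamma$ is complete if $N=\{a+A\in\Gamma : a\in V,\ V^\perp\subseteq \mathrm{Fix}(A)\}$, where $V=\mathrm{Span}(N)$. Let $n\ge 1$, let $M$ be an $(n-1)$-space group, and let $\Delta$ be the infinite dihedral $1$-space group generated by the reflections $\delta_1\colon x\mapsto -x$ and $\delta_2\colon x\mapsto 1-x$ of $E^1$. Let $\mathrm{Aff}(M)$ be the group of all bijections of $E^{n-1}/M$ that lift to an affinity of $E^{n-1}$; for an affinity $\phi$ of $E^{n-1}$, let $\phi_\star\colon E^{n-1}/M\to E^{n-1}/\phi M\phi^{-1}$ be the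 map $Mx\mapsto (\phi M\phi^{-1})\phi(x)$ and let $\phi_\sharp(\alpha)=\phi_\star\alpha\phi_\star^{-1}$; in particular $\phi_\star\in\mathrm{Aff}(M)$ if $\phi\in N_A(M)$. Let $\Omega\colon \mathrm{Aff}(M)\to \mathrm{Out}(M)$ send $\phi_\star$, $\phi\in N_A(M)$, to the outer class of $\mu\mapsto\phi\mu\phi^{-1}$. Let $\mathrm{Hom}_f(\Delta,\mathrm{Aff}(M))$ be the set of homomorphisms $\eta\colon\Delta\to\mathrm{Aff}(M)$ such that $\Omega\eta$ has finite image, let $\mathrm{Aff}(\Delta,M)$ be its set of orbits $[\eta]$ under conjugation by $\mathrm{Aff}(M)$ and precomposition by automorphisms of $\Delta$, and let $\mathrm{Iso}(\Delta,M)$ be the set of isomorphism classes $[\Gamma,N]$ of pairs $(\Gamma,N)$, where $N$ is a complete normal subgroup of an $n$-space group $\Gamma$ with $N\cong M$ and $\Gamma/N\cong\Delta$ (an isomorphism of pairs is a group isomorphism $\Gamma_1\to\Gamma_2$ mapping $N_1$ onto $N_2$). For each $\eta\in \mathrm{Hom}_f(\Delta,\mathrm{Aff}(M))$ there are $C\in\mathrm{GL}(n-1,\mathbb{R})$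 such that $CMC^{-1}$ is an $(n-1)$-space group and $C_\sharp\eta(\Delta)$ consists of isometries of $E^{n-1}/CMC^{-1}$, and an $n$-space group $\Gamma$ which contains, as a complete normal subgroup, the extension $N$ of $CMC^{-1}$ to $E^n=E^{n-1}\times E^1$ by the trivial action on $E^1$, such that the group $\Gamma'$ of the actions $\gamma'$ on $E^1$ of the elements $\gamma$ of $\Gamma$ is $\Delta$, and each $\gamma\in\Gamma$ acts on $E^{n-1}/CMC^{-1}$ by $C_\sharp\eta(\gamma')$. The class $[\Gamma,N]$ depends only on $[\eta]$, and $[\eta]\mapsto[\Gamma,N]$ is a well-defined surjection $\psi\colon\mathrm{Aff}(\Delta,M)\to\mathrm{Iso}(\Delta,M)$. This surjection has the following property. Let $\eta_1,\eta_2\in \mathrm{Hom}_f(\Delta,\mathrm{Aff}(M))$, let $\eta_1(\delta_i)=(a_i+A_i)_\star$ with $a_i+A_i\in N_A(M)$ for $i=1,2$, and let $E_i$ be the $(-1)$-eigenspace of the restriction of $A_i$ to $\mathrm{Span}(Z(M))$ for $i=1,2$. Then $\psi([\eta_1])=\psi([\eta_2])$ if and only if there is a vector $v\in E_1\cap E_2$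 such that the unordered pair $\{\eta_1(\delta_1),(v+I)_\star\eta_1(\delta_2)\}$ is conjugate to the unordered pair $\{\eta_2(\delta_1),\eta_2(\delta_2)\}$ by an element of $\mathrm{Aff}(M)$. -/

import Mathlib

noncomputable section

namespace FlatOrb

/-! ## Affinities of Euclidean space and space groups -/

/-- Euclidean `n`-space. -/
abbrev E (n : ℕ) : Type := EuclideanSpace ℝ (Fin n)

/-- The group of affinities `a + A` of Euclidean `n`-space; `a = φ 0` and `A = φ.linear`. -/
abbrev Aff (n : ℕ) : Type := E n ≃ᵃ[ℝ] E n

/-- The translation `a + I`. -/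
abbrev transl {n : ℕ} (a : E n) : Aff n := AffineEquiv.constVAdd ℝ (E n) a

/-- The tautological action of the affine group on Euclidean space. -/
instance affAction (n : ℕ) : MulAction (Aff n) (E n) where
  smul φ x := φ x
  one_smul _ := rfl
  mul_smul _ _ _ := rfl

theorem smul_eq {n : ℕ} (φ : Aff n) (x : E n) : φ • x = φ x := rfl

/-- The orbit space `E^n / Γ`, with its quotient topology. -/
abbrev Orb {n : ℕ} (Γ : Subgroup (Aff n)) : Type := MulAction.orbitRel.Quotient Γ (E n)

/-- The point `Γ x` of `E^n / Γ`. -/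
def orb {n : ℕ} (Γ : Subgroup (Aff n)) (x : E n) : Orb Γ :=
  Quotient.mk (MulAction.orbitRel Γ (E n)) x

theorem orb_eq_iff {n : ℕ} {Γ : Subgroup (Aff n)} {x y : E n} :
    orb Γ x = orb Γ y ↔ ∃ γ ∈ Γ, γ y = x := by
  unfold orb
  rw [Quotient.eq, MulAction.orbitRel_apply, MulAction.mem_orbit_iff]
  constructor
  · rintro ⟨⟨γ, hγ⟩, h⟩
    exact ⟨γ, hγ, h⟩
  · rintro ⟨γ, hγ, h⟩
    exact ⟨⟨γ, hγ⟩, h⟩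

/-- An `n`-space group: a discrete group of isometries of `E^n` with compact orbit space.
Discreteness says that the identity is isolated in `Γ`, where `a + A` is close to the identity when
`a` is close to `0` and `A` is close to `I` in operator norm. -/
structure IsSpaceGroup {n : ℕ} (Γ : Subgroup (Aff n)) : Prop where
  isometry : ∀ γ ∈ Γ, Isometry γ
  discrete : ∃ ε : ℝ, 0 < ε ∧ ∀ γ ∈ Γ, ‖γ 0‖ < ε →
    (∀ x : E n, ‖γ.linear x - x‖ ≤ ε * ‖x‖) → γ = 1
  cocompact : CompactSpace (Orb Γ)

/-- `Span(H)`: the span of all `a` such that the translation `a + I` lies in `H`. -/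
def span {n : ℕ} (H : Subgroup (Aff n)) : Submodule ℝ (E n) :=
  Submodule.span ℝ {a | transl a ∈ H}

/-- The center `Z(Γ)`, as a subgroup of the affine group. -/
def center {n : ℕ} (Γ : Subgroup (Aff n)) : Subgroup (Aff n) :=
  (Subgroup.center Γ).map Γ.subtype

/-- `N` is a complete normal subgroup of `Γ`:
`N = {a + A ∈ Γ : a ∈ V and V^⊥ ⊆ Fix(A)}`, where `V = Span(N)`. -/
structure IsCompleteNormal {n : ℕ} (Γ N : Subgroup (Aff n)) : Prop where
  le : N ≤ Γ
  normal : (N.subgroupOf Γ).Normal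
  complete : ∀ γ ∈ Γ,
    (γ ∈ N ↔ γ 0 ∈ span N ∧ ∀ w ∈ (span N)ᗮ, γ.linear w = w)

/-- The conjugate `φ Γ φ⁻¹`. -/
abbrev conj {n : ℕ} (φ : Aff n) (Γ : Subgroup (Aff n)) : Subgroup (Aff n) :=
  Γ.map (MulAut.conj φ).toMonoidHom

/-- The normalizer `N_A(Γ)` of `Γ` in the affine group. -/
abbrev NA {n : ℕ} (Γ : Subgroup (Aff n)) : Subgroup (Aff n) :=
  Subgroup.normalizer (Γ : Set (Aff n))

/-! ## Affinities of flat orbifolds -/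

theorem orb_map {n : ℕ} {Γ₁ Γ₂ : Subgroup (Aff n)} {φ : Aff n} (h : conj φ Γ₁ = Γ₂)
    {x y : E n} (hxy : orb Γ₁ x = orb Γ₁ y) : orb Γ₂ (φ x) = orb Γ₂ (φ y) := by
  obtain ⟨γ, hγ, rfl⟩ := orb_eq_iff.1 hxy
  refine orb_eq_iff.2 ⟨φ * γ * φ⁻¹, ?_, ?_⟩
  · rw [← h]
    exact ⟨γ, hγ, rfl⟩
  · change φ (γ (φ.symm (φ y))) = φ (γ y)
    rw [AffineEquiv.symm_apply_apply]

theorem conj_inv_eq {n : ℕ} {Γ₁ Γ₂ : Subgroup (Aff n)} {φ : Aff n} (h : conj φ Γ₁ = Γ₂) :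
    conj φ⁻¹ Γ₂ = Γ₁ := by
  subst h
  ext γ
  constructor
  · rintro ⟨_, ⟨δ, hδ, rfl⟩, rfl⟩
    have : (MulAut.conj φ⁻¹).toMonoidHom ((MulAut.conj φ).toMonoidHom δ) = δ := by
      simp [MulAut.conj_apply, mul_assoc]
    rw [this]
    exact hδ
  · intro hγ
    refine ⟨_, ⟨γ, hγ, rfl⟩, ?_⟩
    simp [MulAut.conj_apply, mul_assoc]

/-- If `φ Γ₁ φ⁻¹ = Γ₂`, the bijection `φ_⋆ : E^n / Γ₁ → E^n / Γ₂`, `φ_⋆(Γ₁ x) = Γ₂ φ(x)`. -/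
def star {n : ℕ} (φ : Aff n) {Γ₁ Γ₂ : Subgroup (Aff n)} (h : conj φ Γ₁ = Γ₂) :
    Orb Γ₁ ≃ Orb Γ₂ where
  toFun := Quotient.lift (fun x => orb Γ₂ (φ x))
    (fun _ _ hab => orb_map h (Quotient.sound hab))
  invFun := Quotient.lift (fun x => orb Γ₁ (φ⁻¹ x))
    (fun _ _ hab => orb_map (conj_inv_eq h) (Quotient.sound hab))
  left_inv := by
    rintro ⟨x⟩
    change orb Γ₁ (φ.symm (φ x)) = orb Γ₁ x
    rw [AffineEquiv.symm_apply_apply]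
  right_inv := by
    rintro ⟨x⟩
    change orb Γ₂ (φ (φ.symm x)) = orb Γ₂ x
    rw [AffineEquiv.apply_symm_apply]

theorem star_orb {n : ℕ} (φ : Aff n) {Γ₁ Γ₂ : Subgroup (Aff n)} (h : conj φ Γ₁ = Γ₂) (x : E n) :
    star φ h (orb Γ₁ x) = orb Γ₂ (φ x) := rfl

/-- `Aff(Γ) = Aff(E^n / Γ)`: the group of all bijections `β` of `E^n / Γ` that lift to an affinity
`φ` of `E^n`, that is, `β(Γ x) = Γ φ(x)` for all `x`. -/
def AffOrb {n : ℕ} (Γ : Subgroup (Aff n)) : Subgroup (Equiv.Perm (Orb Γ)) where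
  carrier := {β | ∃ φ : Aff n, ∀ x, β (orb Γ x) = orb Γ (φ x)}
  one_mem' := ⟨1, fun _ => rfl⟩
  mul_mem' := by
    rintro α β ⟨φ, hφ⟩ ⟨χ, hχ⟩
    refine ⟨φ * χ, fun x => ?_⟩
    rw [Equiv.Perm.mul_apply, hχ, hφ]
    rfl
  inv_mem' := by
    rintro β ⟨φ, hφ⟩
    refine ⟨φ⁻¹, fun x => ?_⟩
    rw [Equiv.Perm.inv_eq_iff_eq, hφ]
    change orb Γ x = orb Γ (φ (φ.symm x))
    rw [AffineEquiv.apply_symm_apply]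

/-- `Φ : N_A(Γ) → Aff(Γ)`, `φ ↦ φ_⋆`. -/
def starNA {n : ℕ} {Γ : Subgroup (Aff n)} (φ : Aff n) (h : φ ∈ NA Γ) : AffOrb Γ :=
  ⟨star φ (Subgroup.mem_normalizer_iff_map_conj_eq.1 h), φ, fun _ => rfl⟩

/-- The isomorphism `φ_♯ : β ↦ φ_⋆ β φ_⋆⁻¹`, on bijections of the orbit spaces. -/
def sharp {n : ℕ} (φ : Aff n) {Γ₁ Γ₂ : Subgroup (Aff n)} (h : conj φ Γ₁ = Γ₂)
    (β : Equiv.Perm (Orb Γ₁)) : Equiv.Perm (Orb Γ₂) :=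
  (star φ h).permCongr β

/-! ## The set `Aff(Δ, M)` -/

/-- `Out(Γ) = Aut(Γ) / Inn(Γ)`. -/
abbrev Out (G : Type) [Group G] : Type := MulAut G ⧸ (MulAut.conj : G →* MulAut G).range

/-- `o = Ω(β)`: the affinity `β` of `E^n / Γ` has a lift `φ ∈ N_A(Γ)` such that `o` is the outer
class of the automorphism `γ ↦ φ γ φ⁻¹` of `Γ`. -/
def IsOmega {n : ℕ} {Γ : Subgroup (Aff n)} (β : AffOrb Γ) (o : Out Γ) : Prop :=
  ∃ (φ : Aff n) (h : φ ∈ NA Γ), starNA φ h = β ∧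
    o = QuotientGroup.mk (Γ.normalizerMonoidHom ⟨φ, h⟩)

/-- `Hom_f(Δ, Aff(M))`: homomorphisms `η : Δ → Aff(M)` such that `Ωη` has finite image. -/
def HomF {m k : ℕ} (Δ : Subgroup (Aff k)) (M : Subgroup (Aff m)) : Type :=
  {η : Δ →* AffOrb M // {o : Out M | ∃ δ : Δ, IsOmega (η δ) o}.Finite}

/-- Two elements of `Hom_f(Δ, Aff(M))` are in the same orbit under conjugation by `Aff(M)` and
precomposition by `Aut(Δ)`. -/
def affSetoid {m k : ℕ} (Δ : Subgroup (Aff k)) (M : Subgroup (Aff m)) : Setoid (HomF Δ M) where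
  r η₁ η₂ := ∃ (α : AffOrb M) (ζ : MulAut Δ), ∀ δ : Δ, η₂.1 δ = α * η₁.1 (ζ δ) * α⁻¹
  iseqv :=
    { refl := fun η => ⟨1, 1, fun δ => by simp⟩
      symm := by
        rintro η₁ η₂ ⟨α, ζ, h⟩
        refine ⟨α⁻¹, ζ⁻¹, fun δ => ?_⟩
        rw [h, MulAut.apply_inv_self]
        group
      trans := by
        rintro η₁ η₂ η₃ ⟨α, ζ, h⟩ ⟨α', ζ', h'⟩
        refine ⟨α' * α, ζ * ζ', fun δ => ?_⟩
        rw [h', h, MulAut.mul_apply]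
        group }

/-- `Aff(Δ, M) = (Aff(M) \ Hom_f(Δ, Aff(M))) / Out(Δ)`; inner automorphisms of `Δ` act trivially on
`Aff(M)`-orbits, so these are the orbits of `Aff(M)` and `Aut(Δ)` together. -/
def AffClass {m k : ℕ} (Δ : Subgroup (Aff k)) (M : Subgroup (Aff m)) : Type :=
  Quotient (affSetoid Δ M)

/-- The class `[η]` in `Aff(Δ, M)`. -/
def affClass {m k : ℕ} {Δ : Subgroup (Aff k)} {M : Subgroup (Aff m)} (η : HomF Δ M) :
    AffClass Δ M :=
  Quotient.mk (affSetoid Δ M) η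

/-! ## The set `Iso(Δ, M)` -/

/-- A pair `(Γ, N)`, where `N` is a complete normal subgroup of an `(m+k)`-space group `Γ` such that
`N` is isomorphic to `M` and `Γ / N` is isomorphic to `Δ`. -/
structure Pair {m k : ℕ} (Δ : Subgroup (Aff k)) (M : Subgroup (Aff m)) where
  Γ : Subgroup (Aff (m + k))
  N : Subgroup (Aff (m + k))
  spaceGroup : IsSpaceGroup Γ
  complete : IsCompleteNormal Γ N
  isoM : Nonempty (N ≃* M)
  isoΔ : haveI := complete.normal; Nonempty ((Γ ⧸ N.subgroupOf Γ) ≃* Δ)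

/-- Isomorphism of pairs: a group isomorphism `Γ₁ → Γ₂` that maps `N₁` onto `N₂`. -/
def pairSetoid {m k : ℕ} (Δ : Subgroup (Aff k)) (M : Subgroup (Aff m)) : Setoid (Pair Δ M) where
  r p q := ∃ f : p.Γ ≃* q.Γ, ∀ γ : p.Γ, γ ∈ p.N.subgroupOf p.Γ ↔ f γ ∈ q.N.subgroupOf q.Γ
  iseqv :=
    { refl := fun p => ⟨MulEquiv.refl _, fun _ => Iff.rfl⟩
      symm := by
        rintro p q ⟨f, h⟩
        refine ⟨f.symm, fun γ => ?_⟩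
        rw [h, MulEquiv.apply_symm_apply]
      trans := by
        rintro p q r ⟨f, h⟩ ⟨g, h'⟩
        exact ⟨f.trans g, fun γ => (h γ).trans (h' _)⟩ }

/-- `Iso(Δ, M)`: the set of isomorphism classes of pairs `(Γ, N)`. -/
def IsoClass {m k : ℕ} (Δ : Subgroup (Aff k)) (M : Subgroup (Aff m)) : Type :=
  Quotient (pairSetoid Δ M)

/-- The class `[Γ, N]` in `Iso(Δ, M)`. -/
def isoClass {m k : ℕ} {Δ : Subgroup (Aff k)} {M : Subgroup (Aff m)} (p : Pair Δ M) :
    IsoClass Δ M :=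
  Quotient.mk (pairSetoid Δ M) p

/-! ## The function `ψ` -/

/-- The point `(v, w)` of `E^{m+k} = E^m × E^k`. -/
def join {m k : ℕ} (v : E m) (w : E k) : E (m + k) :=
  WithLp.toLp 2 (Fin.append v.ofLp w.ofLp)

/-- The projection of `E^{m+k} = E^m × E^k` onto `E^m`. -/
def fst {m k : ℕ} (x : E (m + k)) : E m := WithLp.toLp 2 (fun i => x (Fin.castAdd k i))

/-- The projection of `E^{m+k} = E^m × E^k` onto `E^k`. -/
def snd {m k : ℕ} (x : E (m + k)) : E k := WithLp.toLp 2 (fun i => x (Fin.natAdd m i))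

/-- For `γ = b + B`, the map `v ↦ b̄ + B̄ v` of `E^m`. -/
def bar {m k : ℕ} (γ : Aff (m + k)) : E m → E m := fun v => fst (γ (join v (0 : E k)))

/-- For `γ = b + B`, the map `w ↦ b' + B' w` of `E^k`. -/
def perp {m k : ℕ} (γ : Aff (m + k)) : E k → E k := fun w => snd (γ (join (0 : E m) w))

/-- The pair `(Γ, N)` is constructed from `η ∈ Hom_f(Δ, Aff(M))` by means of `C ∈ GL(m, ℝ)`. -/
structure IsConstructedFrom {m k : ℕ} {Δ : Subgroup (Aff k)} {M : Subgroup (Aff m)}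
    (η : HomF Δ M) (C : E m ≃ₗ[ℝ] E m) (p : Pair Δ M) : Prop where
  /-- `C M C⁻¹` is an `m`-space group. -/
  spaceGroup : IsSpaceGroup (conj C.toAffineEquiv M)
  /-- Each element of `C_♯ η(Δ)` is an isometry of `E^m / C M C⁻¹`, that is, it is induced by an
  isometry of `E^m`. -/
  isometry : ∀ δ : Δ, ∃ φ : Aff m, Isometry φ ∧
    ∀ x, sharp C.toAffineEquiv rfl (η.1 δ).1 (orb _ x) = orb _ (φ x)
  /-- `N` is `C M C⁻¹` extended to `E^m × E^k` by the trivial action on `E^k`. -/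
  extend : ∀ γ : Aff (m + k), γ ∈ p.N ↔
    ∃ ν ∈ conj C.toAffineEquiv M, ∀ v w, γ (join v w) = join (ν v) w
  /-- `Γ' = Δ`. -/
  perp_eq : {f : E k → E k | ∃ γ ∈ p.Γ, perp (m := m) γ = f} = {f | ∃ δ ∈ Δ, ⇑δ = f}
  /-- `Ξ = C_♯ η P`, where `Ξ(N γ)` is the map induced by `γ̄` on `E^m / C M C⁻¹`, and
  `P(N γ) = γ'`. -/
  action : ∀ γ ∈ p.Γ, ∀ δ : Δ, perp (m := m) γ = ⇑(δ : Aff k) → ∀ x : E m,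
    sharp C.toAffineEquiv rfl (η.1 δ).1 (orb _ x) = orb _ (bar (k := k) γ x)

/-- The defining relation of the function `ψ : Aff(Δ, M) → Iso(Δ, M)`: `c = [Γ, N]` for a pair
`(Γ, N)` constructed, by means of some `C`, from a representative `η` of `x`. -/
def PsiGraph {m k : ℕ} {Δ : Subgroup (Aff k)} {M : Subgroup (Aff m)}
    (x : AffClass Δ M) (c : IsoClass Δ M) : Prop :=
  ∃ (η : HomF Δ M) (C : E m ≃ₗ[ℝ] E m) (p : Pair Δ M),
    affClass η = x ∧ IsConstructedFrom η C p ∧ isoClass p = c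

/-! ## The standard infinite dihedral group, eigenspaces and pairs -/

/-- The reflection `δ₁ = -I'` of `E^1`. -/
def refl₁ : Aff 1 := (LinearEquiv.neg ℝ).toAffineEquiv

/-- The reflection `δ₂ = 1 - I'` of `E^1`. -/
def refl₂ : Aff 1 := transl (EuclideanSpace.single 0 1) * refl₁

/-- The standard infinite dihedral 1-space group. -/
def Dih : Subgroup (Aff 1) := Subgroup.closure {refl₁, refl₂}

/-- The Coxeter generator `δ₁` of the standard infinite dihedral group. -/
def δ₁ : Dih := ⟨refl₁, Subgroup.subset_closure (by simp)⟩

/-- The Coxeter generator `δ₂` of the standard infinite dihedral group. -/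
def δ₂ : Dih := ⟨refl₂, Subgroup.subset_closure (by simp)⟩

/-- The `(-1)`-eigenspace of the restriction of `A` to `Span(Z(M))`, where `α = a + A`. -/
def negEigen {m : ℕ} (M : Subgroup (Aff m)) (α : Aff m) : Submodule ℝ (E m) :=
  span (center M) ⊓ Module.End.eigenspace (α.linear : E m →ₗ[ℝ] E m) (-1)

theorem linear_eq_of_mem_span_center {m : ℕ} {M : Subgroup (Aff m)} {v : E m}
    (hv : v ∈ span (center M)) {γ : Aff m} (hγ : γ ∈ M) : γ.linear v = v := by
  unfold span at hv
  induction hv using Submodule.span_induction with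
  | mem a ha =>
    obtain ⟨z, hz, hza⟩ := ha
    have h := congrArg Subtype.val (Subgroup.mem_center_iff.1 hz ⟨γ, hγ⟩)
    change γ * M.subtype z = M.subtype z * γ at h
    rw [hza] at h
    have h0 : γ (a + 0) = a + γ 0 := DFunLike.congr_fun h (0 : E m)
    have h1 : γ (a + 0) = γ.linear a + γ 0 := γ.map_vadd 0 a
    exact add_right_cancel (h1.symm.trans h0)
  | zero => exact map_zero _
  | add a b _ _ ha hb => rw [map_add, ha, hb]
  | smul c a _ ha => rw [map_smul, ha]

/-- For `v ∈ Span(Z(M))` the translation `v + I` normalizes (indeed centralizes) `M`. -/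
theorem transl_mem_NA {m : ℕ} {M : Subgroup (Aff m)} {v : E m}
    (hv : v ∈ span (center M)) : transl v ∈ NA M := by
  have key : ∀ γ ∈ M, transl v * γ = γ * transl v := by
    intro γ hγ
    ext1 x
    change v + γ x = γ (v + x)
    have h1 : γ (v + x) = γ.linear v + γ x := γ.map_vadd x v
    rw [h1, linear_eq_of_mem_span_center hv hγ]
  rw [Subgroup.mem_normalizer_iff]
  intro γ
  constructor
  · intro hγ
    rw [key γ hγ, mul_inv_cancel_right]
    exact hγ
  · intro hγ
    have h := key _ hγ
    have h2 : γ = transl v * γ * (transl v)⁻¹ := by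
      have h3 : transl v * (transl v * γ * (transl v)⁻¹) = transl v * γ := by
        rw [h, inv_mul_cancel_right]
      exact (mul_left_cancel h3).symm
    rw [h2]
    exact hγ

/-- The affinity `(v + I)_⋆` of `E^m / M`, for `v ∈ Span(Z(M))`. -/
def translStar {m : ℕ} {M : Subgroup (Aff m)} (v : span (center M)) : AffOrb M :=
  starNA (transl v.1) (transl_mem_NA v.2)

/-- The unordered pairs `{x₁, x₂}` and `{y₁, y₂}` are conjugate by an element of `G`. -/
def PairConj {G : Type} [Group G] (x₁ x₂ y₁ y₂ : G) : Prop :=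
  ∃ g : G, s(g * x₁ * g⁻¹, g * x₂ * g⁻¹) = s(y₁, y₂)

end FlatOrb

end

noncomputable section

namespace FlatOrb

section

open Filter Topology

/-! ## Affinities -/

section basics

variable {n : ℕ}

/-! Everything passes through one abstract extension. A homomorphism η : Δ → Aff(M) determines the
group `Model η` of pairs (φ, δ) with φ an affine lift of η(δ). The kernel of its projection to Δ is
M, because an affinity acting trivially on E^m/M lies in M (`mem_of_orb_eq`). Every pair (Γ, N)
constructed from η, by whatever C, is isomorphic to this extension (`models_of_isConstructedFrom`),
so [Γ, N] depends only on η, and equality of classes is isomorphism of model extensions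
(`isoClass_eq_iff`). Constructed pairs exist: finiteness of the image of Ωη makes the linear parts
of all lifts a finite group, and averaging an inner product yields C (`exists_isConstructedFrom`).
Every pair occurs: Γ acts on Span(N), and Bieberbach's second theorem identifies the action of N
there with that of M (`exists_models`).

The criterion is a computation of cocycles. An isomorphism of model extensions over the infinite
dihedral group induces an automorphism of Δ, which permutes δ₁ and δ₂ up to an inner automorphism,
and an automorphism of M, which is conjugation by an affinity Φ. Compared through Φ, lifts over δᵢ
change by an affinity centralizing M, that is, by a translation wᵢ in Span(Z(M)) (`centralizer_eq`),
and δᵢ² = 1 forces wᵢ ∈ Eᵢ (`exists_translation_change`). Composing Φ with a translation u changes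
(w₁, w₂) by the coboundary (u − A₁u, u − A₂u); an orthogonal projection for an invariant inner
product reduces (w₁, w₂) to (0, v) with v ∈ E₁ ∩ E₂ (`exists_cocycle_normal_form`). Conversely,
lifts over δ multiply such a v by the slope ±1 of δ, so δ ↦ trn(δ)v is a cocycle; twisting by it
keeps the extension, fixes η(δ₁) and multiplies η(δ₂) by (v + I)_⋆ (`modelIso_twist`).

Both Bieberbach theorems are proved on the way: the first by a commutator argument with elements of
least displacement (`lin_eq_one_of_small`), the second by extending an isomorphism of lattices
linearly and averaging a cocycle over a finite quotient (`exists_affineEquiv`). -/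

theorem apply_add (g : Aff n) (x y : E n) : g (x + y) = g.linear x + g y := g.map_vadd y x

theorem apply_eq (g : Aff n) (x : E n) : g x = g.linear x + g 0 := by
  simpa using apply_add g x 0

theorem apply_sub_apply (g : Aff n) (x y : E n) : g x - g y = g.linear (x - y) := by
  rw [apply_eq g x, apply_eq g y, map_sub]; abel

theorem mul_apply' (g h : Aff n) (x : E n) : (g * h) x = g (h x) := rfl

theorem mul_linear (g h : Aff n) (x : E n) : (g * h).linear x = g.linear (h.linear x) := rfl

theorem inv_apply_self' (g : Aff n) (x : E n) : g⁻¹ (g x) = x := g.symm_apply_apply x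

theorem apply_inv_self' (g : Aff n) (x : E n) : g (g⁻¹ x) = x := g.apply_symm_apply x

theorem linear_inv_apply (g : Aff n) (x : E n) : g⁻¹.linear (g.linear x) = x :=
  g.linear.symm_apply_apply x

theorem linear_apply_inv (g : Aff n) (x : E n) : g.linear (g⁻¹.linear x) = x :=
  g.linear.apply_symm_apply x

theorem aff_ext {g h : Aff n} (h0 : g 0 = h 0) (hl : ∀ x, g.linear x = h.linear x) : g = h := by
  ext1 x
  rw [apply_eq g, apply_eq h, h0, hl]

theorem transl_apply (a x : E n) : transl a x = a + x := rfl

theorem transl_linear (a x : E n) : (transl a).linear x = x := rfl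

theorem transl_injective : Function.Injective (transl : E n → Aff n) := by
  intro a b h
  simpa [transl_apply] using DFunLike.congr_fun h (0 : E n)

theorem transl_mul (a b : E n) : transl a * transl b = transl (a + b) := by
  ext1 x
  simp [mul_apply']

theorem transl_zero : transl (0 : E n) = 1 := by
  ext1 x
  simp

theorem transl_inv (a : E n) : (transl a)⁻¹ = transl (-a) := by
  rw [inv_eq_iff_mul_eq_one, transl_mul, add_neg_cancel, transl_zero]

theorem eq_transl {g : Aff n} (hl : ∀ x, g.linear x = x) : g = transl (g 0) :=
  aff_ext (by simp) (by simpa using hl)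

theorem mul_transl (g : Aff n) (a : E n) : g * transl a = transl (g.linear a) * g := by
  ext1 x
  simp [mul_apply', apply_add]

theorem conj_transl (g : Aff n) (a : E n) : g * transl a * g⁻¹ = transl (g.linear a) := by
  rw [mul_transl, mul_inv_cancel_right]

theorem norm_linear_of_isometry {g : Aff n} (hg : Isometry g) (x : E n) : ‖g.linear x‖ = ‖x‖ := by
  have h := hg.dist_eq x 0
  rw [dist_eq_norm, dist_eq_norm, apply_sub_apply, sub_zero] at h
  exact h

theorem isometry_of_norm_linear {g : Aff n} (hg : ∀ x, ‖g.linear x‖ = ‖x‖) : Isometry g :=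
  Isometry.of_dist_eq fun x y => by rw [dist_eq_norm, dist_eq_norm, apply_sub_apply, hg]

/-- The linear part of an affinity, as a continuous linear map. -/
def lin (g : Aff n) : E n →L[ℝ] E n := LinearMap.toContinuousLinearMap g.linear.toLinearMap

@[simp] theorem lin_apply (g : Aff n) (x : E n) : lin g x = g.linear x := rfl

theorem continuous_aff (g : Aff n) : Continuous g := by
  have : (g : E n → E n) = fun x => lin g x + g 0 := funext fun x => apply_eq g x
  rw [this]
  fun_prop

theorem norm_lin_le {g : Aff n} (hg : Isometry g) : ‖lin g‖ ≤ 1 :=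
  ContinuousLinearMap.opNorm_le_bound _ zero_le_one fun x => by
    rw [lin_apply, norm_linear_of_isometry hg, one_mul]

end basics

/-! ## Discrete groups of isometries -/

/-- A discrete group of isometries of Euclidean space. -/
structure IsDiscreteIsom {n : ℕ} (G : Subgroup (Aff n)) : Prop where
  isometry : ∀ γ ∈ G, Isometry γ
  discrete : ∃ ε : ℝ, 0 < ε ∧ ∀ γ ∈ G, ‖γ 0‖ < ε →
    (∀ x : E n, ‖γ.linear x - x‖ ≤ ε * ‖x‖) → γ = 1

theorem IsSpaceGroup.isDiscreteIsom {n : ℕ} {G : Subgroup (Aff n)} (h : IsSpaceGroup G) :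
    IsDiscreteIsom G := ⟨h.isometry, h.discrete⟩

theorem IsDiscreteIsom.mono {n : ℕ} {G H : Subgroup (Aff n)} (h : IsDiscreteIsom G) (hH : H ≤ G) :
    IsDiscreteIsom H :=
  ⟨fun γ hγ => h.isometry γ (hH hγ), h.discrete.imp fun _ hε => ⟨hε.1, fun γ hγ => hε.2 γ (hH hγ)⟩⟩

theorem norm_linear {n : ℕ} {G : Subgroup (Aff n)} (h : IsDiscreteIsom G) {g : Aff n} (hg : g ∈ G)
    (x : E n) : ‖g.linear x‖ = ‖x‖ := norm_linear_of_isometry (h.isometry g hg) x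

theorem exists_tendsto_lin {n : ℕ} (u : ℕ → Aff n) (hu : ∀ k, Isometry (u k)) :
    ∃ (L : E n →L[ℝ] E n) (φ : ℕ → ℕ), StrictMono φ ∧
      Tendsto (fun k => lin (u (φ k))) atTop (𝓝 L) := by
  have : ProperSpace (E n →L[ℝ] E n) := FiniteDimensional.proper ℝ _
  obtain ⟨L, -, φ, hφ, h⟩ := (isCompact_closedBall (0 : E n →L[ℝ] E n) 1).tendsto_subseq
    (x := fun k => lin (u k)) (fun k => by
      rw [mem_closedBall_zero_iff]; exact norm_lin_le (hu k))
  exact ⟨L, φ, hφ, h⟩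

/-- An infinite bounded set contains an injective sequence whose displacements and linear parts
converge along a subsequence; two late terms g, h then give h⁻¹g close to the identity, against
discreteness. -/
theorem finite_bounded {n : ℕ} {G : Subgroup (Aff n)} (hG : IsDiscreteIsom G) (R : ℝ) :
    {g : Aff n | g ∈ G ∧ ‖g 0‖ ≤ R}.Finite := by
  by_contra hinf
  have hinf : {g : Aff n | g ∈ G ∧ ‖g 0‖ ≤ R}.Infinite := hinf
  obtain ⟨ε, hε, hdisc⟩ := hG.discrete
  let u : ℕ → Aff n := fun k => (hinf.natEmbedding _ k).1
  have hu : ∀ k, u k ∈ G ∧ ‖u k 0‖ ≤ R := fun k => (hinf.natEmbedding _ k).2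
  have hinj : Function.Injective u := fun a b h =>
    (hinf.natEmbedding _).injective (Subtype.ext h)
  obtain ⟨L, φ, hφ, hL⟩ := exists_tendsto_lin u fun k => hG.isometry _ (hu k).1
  obtain ⟨a, -, χ, hχ, ha⟩ := (isCompact_closedBall (0 : E n) R).tendsto_subseq
    (x := fun k => u (φ k) 0) (fun k => by
      rw [mem_closedBall_zero_iff]; exact (hu _).2)
  have hL' := hL.comp hχ.tendsto_atTop
  have h1 := Metric.cauchySeq_iff.1 ha.cauchySeq ε hε
  have h2 := Metric.cauchySeq_iff.1 hL'.cauchySeq ε hε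
  obtain ⟨N1, h1⟩ := h1
  obtain ⟨N2, h2⟩ := h2
  let N := max N1 N2
  have d1 := h1 N (le_max_left _ _) (N + 1) ((le_max_left _ _).trans (Nat.le_succ _))
  have d2 := h2 N (le_max_right _ _) (N + 1) ((le_max_right _ _).trans (Nat.le_succ _))
  set g := u (φ (χ N)) with hgd
  set h := u (φ (χ (N + 1))) with hhd
  have hg : g ∈ G := (hu _).1
  have hh : h ∈ G := (hu _).1
  have hne : g ≠ h := fun e => absurd (hχ.injective (hφ.injective (hinj e))) (by omega)
  have key : h⁻¹ * g = 1 := by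
    refine hdisc _ (G.mul_mem (G.inv_mem hh) hg) ?_ fun x => ?_
    · rw [← norm_linear hG hh, ← sub_zero ((h⁻¹ * g) 0), ← apply_sub_apply, mul_apply',
        apply_inv_self', ← dist_eq_norm]
      exact d1
    · rw [← norm_linear hG hh, map_sub, mul_linear, linear_apply_inv]
      have : g.linear x - h.linear x = (lin g - lin h) x := rfl
      rw [this]
      refine ((lin g - lin h).le_opNorm x).trans ?_
      gcongr
      rw [← dist_eq_norm]
      exact d2.le
  exact hne (inv_mul_eq_one.1 key).symm

theorem countable_of_isDiscreteIsom {n : ℕ} {G : Subgroup (Aff n)} (hG : IsDiscreteIsom G) :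
    (G : Set (Aff n)).Countable := by
  have : (G : Set (Aff n)) = ⋃ k : ℕ, {g : Aff n | g ∈ G ∧ ‖g 0‖ ≤ k} := by
    ext g
    simp only [SetLike.mem_coe, Set.mem_iUnion, Set.mem_ofPred_eq, exists_and_left]
    exact ⟨fun h => ⟨h, exists_nat_ge _⟩, fun h => h.1⟩
  rw [this]
  exact Set.countable_iUnion fun k => (finite_bounded hG k).countable

/-! ## Cocompactness -/

theorem continuous_orb {n : ℕ} (G : Subgroup (Aff n)) : Continuous (orb G) := continuous_quot_mk

instance {n : ℕ} (G : Subgroup (Aff n)) : ContinuousConstSMul G (E n) :=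
  ⟨fun g => continuous_aff (g : Aff n)⟩

/-- The metric form in which cocompactness is used. Images of open balls form a directed open cover
of the orbit space, so compactness selects a single ball. -/
theorem compactSpace_orb_iff {n : ℕ} (G : Subgroup (Aff n)) :
    CompactSpace (Orb G) ↔ ∃ R : ℝ, ∀ x : E n, ∃ g ∈ G, ‖g x‖ ≤ R := by
  constructor
  · intro h
    have hopen : IsOpenMap (orb G) := isOpenMap_quotient_mk'_mul
    obtain ⟨t, ht⟩ := (isCompact_univ (X := Orb G)).elim_directed_cover
      (fun k : ℕ => orb G '' Metric.ball 0 k) (fun k => hopen _ Metric.isOpen_ball)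
      (fun y _ => by
        obtain ⟨x, rfl⟩ := Quotient.exists_rep y
        obtain ⟨k, hk⟩ := exists_nat_gt ‖x‖
        exact Set.mem_iUnion.2 ⟨k, x, by simpa using hk, rfl⟩)
      (by
        refine (monotone_nat_of_le_succ fun k => Set.image_mono ?_).directed_le
        exact Metric.ball_subset_ball (by simp))
    refine ⟨t, fun x => ?_⟩
    obtain ⟨y, hy, hyx⟩ := ht (Set.mem_univ (orb G x))
    obtain ⟨g, hg, rfl⟩ := orb_eq_iff.1 hyx
    exact ⟨g, hg, (by simpa using hy : _ < _).le⟩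
  · rintro ⟨R, hR⟩
    have : (Set.univ : Set (Orb G)) = orb G '' Metric.closedBall 0 R := by
      refine (Set.eq_univ_of_forall fun y => ?_).symm
      obtain ⟨x, rfl⟩ := Quotient.exists_rep y
      obtain ⟨g, hg, h⟩ := hR x
      exact ⟨g x, by simpa using h, orb_eq_iff.2 ⟨g, hg, rfl⟩⟩
    refine ⟨?_⟩
    rw [this]
    exact (isCompact_closedBall 0 R).image (continuous_orb G)

/-! ## Bieberbach's first theorem -/

/-- Elements of a space group with small rotational part exist in every direction. -/
theorem exists_small_rotation {n : ℕ} {M : Subgroup (Aff n)} (hM : IsSpaceGroup M) (u : E n)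
    {ε : ℝ} (hε : 0 < ε) :
    ∃ β ∈ M, ∃ t : ℝ, 0 < t ∧ ‖β 0 - t • u‖ ≤ ε * t ∧ ‖lin β - 1‖ ≤ ε := by
  obtain ⟨R, hR⟩ := (compactSpace_orb_iff M).1 hM.cocompact
  have hD := hM.isDiscreteIsom
  choose g hg hgR using fun k : ℕ => hR ((k : ℝ) • u)
  have hh : ∀ k, (g k)⁻¹ ∈ M := fun k => M.inv_mem (hg k)
  have hhR : ∀ k : ℕ, ‖(g k)⁻¹ 0 - (k : ℝ) • u‖ ≤ R := fun k => by
    rw [← norm_linear hD (hg k), ← apply_sub_apply, apply_inv_self', zero_sub, norm_neg]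
    exact hgR k
  obtain ⟨L, φ, hφ, hL⟩ := exists_tendsto_lin (fun k => (g k)⁻¹) fun k => hM.isometry _ (hh k)
  -- A quotient of two late terms has rotational part near the identity. One term stays fixed at N;
  -- the other goes so far out that the bounded error ‖b‖ + R is at most ε times the distance.
  obtain ⟨N, hN⟩ := Metric.cauchySeq_iff.1 hL.cauchySeq ε hε
  set b := g (φ N) 0 with hb
  obtain ⟨K, hK⟩ := exists_nat_gt ((‖b‖ + R) / ε)
  set j := max N (K + 1)
  have hφj : (K : ℝ) + 1 ≤ φ j := by
    have : K + 1 ≤ φ j := (le_max_right _ _).trans (hφ.id_le j)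
    exact_mod_cast this
  refine ⟨(g (φ j))⁻¹ * g (φ N), M.mul_mem (hh _) (hg _), (φ j : ℝ), ?_, ?_, ?_⟩
  · have : (0 : ℝ) ≤ K := K.cast_nonneg
    linarith
  · rw [mul_apply', ← hb, apply_eq, add_sub_assoc]
    refine (norm_add_le _ _).trans ?_
    rw [norm_linear hD (hh _)]
    rw [div_lt_iff₀ hε] at hK
    have := hhR (φ j)
    nlinarith
  · refine ContinuousLinearMap.opNorm_le_bound _ hε.le fun x => ?_
    set y := (g (φ N)).linear x with hy
    have hx : x = (g (φ N))⁻¹.linear y := (linear_inv_apply _ _).symm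
    have hxy : ‖x‖ = ‖y‖ := (norm_linear hD (hg _) x).symm
    have e : (lin ((g (φ j))⁻¹ * g (φ N)) - 1) x
        = (lin (g (φ j))⁻¹ - lin (g (φ N))⁻¹) y := by
      change (g (φ j))⁻¹.linear ((g (φ N)).linear x) - x = (g (φ j))⁻¹.linear y - (g (φ N))⁻¹.linear y
      rw [← hy, ← hx]
    rw [e, hxy]
    refine (ContinuousLinearMap.le_opNorm _ y).trans ?_
    gcongr
    rw [← dist_eq_norm]
    exact (hN j (le_max_left _ _) N le_rfl).le

/-! ### Norm-attaining subspaces of normal operators -/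

section spectral

variable {V : Type*} [NormedAddCommGroup V] [InnerProductSpace ℝ V] [FiniteDimensional ℝ V]

open ContinuousLinearMap

theorem exists_norm_max_on (T : V →L[ℝ] V) {F : Submodule ℝ V} (hF : F ≠ ⊥) :
    ∃ x ∈ F, ‖x‖ = 1 ∧ ∀ y ∈ F, ‖T y‖ ≤ ‖T x‖ * ‖y‖ := by
  have : ProperSpace V := FiniteDimensional.proper ℝ V
  obtain ⟨z, hz, hz0⟩ := F.exists_mem_ne_zero_of_ne_bot hF
  have hnorm : ∀ y ∈ F, y ≠ 0 → ‖y‖⁻¹ • y ∈ Metric.sphere (0 : V) 1 ∩ F := fun y hy hy0 =>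
    ⟨by simp [norm_smul, hy0], F.smul_mem _ hy⟩
  have hK : IsCompact (Metric.sphere (0 : V) 1 ∩ F) :=
    (isCompact_sphere 0 1).inter_right F.closed_of_finiteDimensional
  obtain ⟨x, hx, hmax⟩ := hK.exists_isMaxOn ⟨_, hnorm z hz hz0⟩ (f := fun x => ‖T x‖)
    (by fun_prop)
  refine ⟨x, hx.2, by simpa using hx.1, fun y hy => ?_⟩
  rcases eq_or_ne y 0 with rfl | hy0
  · simp
  have h := hmax (hnorm y hy hy0)
  simp only [Set.mem_ofPred_eq, map_smul, norm_smul, norm_inv, norm_norm] at h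
  rwa [inv_mul_le_iff₀ (norm_pos_iff.2 hy0), mul_comm] at h

/-- The subspace on which a nonzero normal operator attains its norm, with the gap between the norm
of the operator and that of its restriction to the orthogonal complement. -/
theorem exists_max_subspace (D : V →L[ℝ] V) (hD : adjoint D * D = D * adjoint D) (h0 : D ≠ 0) :
    ∃ (W : Submodule ℝ V) (c : ℝ), W ≠ ⊥ ∧ 0 ≤ c ∧ c < ‖D‖ ∧ (∀ x ∈ W, D x ∈ W) ∧
      (∀ x ∈ Wᗮ, D x ∈ Wᗮ) ∧ (∀ x ∈ W, ‖D x‖ = ‖D‖ * ‖x‖) ∧ ∀ x ∈ Wᗮ, ‖D x‖ ≤ c * ‖x‖ := by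
  set S := adjoint D * D with hS
  -- The eigenspace of D*D for ‖D‖². Since D is normal, D and its adjoint preserve W, hence D
  -- preserves the orthogonal complement.
  let W : Submodule ℝ V := LinearMap.ker (S - (‖D‖ ^ 2) • (1 : V →L[ℝ] V)).toLinearMap
  have memW : ∀ x, x ∈ W ↔ S x = ‖D‖ ^ 2 • x := fun x => by
    simp [W, sub_eq_zero]
  have hSx : ∀ x, inner ℝ (S x) x = ‖D x‖ ^ 2 := fun x => by
    rw [hS, mul_apply_eq_comp, adjoint_inner_left, real_inner_self_eq_norm_sq]
  -- For such x the square of ‖S x − ‖D‖² x‖ expands to ‖S x‖² − ‖D‖⁴, which is at most 0.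
  have attain : ∀ x, ‖x‖ = 1 → ‖D x‖ = ‖D‖ → x ∈ W := by
    intro x hx hDx
    rw [memW, ← sub_eq_zero, ← norm_eq_zero, ← sq_eq_zero_iff]
    refine le_antisymm ?_ (sq_nonneg _)
    rw [norm_sub_sq_real, inner_smul_right, hSx, hDx, norm_smul, hx]
    have hle : ‖S x‖ ≤ ‖D‖ ^ 2 := by
      have := (adjoint D).le_opNorm (D x)
      rw [hDx, LinearIsometryEquiv.norm_map, ← sq] at this
      exact this
    have h2 : ‖S x‖ ^ 2 ≤ (‖D‖ ^ 2) ^ 2 := by gcongr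
    have h3 : ‖‖D‖ ^ 2‖ = ‖D‖ ^ 2 := by simp
    rw [h3]
    nlinarith
  have hDS : ∀ x, S (D x) = D (S x) := fun x => by
    have : S * D = D * S := by rw [hS, ← mul_assoc, ← hD]
    exact DFunLike.congr_fun this x
  have hDS' : ∀ x, S (adjoint D x) = adjoint D (S x) := fun x => by
    have : S * adjoint D = adjoint D * S := by rw [hS, mul_assoc, ← hD]
    exact DFunLike.congr_fun this x
  have invW : ∀ x ∈ W, D x ∈ W := fun x hx => by
    rw [memW] at hx ⊢
    rw [hDS, hx, map_smul]
  have invW' : ∀ x ∈ W, adjoint D x ∈ W := fun x hx => by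
    rw [memW] at hx ⊢
    rw [hDS', hx, map_smul]
  have normW : ∀ x ∈ W, ‖D x‖ = ‖D‖ * ‖x‖ := fun x hx => by
    have h := hSx x
    rw [(memW x).1 hx, inner_smul_left, real_inner_self_eq_norm_sq] at h
    rw [← sq_eq_sq₀ (norm_nonneg _) (by positivity), ← h, mul_pow]
    simp
  have htop : (⊤ : Submodule ℝ V) ≠ ⊥ := by
    intro h
    refine h0 (ContinuousLinearMap.ext fun x => ?_)
    have : x ∈ (⊥ : Submodule ℝ V) := h ▸ Submodule.mem_top
    rw [(Submodule.mem_bot ℝ).1 this, map_zero, map_zero]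
  have hWbot : W ≠ ⊥ := by
    obtain ⟨x, -, hx1, hx⟩ := exists_norm_max_on D htop
    have hDx : ‖D x‖ = ‖D‖ := by
      refine le_antisymm ?_ (D.opNorm_le_bound (norm_nonneg _) fun y => hx y trivial)
      simpa [hx1] using D.le_opNorm x
    intro h
    have : x ∈ (⊥ : Submodule ℝ V) := h ▸ attain x hx1 hDx
    rw [(Submodule.mem_bot ℝ).1 this] at hx1
    simp at hx1
  have invO : ∀ x ∈ Wᗮ, D x ∈ Wᗮ := fun x hx y hy => by
    rw [← adjoint_inner_left]
    exact hx _ (invW' y hy)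
  rcases eq_or_ne Wᗮ ⊥ with hO | hO
  · refine ⟨W, 0, hWbot, le_rfl, norm_pos_iff.2 h0, invW, invO, normW, fun x hx => ?_⟩
    rw [hO] at hx
    simp [(Submodule.mem_bot ℝ).1 hx]
  -- The gap: a unit vector of the complement that attained ‖D‖ would also lie in W.
  · obtain ⟨x, hxO, hx1, hx⟩ := exists_norm_max_on D hO
    refine ⟨W, ‖D x‖, hWbot, norm_nonneg _, lt_of_le_of_ne ?_ fun h => ?_, invW, invO, normW, hx⟩
    · simpa [hx1] using D.le_opNorm x
    · have := hxO x (attain x hx1 h)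
      rw [real_inner_self_eq_norm_sq, hx1] at this
      norm_num at this

end spectral

theorem lin_adjoint_mul {n : ℕ} {g : Aff n} (hg : ∀ x, ‖g.linear x‖ = ‖x‖) :
    ContinuousLinearMap.adjoint (lin g) = lin g⁻¹ := by
  have hin : ∀ x y, inner ℝ (g.linear x) (g.linear y) = inner ℝ x y :=
    (LinearMap.norm_map_iff_inner_map_map g.linear).1 hg
  refine ((ContinuousLinearMap.eq_adjoint_iff _ _).2 fun x y => ?_).symm
  rw [lin_apply, lin_apply, ← hin, linear_apply_inv]

/-- An orthogonal map commutes with its inverse, which is its adjoint. This makes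
`exists_max_subspace` applicable to the deviation from the identity. -/
theorem lin_sub_one_normal {n : ℕ} {g : Aff n} (hg : ∀ x, ‖g.linear x‖ = ‖x‖) :
    ContinuousLinearMap.adjoint (lin g - 1) * (lin g - 1) =
      (lin g - 1) * ContinuousLinearMap.adjoint (lin g - 1) := by
  have h1 : ContinuousLinearMap.adjoint (1 : E n →L[ℝ] E n) = 1 :=
    ContinuousLinearMap.adjoint_id
  have h2 : lin g⁻¹ * lin g = 1 := ContinuousLinearMap.ext fun x => linear_inv_apply g x
  have h3 : lin g * lin g⁻¹ = 1 := ContinuousLinearMap.ext fun x => linear_apply_inv g x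
  rw [map_sub, h1, lin_adjoint_mul hg]
  simp only [sub_mul, mul_sub, h2, h3, mul_one, one_mul]
  abel

/-- The elements of a space group with small rotational part are translations. -/
theorem lin_eq_one_of_small {n : ℕ} {M : Subgroup (Aff n)} (hM : IsSpaceGroup M) {α : Aff n}
    (hα : α ∈ M) (hsmall : ‖lin α - 1‖ ≤ 1 / 2) : lin α = 1 := by
  have hI := hM.isDiscreteIsom
  by_contra hne
  -- an element with the least displacement of the origin
  have exmin : ∀ P : Aff n → Prop, (∃ g ∈ M, P g) →
      ∃ g ∈ M, P g ∧ ∀ h ∈ M, P h → ‖g 0‖ ≤ ‖h 0‖ := by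
    rintro P ⟨g, hg, hP⟩
    have hfin : {h : Aff n | (h ∈ M ∧ ‖h 0‖ ≤ ‖g 0‖) ∧ P h}.Finite :=
      (finite_bounded hI ‖g 0‖).subset fun h hh => hh.1
    obtain ⟨g', hg', hmin⟩ := hfin.exists_minimalFor (fun h => ‖h 0‖) _ ⟨g, ⟨hg, le_rfl⟩, hP⟩
    refine ⟨g', hg'.1.1, hg'.2, fun h hh hPh => ?_⟩
    by_contra hlt
    rw [not_le] at hlt
    exact absurd (hmin ⟨⟨hh, hlt.le.trans hg'.1.2⟩, hPh⟩ hlt.le) (not_le.2 hlt)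
  -- A counterexample α of least displacement is set against an element β of least displacement that
  -- has a tiny rotational part and moves the origin mainly along the space W where lin α − 1
  -- attains its norm. Their commutator will contradict the choice of β.
  obtain ⟨α, hα, ⟨hsmall, hne⟩, hαmin⟩ :=
    exmin (fun g => ‖lin g - 1‖ ≤ 1 / 2 ∧ lin g ≠ 1) ⟨α, hα, hsmall, hne⟩
  have hαn := norm_linear hI hα
  set D := lin α - 1 with hD
  obtain ⟨W, c, hW, hc0, hc, invW, invO, normW, normO⟩ :=
    exists_max_subspace D (lin_sub_one_normal hαn) (sub_ne_zero.2 hne)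
  set m := ‖D‖ with hm
  set P := W.starProjection with hP
  have hsplit : ∀ x, P x + (x - P x) = x := fun x => by abel
  have hPmem : ∀ x, P x ∈ W := fun x => W.starProjection_apply_mem x
  have hQmem : ∀ x, x - P x ∈ Wᗮ := fun x => W.sub_starProjection_mem_orthogonal x
  have hPD : ∀ x, P (D x) = D (P x) := fun x => by
    refine Submodule.eq_starProjection_of_mem_orthogonal (invW _ (hPmem x)) ?_
    rw [← map_sub]
    exact invO _ (hQmem x)
  have hPle : ∀ x, ‖P x‖ ≤ ‖x‖ := fun x => W.norm_starProjection_apply_le x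
  have hQle : ∀ x, ‖x - P x‖ ≤ ‖x‖ := fun x => by
    have := Wᗮ.norm_starProjection_apply_le x
    rwa [Submodule.starProjection_orthogonal'] at this
  -- Two errors of size κ‖b‖ add up to (m − c)/4 · ‖b‖, which the gap between c and m absorbs; also
  -- κ ≤ 1/2, so the minimality of α applies to β.
  set κ := (m - c) / 8 with hκ
  have hκ0 : 0 < κ := by rw [hκ]; linarith
  obtain ⟨u, hu, hu0⟩ := W.exists_mem_ne_zero_of_ne_bot hW
  obtain ⟨β, hβ, ⟨hβκ, hβ0⟩, hβmin⟩ :=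
    exmin (fun g => ‖lin g - 1‖ ≤ κ ∧ ‖g 0 - P (g 0)‖ < ‖P (g 0)‖) (by
      -- Moving in a direction u of W with precision ‖u‖/3 leaves at most t‖u‖/3 off W and at least
      -- 2t‖u‖/3 along W.
      have hupos := norm_pos_iff.2 hu0
      obtain ⟨β, hβ, t, ht, h1, h2⟩ :=
        exists_small_rotation hM u (ε := min κ (‖u‖ / 3)) (lt_min hκ0 (by positivity))
      have h1' : ‖β 0 - t • u‖ ≤ ‖u‖ / 3 * t := h1.trans (by gcongr; exact min_le_right _ _)
      refine ⟨β, hβ, h2.trans (min_le_left _ _), ?_⟩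
      have hPu : P (t • u) = t • u :=
        Submodule.starProjection_eq_self_iff.2 (W.smul_mem _ hu)
      have e1 : P (β 0) = t • u + P (β 0 - t • u) := by rw [map_sub, hPu]; abel
      have e2 : β 0 - P (β 0) = (β 0 - t • u) - P (β 0 - t • u) := by
        rw [map_sub, hPu]; abel
      have h3 : ‖β 0 - P (β 0)‖ ≤ ‖u‖ / 3 * t := by rw [e2]; exact (hQle _).trans h1'
      have h4 : ‖t • u‖ - ‖P (β 0 - t • u)‖ ≤ ‖P (β 0)‖ := by
        rw [e1]
        have := norm_sub_norm_le (t • u) (-P (β 0 - t • u))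
        rwa [norm_neg, sub_neg_eq_add] at this
      have h5 := (hPle (β 0 - t • u)).trans h1'
      rw [norm_smul, Real.norm_of_nonneg ht.le] at h4
      have : 0 < ‖u‖ * t := by positivity
      nlinarith)
  have hβn := norm_linear hI hβ
  set b := β 0 with hb
  set γ := α * β * α⁻¹ * β⁻¹ with hγ
  have hγM : γ ∈ M := M.mul_mem (M.mul_mem (M.mul_mem hα hβ) (M.inv_mem hα)) (M.inv_mem hβ)
  have hγe : γ * (β * α) = α * β := by rw [hγ]; group
  -- the rotational part of the commutator
  have hγlin : ‖lin γ - 1‖ ≤ ‖lin β - 1‖ := by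
    refine ContinuousLinearMap.opNorm_le_bound _ (norm_nonneg _) fun x => ?_
    set y := (β * α)⁻¹.linear x with hy
    have hx : x = β.linear (α.linear y) := (linear_apply_inv (β * α) x).symm
    have hxy : ‖x‖ = ‖y‖ := by rw [hx, hβn, hαn]
    -- Up to an orthogonal change of variable, the deviation of the commutator is the commutator of
    -- the deviations; its norm is at most 2 · 1/2 · ‖lin β − 1‖.
    have e : (lin γ - 1) x = D ((lin β - 1) y) - (lin β - 1) (D y) := by
      have h : γ.linear (β.linear (α.linear y)) = α.linear (β.linear y) :=
        congrArg (fun g : Aff n => g.linear y) hγe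
      change γ.linear x - x = (α.linear (β.linear y - y) - (β.linear y - y)) -
        (β.linear (α.linear y - y) - (α.linear y - y))
      rw [hx, h, map_sub, map_sub]
      abel
    rw [e, hxy]
    have h1 := D.le_opNorm ((lin β - 1) y)
    have h2 := (lin β - 1).le_opNorm (D y)
    have h3 := D.le_opNorm y
    have h4 := (lin β - 1).le_opNorm y
    rw [← hm] at h1 h3
    have h6 : ‖D ((lin β - 1) y)‖ ≤ 1 / 2 * (‖lin β - 1‖ * ‖y‖) := h1.trans (by gcongr)
    have h7 : ‖(lin β - 1) (D y)‖ ≤ ‖lin β - 1‖ * (1 / 2 * ‖y‖) :=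
      h2.trans (by gcongr; exact h3.trans (by gcongr))
    refine (norm_sub_le _ _).trans ?_
    linarith
  -- The commutator moves the origin by D b up to the error r. If β is a translation then r = 0;
  -- otherwise the minimality of α bounds ‖α 0‖ by ‖b‖.
  set r := γ 0 - D b with hr
  have hre : r = (b - γ.linear b) + (α 0 - γ.linear (β.linear (α 0))) := by
    have h : γ (β (α 0)) = α b := DFunLike.congr_fun hγe (0 : E n)
    rw [apply_eq γ, apply_eq β, map_add, apply_eq α b, ← hb] at h
    have h' : γ 0 = α.linear b + α 0 - (γ.linear (β.linear (α 0)) + γ.linear b) := by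
      rw [← h]; abel
    rw [hr, h']
    change _ - (α.linear b - b) = _
    abel
  have hrle : ‖r‖ ≤ (m - c) / 4 * ‖b‖ := by
    by_cases h1 : lin β = 1
    · have hγ1 : ∀ x, γ.linear x = x := fun x => by
        have : lin γ - 1 = 0 := by
          rw [← norm_le_zero_iff]
          simpa [h1] using hγlin
        simpa using DFunLike.congr_fun (sub_eq_zero.1 this) x
      have hβ1 : ∀ x, β.linear x = x := fun x => by
        simpa using DFunLike.congr_fun h1 x
      rw [hre, hγ1, hγ1, hβ1]
      simp only [sub_self, add_zero, norm_zero]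
      have : 0 < m - c := by linarith
      positivity
    · have hab : ‖α 0‖ ≤ ‖b‖ := hαmin β hβ ⟨hβκ.trans (by rw [hκ]; linarith), h1⟩
      rw [hre]
      refine (norm_add_le _ _).trans ?_
      have h2 : ‖b - γ.linear b‖ ≤ κ * ‖b‖ := by
        rw [norm_sub_rev]
        exact ((lin γ - 1).le_opNorm b).trans (by gcongr; exact hγlin.trans hβκ)
      have h3 : ‖α 0 - γ.linear (β.linear (α 0))‖ ≤ κ * ‖b‖ := by
        set y := α⁻¹.linear (α 0) with hy
        have hαy : α 0 = α.linear y := (linear_apply_inv α _).symm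
        have hyn : ‖y‖ = ‖α 0‖ := by rw [hαy, hαn]
        have h : γ.linear (β.linear (α.linear y)) = α.linear (β.linear y) :=
          congrArg (fun g : Aff n => g.linear y) hγe
        rw [hαy, h, ← map_sub, hαn, norm_sub_rev]
        refine ((lin β - 1).le_opNorm y).trans ?_
        rw [hyn]
        gcongr
      calc _ ≤ κ * ‖b‖ + κ * ‖b‖ := add_le_add h2 h3
        _ = _ := by rw [hκ]; ring
  have hγ0 : γ 0 = D b + r := by rw [hr]; abel
  have hbsum : ‖b‖ ≤ ‖P b‖ + ‖b - P b‖ := by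
    conv_lhs => rw [← hsplit b]
    exact norm_add_le _ _
  have hpb : 0 < ‖P b‖ := (norm_nonneg _).trans_lt hβ0
  have hbpos : 0 < ‖b‖ := hpb.trans_le (hPle b)
  have hmc : 0 < m - c := by linarith
  -- Here ‖b‖ < 2‖P b‖. The component of γ 0 along W therefore still dominates, while γ 0 is shorter
  -- than b.
  have hr2 : 2 * ‖r‖ < (m - c) * ‖P b‖ := by nlinarith
  have hγP : m * ‖P b‖ - ‖r‖ ≤ ‖P (γ 0)‖ := by
    rw [hγ0, map_add, hPD, ← normW _ (hPmem b)]
    have := norm_sub_norm_le (D (P b)) (-P r)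
    rw [norm_neg, sub_neg_eq_add] at this
    linarith [hPle r]
  have hγQ : ‖γ 0 - P (γ 0)‖ ≤ c * ‖b - P b‖ + ‖r‖ := by
    have hPγ : P (γ 0) = D (P b) + P r := by rw [hγ0, map_add, hPD]
    have e : γ 0 - P (γ 0) = D (b - P b) + (r - P r) := by
      rw [hPγ, map_sub D b (P b), hγ0]; abel
    rw [e]
    exact (norm_add_le _ _).trans (add_le_add (normO _ (hQmem b)) (hQle r))
  have hlt : ‖γ 0‖ < ‖b‖ := by
    rw [hγ0]
    refine (norm_add_le _ _).trans_lt ?_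
    have := D.le_opNorm b
    rw [← hm] at this
    nlinarith
  refine absurd (hβmin γ hγM ⟨hγlin.trans hβκ, ?_⟩) (not_le.2 hlt)
  nlinarith

/-- Bieberbach's first theorem: the translations of a space group span. -/
theorem span_eq_top {n : ℕ} {M : Subgroup (Aff n)} (hM : IsSpaceGroup M) : span M = ⊤ := by
  by_contra h
  have h' : (span M)ᗮ ≠ ⊥ := fun e => h (Submodule.orthogonal_eq_bot_iff.1 e)
  obtain ⟨u, hu, hu0⟩ := (span M)ᗮ.exists_mem_ne_zero_of_ne_bot h'
  have hupos := norm_pos_iff.2 hu0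
  -- The bound 1/2 makes β a translation; the bound ‖u‖/2 puts its vector too close to t u to be
  -- orthogonal to u.
  obtain ⟨β, hβ, t, ht, h1, h2⟩ := exists_small_rotation hM u (ε := min (1 / 2) (‖u‖ / 2))
    (lt_min (by norm_num) (by positivity))
  have hl := lin_eq_one_of_small hM hβ (h2.trans (min_le_left _ _))
  have hβt : β = transl (β 0) := eq_transl fun x => by simpa using DFunLike.congr_fun hl x
  have hmem : β 0 ∈ span M := Submodule.subset_span (by
    change transl (β 0) ∈ M
    rwa [← hβt])
  have horth : inner ℝ (β 0) u = 0 := hu _ hmem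
  have h3 : ‖β 0 - t • u‖ ≤ ‖u‖ / 2 * t := h1.trans (by gcongr; exact min_le_right _ _)
  have h4 : ‖β 0 - t • u‖ ^ 2 = ‖β 0‖ ^ 2 + (t * ‖u‖) ^ 2 := by
    rw [norm_sub_sq_real, inner_smul_right, horth, norm_smul, Real.norm_of_nonneg ht.le]
    ring
  have h5 : ‖β 0 - t • u‖ ^ 2 ≤ (‖u‖ / 2 * t) ^ 2 := by gcongr
  have h6 : 0 < t * ‖u‖ := by positivity
  nlinarith [sq_nonneg ‖β 0‖]

/-! ## Translation lattices and point groups -/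

/-- The vectors of the translations of a group of affinities. -/
def translVec {n : ℕ} (G : Subgroup (Aff n)) : AddSubgroup (E n) where
  carrier := {a | transl a ∈ G}
  zero_mem' := by
    change transl 0 ∈ G
    rw [transl_zero]; exact G.one_mem
  add_mem' {a b} ha hb := by
    change transl (a + b) ∈ G
    rw [← transl_mul]; exact G.mul_mem ha hb
  neg_mem' {a} ha := by
    change transl (-a) ∈ G
    rw [← transl_inv]; exact G.inv_mem ha

theorem mem_translVec {n : ℕ} {G : Subgroup (Aff n)} {a : E n} : a ∈ translVec G ↔ transl a ∈ G :=
  Iff.rfl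

/-- The elements of `G` that displace the origin by at most `R`. -/
abbrev bounded {n : ℕ} (G : Subgroup (Aff n)) (R : ℝ) : Set (Aff n) := {g | g ∈ G ∧ ‖g 0‖ ≤ R}

/-- Coordinates with respect to a finite spanning set of translation vectors are rounded down; R is
the sum of the lengths of these vectors. -/
theorem exists_transl_near {n : ℕ} (G : Subgroup (Aff n)) : ∃ R : ℝ, ∀ v ∈ span G,
    ∃ a, transl a ∈ Subgroup.closure (bounded G R) ∧ ‖v - a‖ ≤ R := by
  obtain ⟨s, hs, hspan⟩ := Submodule.fg_span_iff_fg_span_finset_subset {a : E n | transl a ∈ G}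
    |>.1 (IsNoetherian.noetherian (Submodule.span ℝ {a : E n | transl a ∈ G}))
  refine ⟨∑ a ∈ s, ‖a‖, fun v hv => ?_⟩
  have hv' : v ∈ Submodule.span ℝ (s : Set (E n)) := hspan ▸ hv
  obtain ⟨f, -, rfl⟩ := Submodule.mem_span_finset.1 hv'
  refine ⟨∑ a ∈ s, ⌊f a⌋ • a, ?_, ?_⟩
  · refine mem_translVec.1 (sum_mem fun a ha => zsmul_mem (mem_translVec.2 ?_) _)
    refine Subgroup.subset_closure ⟨hs ha, ?_⟩
    simpa [transl_apply] using Finset.single_le_sum (f := fun a => ‖a‖)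
      (fun a _ => norm_nonneg a) ha
  · rw [← Finset.sum_sub_distrib]
    refine (norm_sum_le _ _).trans (Finset.sum_le_sum fun a _ => ?_)
    rw [← Int.cast_smul_eq_zsmul ℝ, ← sub_smul, norm_smul]
    refine mul_le_of_le_one_left (norm_nonneg _) ?_
    rw [Int.self_sub_floor, Real.norm_of_nonneg (Int.fract_nonneg _)]
    exact (Int.fract_lt_one _).le

/-- Dividing an element by a translation close to its displacement leaves a bounded element with the
same linear part. The hypothesis holds for space groups by Bieberbach's first theorem, and for
complete normal subgroups by definition. -/
theorem exists_bounded_generators {n : ℕ} {G : Subgroup (Aff n)} (hG : ∀ g ∈ G, g 0 ∈ span G) :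
    ∃ R : ℝ, (G ≤ Subgroup.closure (bounded G R)) ∧
      ∀ g ∈ G, ∃ h ∈ G, ‖h 0‖ ≤ R ∧ ∀ x, h.linear x = g.linear x := by
  obtain ⟨R, hR⟩ := exists_transl_near G
  have hle : Subgroup.closure (bounded G R) ≤ G := by
    rw [Subgroup.closure_le]
    exact fun g hg => hg.1
  have key : ∀ g ∈ G, ∃ a, transl a ∈ Subgroup.closure (bounded G R) ∧
      transl (-a) * g ∈ bounded G R := fun g hg => by
    obtain ⟨a, ha, hb⟩ := hR (g 0) (hG g hg)
    refine ⟨a, ha, G.mul_mem ?_ hg, ?_⟩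
    · rw [← transl_inv]
      exact G.inv_mem (hle ha)
    · rw [mul_apply', transl_apply, neg_add_eq_sub]
      exact hb
  refine ⟨R, fun g hg => ?_, fun g hg => ?_⟩
  · obtain ⟨a, ha, hb⟩ := key g hg
    have : g = transl a * (transl (-a) * g) := by
      rw [← transl_inv, mul_inv_cancel_left]
    rw [this]
    exact Subgroup.mul_mem _ ha (Subgroup.subset_closure hb)
  · obtain ⟨a, ha, hb⟩ := key g hg
    exact ⟨_, hb.1, hb.2, fun x => rfl⟩

theorem finite_linear {n : ℕ} {G : Subgroup (Aff n)} (hD : IsDiscreteIsom G)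
    (hG : ∀ g ∈ G, g 0 ∈ span G) : {A | ∃ g ∈ G, lin g = A}.Finite := by
  obtain ⟨R, -, hR⟩ := exists_bounded_generators hG
  refine ((finite_bounded hD R).image lin).subset ?_
  rintro _ ⟨g, hg, rfl⟩
  obtain ⟨h, hh, hhR, hl⟩ := hR g hg
  exact ⟨h, ⟨hh, hhR⟩, ContinuousLinearMap.ext hl⟩

theorem mem_span_of_isSpaceGroup {n : ℕ} {M : Subgroup (Aff n)} (hM : IsSpaceGroup M) (x : E n) :
    x ∈ span M := by
  rw [span_eq_top hM]; trivial

/-- A linear identity on the translations of a space group holds everywhere. -/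
theorem eq_of_eq_on_transl {n : ℕ} {M : Subgroup (Aff n)} (hM : IsSpaceGroup M)
    {V : Type*} [AddCommGroup V] [Module ℝ V] {f g : E n →ₗ[ℝ] V}
    (h : ∀ a, transl a ∈ M → f a = g a) : f = g :=
  LinearMap.ext_on (s := {a | transl a ∈ M}) (span_eq_top hM) fun a ha => h a ha

/-- The vectors fixed by the point group lie in the span of the center. -/
theorem mem_span_center {n : ℕ} {M : Subgroup (Aff n)} (hM : IsSpaceGroup M) {w : E n}
    (hw : ∀ μ ∈ M, μ.linear w = w) : w ∈ span (center M) := by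
  have hfin := finite_linear hM.isDiscreteIsom fun g _ => mem_span_of_isSpaceGroup hM (g 0)
  set F := hfin.toFinset with hF
  have memF : ∀ A, A ∈ F ↔ ∃ g ∈ M, lin g = A := fun A => by simp [hF]
  -- Summation over the point group sends a translation vector of M to one that the point group
  -- fixes, hence to a central translation. On w the same sum is multiplication by the order of the
  -- point group.
  have key : ∀ x ∈ span M, (∑ A ∈ F, A x) ∈ span (center M) := by
    intro x hx
    induction hx using Submodule.span_induction with
    | mem a ha =>
      refine Submodule.subset_span ?_
      have hs : transl (∑ A ∈ F, A a) ∈ M := by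
        refine mem_translVec.1 (sum_mem fun A hA => ?_)
        obtain ⟨g, hg, rfl⟩ := (memF A).1 hA
        rw [mem_translVec, lin_apply, ← conj_transl]
        exact M.mul_mem (M.mul_mem hg ha) (M.inv_mem hg)
      refine ⟨⟨_, hs⟩, Subgroup.mem_center_iff.2 fun g => Subtype.ext ?_, rfl⟩
      change (g : Aff n) * transl _ = transl _ * (g : Aff n)
      rw [mul_transl]
      congr 2
      rw [map_sum]
      refine Finset.sum_nbij' (fun A => lin g * A) (fun A => lin (g : Aff n)⁻¹ * A) ?_ ?_ ?_ ?_ ?_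
      · intro A hA
        obtain ⟨h, hh, rfl⟩ := (memF A).1 hA
        exact (memF _).2 ⟨g * h, M.mul_mem g.2 hh, rfl⟩
      · intro A hA
        obtain ⟨h, hh, rfl⟩ := (memF A).1 hA
        exact (memF _).2 ⟨(g : Aff n)⁻¹ * h, M.mul_mem (M.inv_mem g.2) hh, rfl⟩
      · intro A _
        exact ContinuousLinearMap.ext fun x => linear_inv_apply (g : Aff n) (A x)
      · intro A _
        exact ContinuousLinearMap.ext fun x => linear_apply_inv (g : Aff n) (A x)
      · intro A _
        rfl
    | zero => simp
    | add x y _ _ hx hy =>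
      simp only [map_add, Finset.sum_add_distrib]
      exact add_mem hx hy
    | smul c x _ hx =>
      simp only [map_smul, ← Finset.smul_sum]
      exact Submodule.smul_mem _ _ hx
  have hsum : ∑ A ∈ F, A w = (F.card : ℝ) • w := by
    rw [Finset.sum_congr rfl (g := fun _ => w), Finset.sum_const, Nat.cast_smul_eq_nsmul]
    intro A hA
    obtain ⟨g, hg, rfl⟩ := (memF A).1 hA
    exact hw g hg
  have hcard : (F.card : ℝ) ≠ 0 := by
    have : 0 < F.card := Finset.card_pos.2 ⟨_, (memF _).2 ⟨1, M.one_mem, rfl⟩⟩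
    exact_mod_cast this.ne'
  have := Submodule.smul_mem _ (F.card : ℝ)⁻¹ (key w (mem_span_of_isSpaceGroup hM w))
  rwa [hsum, inv_smul_smul₀ hcard] at this

/-- The centralizer of a space group in the affine group consists of translations along the span of
the center. -/
theorem centralizer_eq {n : ℕ} {M : Subgroup (Aff n)} (hM : IsSpaceGroup M) {φ : Aff n}
    (hφ : ∀ μ ∈ M, φ * μ = μ * φ) : φ = transl (φ 0) ∧ φ 0 ∈ span (center M) := by
  have hl : ∀ x, φ.linear x = x := by
    -- Commuting with a translation means fixing its vector, and these vectors span.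
    have : φ.linear.toLinearMap = LinearMap.id := eq_of_eq_on_transl hM fun a ha => by
      have h := hφ _ ha
      rw [mul_transl] at h
      exact transl_injective (mul_right_cancel h)
    exact fun x => DFunLike.congr_fun this x
  have ht := eq_transl hl
  refine ⟨ht, mem_span_center hM fun μ hμ => ?_⟩
  have h := hφ μ hμ
  rw [ht, mul_transl] at h
  exact (transl_injective (mul_right_cancel h)).symm

/-! ## Affinities that act trivially on the orbit space -/

theorem eq_of_eqOn_open {n : ℕ} {f g : Aff n} {s : Set (E n)} (hs : (interior s).Nonempty)
    (h : ∀ x ∈ s, f x = g x) : f = g := by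
  obtain ⟨x, hx⟩ := hs
  obtain ⟨r, hr, hball⟩ := Metric.isOpen_iff.1 isOpen_interior x hx
  have hball : Metric.ball x r ⊆ s := hball.trans interior_subset
  have hx0 := h x (hball (Metric.mem_ball_self hr))
  have hl : ∀ y, f.linear y = g.linear y := by
    intro y
    obtain ⟨c, hc, hc'⟩ : ∃ c : ℝ, 0 < c ∧ c * ‖y‖ < r := by
      refine ⟨r / (‖y‖ + 1), by positivity, ?_⟩
      rw [div_mul_eq_mul_div, div_lt_iff₀ (by positivity)]
      nlinarith [norm_nonneg y]
    have hy := h (c • y + x) (hball (by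
      rw [Metric.mem_ball, dist_eq_norm, add_sub_cancel_right, norm_smul, Real.norm_of_nonneg hc.le]
      exact hc'))
    rw [apply_add, apply_add, hx0, add_left_inj, map_smul, map_smul] at hy
    exact smul_right_injective _ hc.ne' hy
  refine aff_ext ?_ hl
  have := hx0
  rwa [apply_eq f, apply_eq g, hl, add_right_inj] at this

/-- The closed sets on which φ agrees with a given element of the countable group G cover E^n. By
Baire one of them has interior points, and affinities that agree on an open set are equal. -/
theorem mem_of_orb_eq {n : ℕ} {G : Subgroup (Aff n)} (hG : IsDiscreteIsom G) {φ : Aff n}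
    (h : ∀ x, orb G (φ x) = orb G x) : φ ∈ G := by
  have : Countable G := (countable_of_isDiscreteIsom hG).to_subtype
  have hU : ⋃ g : G, {x | (g : Aff n) x = φ x} = Set.univ := by
    refine Set.eq_univ_of_forall fun x => ?_
    obtain ⟨g, hg, hx⟩ := orb_eq_iff.1 (h x)
    exact Set.mem_iUnion.2 ⟨⟨g, hg⟩, hx⟩
  obtain ⟨g, hg⟩ := nonempty_interior_of_iUnion_of_closed
    (fun g : G => isClosed_eq (continuous_aff (g : Aff n)) (continuous_aff φ)) hU
  rw [← eq_of_eqOn_open hg fun x hx => hx]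
  exact g.2

theorem orb_apply {n : ℕ} {G : Subgroup (Aff n)} {g : Aff n} (hg : g ∈ G) (x : E n) :
    orb G (g x) = orb G x := orb_eq_iff.2 ⟨g, hg, rfl⟩

/-- A lift of a bijection of the orbit space normalizes the group. -/
theorem mem_NA_of_lift {n : ℕ} {G : Subgroup (Aff n)} (hG : IsDiscreteIsom G)
    {β : Equiv.Perm (Orb G)} {φ : Aff n} (h : ∀ x, β (orb G x) = orb G (φ x)) : φ ∈ NA G := by
  rw [Subgroup.mem_normalizer_iff]
  intro g
  constructor
  · intro hg
    refine mem_of_orb_eq hG fun x => ?_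
    rw [mul_apply', mul_apply', ← h, orb_apply hg, h, apply_inv_self']
  · intro hg
    refine mem_of_orb_eq hG fun x => β.injective ?_
    rw [h, h, ← orb_apply hg (φ x), mul_apply', mul_apply', inv_apply_self']

end

/-! ## Bieberbach's second theorem -/

section second

variable {G : Type*} [Group G] {V W : Type*}
  [NormedAddCommGroup V] [NormedSpace ℝ V]
  [NormedAddCommGroup W] [NormedSpace ℝ W]

/-- An affine action with finitely many linear parts whose translations are discrete and span. -/
structure IsCrystal (ρ : G →* (V →ᵃ[ℝ] V)) : Prop where
  spans : Submodule.span ℝ {a | ∃ g, ∀ x, ρ g x = a + x} = ⊤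
  finite : {A | ∃ g, (ρ g).linear = A}.Finite
  discrete : ∃ ε : ℝ, 0 < ε ∧ ∀ g a, (∀ x, ρ g x = a + x) → ‖a‖ < ε → g = 1

theorem affineMap_apply_eq (f : V →ᵃ[ℝ] V) (x : V) : f x = f.linear x + f 0 := by
  simpa using f.map_vadd 0 x

theorem rep_mul (ρ : G →* (V →ᵃ[ℝ] V)) (g h : G) (x : V) : ρ (g * h) x = ρ g (ρ h x) := by
  rw [map_mul]; rfl

/-- The elements that act as translations. -/
def translKer (ρ : G →* (V →ᵃ[ℝ] V)) : Subgroup G := (AffineMap.linearHom.comp ρ).toHomUnits.ker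

theorem mem_translKer {ρ : G →* (V →ᵃ[ℝ] V)} {g : G} :
    g ∈ translKer ρ ↔ ∀ x, ρ g x = ρ g 0 + x := by
  unfold translKer
  rw [MonoidHom.mem_ker, Units.ext_iff]
  change (ρ g).linear = 1 ↔ _
  constructor
  · intro h x
    rw [affineMap_apply_eq, h, add_comm]; rfl
  · intro h
    ext x
    have := h x
    rw [affineMap_apply_eq, add_comm, add_right_inj] at this
    exact this

theorem finiteIndex_translKer {ρ : G →* (V →ᵃ[ℝ] V)} (hρ : IsCrystal ρ) :
    (translKer ρ).FiniteIndex := by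
  have : Finite (AffineMap.linearHom.comp ρ).toHomUnits.range := by
    refine Set.Finite.to_subtype (Set.Finite.of_finite_image (f := Units.val) (hρ.finite.subset ?_)
      Units.val_injective.injOn)
    rintro _ ⟨_, ⟨g, rfl⟩, rfl⟩
    exact ⟨g, rfl⟩
  exact Subgroup.finiteIndex_ker _

/-- The translation vectors of a group of elements that act as translations. -/
def vecHom (ρ : G →* (V →ᵃ[ℝ] V)) {T : Subgroup G} (hT : T ≤ translKer ρ) : Additive T →+ V where
  toFun t := ρ (t.toMul : G) 0
  map_zero' := by
    change ρ ((1 : T) : G) 0 = 0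
    rw [OneMemClass.coe_one, map_one]; rfl
  map_add' s t := by
    change ρ ((s.toMul * t.toMul : T) : G) 0 = _
    rw [Subgroup.coe_mul, rep_mul, mem_translKer.1 (hT s.toMul.2)]

theorem vecHom_injective {ρ : G →* (V →ᵃ[ℝ] V)} (hρ : IsCrystal ρ) {T : Subgroup G}
    (hT : T ≤ translKer ρ) : Function.Injective (vecHom ρ hT) := by
  rw [injective_iff_map_eq_zero]
  intro t ht
  obtain ⟨ε, hε, h⟩ := hρ.discrete
  refine Additive.toMul.injective (Subtype.ext ?_)
  exact h t.toMul _ (mem_translKer.1 (hT t.toMul.2)) (by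
    have : ρ (t.toMul : G) 0 = 0 := ht
    rw [this, norm_zero]; exact hε)

/-- The lattice of translation vectors. -/
def vecLattice (ρ : G →* (V →ᵃ[ℝ] V)) {T : Subgroup G} (hT : T ≤ translKer ρ) : Submodule ℤ V :=
  AddSubgroup.toIntSubmodule (vecHom ρ hT).range

theorem discrete_vecLattice {ρ : G →* (V →ᵃ[ℝ] V)} (hρ : IsCrystal ρ) {T : Subgroup G}
    (hT : T ≤ translKer ρ) : DiscreteTopology (vecLattice ρ hT) := by
  obtain ⟨ε, hε, h⟩ := hρ.discrete
  refine DiscreteTopology.of_forall_le_norm hε ?_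
  rintro ⟨x, t, rfl⟩ hx
  by_contra! hlt
  have h1 : (t.toMul : G) = 1 := h t.toMul _ (mem_translKer.1 (hT t.toMul.2)) hlt
  refine hx (Subtype.ext ?_)
  change ρ (t.toMul : G) 0 = 0
  rw [h1, map_one]; rfl

/-- A power of every translation lies in the subgroup T of finite index, so no direction is lost by
restricting to T. -/
theorem span_vecLattice {ρ : G →* (V →ᵃ[ℝ] V)} (hρ : IsCrystal ρ) {T : Subgroup G}
    (hT : T ≤ translKer ρ) [hf : T.FiniteIndex] [T.Normal] :
    Submodule.span ℝ (vecLattice ρ hT : Set V) = ⊤ := by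
  rw [eq_top_iff, ← hρ.spans, Submodule.span_le]
  rintro a ⟨g, hg⟩
  have hpow : ∀ k : ℕ, ρ (g ^ k) 0 = (k : ℝ) • a := by
    intro k
    induction k with
    | zero => rw [pow_zero, map_one, Nat.cast_zero, zero_smul]; rfl
    | succ k ih => rw [pow_succ', rep_mul, hg, ih, Nat.cast_succ, add_smul, one_smul, add_comm]
  have hmem := T.pow_index_mem g
  have h0 : (T.index : ℝ) ≠ 0 := by exact_mod_cast hf.index_ne_zero
  have : (T.index : ℝ) • a ∈ Submodule.span ℝ (vecLattice ρ hT : Set V) := by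
    rw [← hpow]
    exact Submodule.subset_span ⟨Additive.ofMul ⟨_, hmem⟩, rfl⟩
  have h2 := Submodule.smul_mem _ (T.index : ℝ)⁻¹ this
  rwa [inv_smul_smul₀ h0] at h2

variable [FiniteDimensional ℝ V] [FiniteDimensional ℝ W]

/-- A common group of translations of finite index determines a linear equivalence. -/
theorem exists_linearEquiv {ρ : G →* (V →ᵃ[ℝ] V)} {σ : G →* (W →ᵃ[ℝ] W)} (hρ : IsCrystal ρ)
    (hσ : IsCrystal σ) {T : Subgroup G} [T.FiniteIndex] [T.Normal] (h₁ : T ≤ translKer ρ)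
    (h₂ : T ≤ translKer σ) : ∃ L : V ≃ₗ[ℝ] W, ∀ t ∈ T, L (ρ t 0) = σ t 0 := by
  have := discrete_vecLattice hρ h₁
  have := discrete_vecLattice hσ h₂
  have : IsZLattice ℝ (vecLattice ρ h₁) := ⟨span_vecLattice hρ h₁⟩
  have : IsZLattice ℝ (vecLattice σ h₂) := ⟨span_vecLattice hσ h₂⟩
  let e₁ := AddMonoidHom.ofInjective (vecHom_injective hρ h₁)
  let e₂ := AddMonoidHom.ofInjective (vecHom_injective hσ h₂)
  -- Both lattices are copies of T. A ℤ-basis of the first and its image in the second are real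
  -- bases of V and W, and L matches them.
  let e : vecLattice ρ h₁ ≃ₗ[ℤ] vecLattice σ h₂ := (e₁.symm.trans e₂).toIntLinearEquiv
  have : Module.Free ℤ (vecLattice ρ h₁) := ZLattice.module_free ℝ _
  let b := Module.Free.chooseBasis ℤ (vecLattice ρ h₁)
  let b₁ := b.ofZLatticeBasis ℝ (vecLattice ρ h₁)
  let b₂ := (b.map e).ofZLatticeBasis ℝ (vecLattice σ h₂)
  let L := b₁.equiv b₂ (Equiv.refl _)
  have key : (L.toLinearMap.restrictScalars ℤ).comp (vecLattice ρ h₁).subtype =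
      (vecLattice σ h₂).subtype.comp e.toLinearMap := by
    refine b.ext fun i => ?_
    change L (b i : V) = e (b i)
    have hb : (b i : V) = b₁ i := (b.ofZLatticeBasis_apply ℝ _ i).symm
    rw [hb, Module.Basis.equiv_apply]
    change b₂ i = _
    rw [Module.Basis.ofZLatticeBasis_apply]
    rfl
  refine ⟨L, fun t ht => ?_⟩
  have h := DFunLike.congr_fun key (e₁ (Additive.ofMul ⟨t, ht⟩))
  have he : e (e₁ (Additive.ofMul ⟨t, ht⟩)) = e₂ (Additive.ofMul ⟨t, ht⟩) := by
    change e₂ (e₁.symm _) = _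
    rw [AddEquiv.symm_apply_apply]
  change L (ρ t 0) = (e (e₁ (Additive.ofMul ⟨t, ht⟩)) : W) at h
  rw [he] at h
  exact h

/-- Bieberbach's second theorem: two crystallographic actions of a group are affinely conjugate. -/
theorem exists_affineEquiv {ρ : G →* (V →ᵃ[ℝ] V)} {σ : G →* (W →ᵃ[ℝ] W)} (hρ : IsCrystal ρ)
    (hσ : IsCrystal σ) : ∃ φ : V ≃ᵃ[ℝ] W, ∀ g x, φ (ρ g x) = σ g (φ x) := by
  have := finiteIndex_translKer hρ
  have := finiteIndex_translKer hσ
  have n₁ : (translKer ρ).Normal := MonoidHom.normal_ker _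
  have n₂ : (translKer σ).Normal := MonoidHom.normal_ker _
  set T := translKer ρ ⊓ translKer σ with hTdef
  have nT : T.Normal := inferInstance
  have h₁ : T ≤ translKer ρ := inf_le_left
  have h₂ : T ≤ translKer σ := inf_le_right
  obtain ⟨L, hL⟩ := exists_linearEquiv hρ hσ h₁ h₂
  have conjρ : ∀ g, ∀ t ∈ T, ρ (g * t * g⁻¹) 0 = (ρ g).linear (ρ t 0) := by
    intro g t ht
    have h := rep_mul ρ (g * t * g⁻¹) g 0
    rw [mem_translKer.1 (h₁ (nT.conj_mem t ht g)), inv_mul_cancel_right, rep_mul,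
      affineMap_apply_eq (ρ g), add_left_inj] at h
    exact h.symm
  have conjσ : ∀ g, ∀ t ∈ T, σ (g * t * g⁻¹) 0 = (σ g).linear (σ t 0) := by
    intro g t ht
    have h := rep_mul σ (g * t * g⁻¹) g 0
    rw [mem_translKer.1 (h₂ (nT.conj_mem t ht g)), inv_mul_cancel_right, rep_mul,
      affineMap_apply_eq (σ g), add_left_inj] at h
    exact h.symm
  have equi : ∀ g x, L ((ρ g).linear x) = (σ g).linear (L x) := by
    intro g
    have : L.toLinearMap ∘ₗ (ρ g).linear = (σ g).linear ∘ₗ L.toLinearMap := by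
      refine LinearMap.ext_on (span_vecLattice hρ h₁) ?_
      rintro _ ⟨t, rfl⟩
      change L ((ρ g).linear (ρ t.toMul 0)) = (σ g).linear (L (ρ t.toMul 0))
      rw [← conjρ g _ t.toMul.2, hL _ (nT.conj_mem _ t.toMul.2 g), conjσ g _ t.toMul.2,
        hL _ t.toMul.2]
    exact fun x => DFunLike.congr_fun this x
  -- The failure of L to intertwine the actions is a cocycle that vanishes on T. Averaging over the
  -- finite quotient by T exhibits it as the coboundary of some v, and x ↦ v + L x then intertwines.
  let w : G → W := fun g => σ g 0 - L (ρ g 0)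
  have hw : ∀ g h, w (g * h) = w g + (σ g).linear (w h) := by
    intro g h
    simp only [w]
    rw [rep_mul, rep_mul, affineMap_apply_eq (ρ g), affineMap_apply_eq (σ g), map_add, equi, map_sub]
    abel
  have hwT : ∀ t ∈ T, w t = 0 := fun t ht => by simp only [w]; rw [hL t ht, sub_self]
  let q : G ⧸ T → W := Quotient.lift w fun a b hab => by
    have hab : a⁻¹ * b ∈ T := QuotientGroup.leftRel_apply.1 hab
    have : b = a * (a⁻¹ * b) := by group
    rw [this, hw, hwT _ hab, map_zero, add_zero]
  have : Fintype (G ⧸ T) := Fintype.ofFinite _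
  set N : ℝ := (Fintype.card (G ⧸ T) : ℝ) with hN
  have hN0 : N ≠ 0 := by
    rw [hN]; exact_mod_cast Fintype.card_ne_zero
  set s := ∑ c, q c with hs
  have hsum : ∀ g, s = N • w g + (σ g).linear s := by
    intro g
    calc s = ∑ c : G ⧸ T, q (g • c) := (Equiv.sum_comp (MulAction.toPerm g) q).symm
      _ = ∑ c, (w g + (σ g).linear (q c)) := by
        refine Finset.sum_congr rfl fun c _ => ?_
        obtain ⟨h, rfl⟩ := QuotientGroup.mk_surjective c
        exact hw g h
      _ = _ := by
        rw [Finset.sum_add_distrib, Finset.sum_const, Finset.card_univ, ← map_sum, hN,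
          Nat.cast_smul_eq_nsmul]
  set v := N⁻¹ • s with hv
  have hwv : ∀ g, w g = v - (σ g).linear v := by
    intro g
    have h := congrArg (N⁻¹ • ·) (hsum g)
    simp only [smul_add, inv_smul_smul₀ hN0, ← map_smul] at h
    rw [eq_sub_iff_add_eq]
    exact h.symm
  refine ⟨L.toAffineEquiv.trans (AffineEquiv.constVAdd ℝ W v), fun g x => ?_⟩
  change v + L (ρ g x) = σ g (v + L x)
  have h := hwv g
  rw [affineMap_apply_eq, map_add, equi, affineMap_apply_eq (σ g), map_add]
  have h' : σ g 0 = L (ρ g 0) + (v - (σ g).linear v) := by rw [← h]; simp only [w]; abel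
  rw [h']
  abel

end second

/-! ## Lifts of affinities of orbit spaces -/

theorem perm_orb_ext {n : ℕ} {G : Subgroup (Aff n)} {α β : AffOrb G}
    (h : ∀ x, α.1 (orb G x) = β.1 (orb G x)) : α = β := by
  refine Subtype.ext (Equiv.ext fun y => ?_)
  obtain ⟨x, rfl⟩ := Quotient.exists_rep y
  exact h x

theorem exists_eq_mul_of_lift {n : ℕ} {G : Subgroup (Aff n)} (hG : IsDiscreteIsom G)
    {β : Equiv.Perm (Orb G)} {φ χ : Aff n} (h : ∀ x, β (orb G x) = orb G (φ x))
    (h' : ∀ x, β (orb G x) = orb G (χ x)) : ∃ μ ∈ G, φ = μ * χ := by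
  refine ⟨φ * χ⁻¹, mem_of_orb_eq hG fun x => ?_, by group⟩
  rw [mul_apply', ← h, h', apply_inv_self']

theorem starNA_orb {n : ℕ} {G : Subgroup (Aff n)} {φ : Aff n} (h : φ ∈ NA G) (x : E n) :
    (starNA φ h).1 (orb G x) = orb G (φ x) := rfl

theorem eq_starNA {n : ℕ} {G : Subgroup (Aff n)} {β : AffOrb G} {φ : Aff n} (h : φ ∈ NA G)
    (hβ : ∀ x, β.1 (orb G x) = orb G (φ x)) : starNA φ h = β :=
  perm_orb_ext fun x => (hβ x).symm

theorem translStar_orb {n : ℕ} {G : Subgroup (Aff n)} (v : span (center G)) (x : E n) :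
    (translStar v).1 (orb G x) = orb G ((v : E n) + x) := rfl

/-! ## The model extension of a homomorphism `Δ → Aff(M)` -/

section model

variable {m k : ℕ} {Δ : Subgroup (Aff k)} {M : Subgroup (Aff m)}

/-- The group of the pairs `(φ, δ)` such that `φ` is a lift of `η(δ)`. -/
def Model (η : Δ →* AffOrb M) : Subgroup (Aff m × Δ) where
  carrier := {g | ∀ x, (η g.2).1 (orb M x) = orb M (g.1 x)}
  one_mem' x := by
    change (η 1).1 (orb M x) = _
    rw [map_one]; rfl
  mul_mem' {g h} hg hh x := by
    change (η (g.2 * h.2)).1 (orb M x) = _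
    rw [map_mul]
    change (η g.2).1 ((η h.2).1 (orb M x)) = _
    rw [hh, hg]; rfl
  inv_mem' {g} hg x := by
    change (η g.2⁻¹).1 (orb M x) = _
    rw [map_inv]
    change (η g.2).1⁻¹ (orb M x) = _
    rw [Equiv.Perm.inv_eq_iff_eq, hg]
    change _ = orb M (g.1 (g.1⁻¹ x))
    rw [apply_inv_self']

theorem mem_model {η : Δ →* AffOrb M} {g : Aff m × Δ} :
    g ∈ Model η ↔ ∀ x, (η g.2).1 (orb M x) = orb M (g.1 x) := Iff.rfl

theorem mk_one_mem_model (η : Δ →* AffOrb M) {μ : Aff m} (hμ : μ ∈ M) : (μ, (1 : Δ)) ∈ Model η := by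
  intro x
  rw [map_one, orb_apply hμ]; rfl

/-- Together with `mk_one_mem_model`, this identifies the kernel of the projection to Δ with M. -/
theorem fst_mem_of_snd_eq_one (hM : IsDiscreteIsom M) {η : Δ →* AffOrb M} {g : Aff m × Δ}
    (hg : g ∈ Model η) (h1 : g.2 = 1) : g.1 ∈ M :=
  mem_of_orb_eq hM fun x => by
    rw [← hg x, h1, map_one]; rfl

theorem exists_mem_model (η : Δ →* AffOrb M) (δ : Δ) : ∃ φ, (φ, δ) ∈ Model η := (η δ).2

/-- Isomorphism of the model extensions, as group pairs. -/
def ModelIso (η₁ η₂ : Δ →* AffOrb M) : Prop :=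
  ∃ f : Model η₁ ≃* Model η₂, ∀ g, g.1.2 = 1 ↔ (f g).1.2 = 1

theorem ModelIso.trans {η₁ η₂ η₃ : Δ →* AffOrb M} (h : ModelIso η₁ η₂) (h' : ModelIso η₂ η₃) :
    ModelIso η₁ η₃ := by
  obtain ⟨f, hf⟩ := h
  obtain ⟨f', hf'⟩ := h'
  exact ⟨f.trans f', fun g => (hf g).trans (hf' _)⟩

theorem modelIso_of_equiv {η₁ η₂ : Δ →* AffOrb M} (F : Aff m × Δ ≃ Aff m × Δ)
    (hmem : ∀ g, g ∈ Model η₁ ↔ F g ∈ Model η₂)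
    (hmul : ∀ g ∈ Model η₁, ∀ h ∈ Model η₁, F (g * h) = F g * F h)
    (hone : ∀ g, g.2 = 1 ↔ (F g).2 = 1) : ModelIso η₁ η₂ :=
  ⟨MulEquiv.mk' (F.subtypeEquiv hmem) fun g h => Subtype.ext (hmul g.1 g.2 h.1 h.2),
    fun g => hone g.1⟩

/-- A lift of α conjugates the first coordinates and ζ⁻¹ acts on the second. This is what makes ψ
independent of the representative of [η]. -/
theorem modelIso_of_conj {η₁ η₂ : Δ →* AffOrb M} (α : AffOrb M) (ζ : MulAut Δ)
    (h : ∀ δ, η₂ δ = α * η₁ (ζ δ) * α⁻¹) : ModelIso η₁ η₂ := by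
  obtain ⟨φ, hφ⟩ := α.2
  let F : Aff m × Δ ≃* Aff m × Δ := (MulAut.conj φ).prodCongr ζ⁻¹
  refine modelIso_of_equiv F.toEquiv (fun g => ?_) (fun g _ h _ => map_mul F g h) fun g => ?_
  · have hF : F g = (φ * g.1 * φ⁻¹, ζ⁻¹ g.2) := rfl
    have key : ∀ x, (η₂ (ζ⁻¹ g.2)).1 (orb M (φ x)) = α.1 ((η₁ g.2).1 (orb M x)) := fun x => by
      rw [h, MulAut.apply_inv_self, ← hφ]
      change α.1 ((η₁ g.2).1 (α.1.symm (α.1 _))) = _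
      rw [Equiv.symm_apply_apply]
    change _ ↔ F g ∈ _
    rw [hF, mem_model, mem_model]
    constructor
    · intro hg x
      have := key (φ⁻¹ x)
      rw [hg, hφ, apply_inv_self'] at this
      exact this
    · intro hg x
      have := hg (φ x)
      rw [key] at this
      refine α.1.injective ?_
      rw [this, hφ]
      change orb M (φ (g.1 (φ⁻¹ (φ x)))) = _
      rw [inv_apply_self']
  · change _ ↔ ζ⁻¹ g.2 = 1
    rw [map_eq_one_iff _ (ζ⁻¹ : MulAut Δ).injective]

/-- The pair `(Γ, N)` is isomorphic to the model extension of `η`. -/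
def Models (η : Δ →* AffOrb M) (p : Pair Δ M) : Prop :=
  ∃ f : Model η ≃* p.Γ, ∀ g, g.1.2 = 1 ↔ (f g : Aff (m + k)) ∈ p.N

theorem isoClass_eq_iff {η₁ η₂ : Δ →* AffOrb M} {p q : Pair Δ M} (hp : Models η₁ p)
    (hq : Models η₂ q) : isoClass p = isoClass q ↔ ModelIso η₁ η₂ := by
  obtain ⟨f, hf⟩ := hp
  obtain ⟨f', hf'⟩ := hq
  have h0 : isoClass p = isoClass q ↔ ∃ F : p.Γ ≃* q.Γ, ∀ γ : p.Γ,
    γ ∈ p.N.subgroupOf p.Γ ↔ F γ ∈ q.N.subgroupOf q.Γ := Quotient.eq (r := pairSetoid Δ M)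
  rw [h0]
  simp only [Subgroup.mem_subgroupOf]
  constructor
  · rintro ⟨F, hF⟩
    refine ⟨(f.trans F).trans f'.symm, fun g => ?_⟩
    rw [hf, hF, hf']
    simp
  · rintro ⟨F, hF⟩
    refine ⟨(f.symm.trans F).trans f', fun γ => ?_⟩
    have h1 := hf (f.symm γ)
    rw [MulEquiv.apply_symm_apply] at h1
    rw [← h1, hF, hf']
    rfl

/-- The isomorphism is γ ↦ (b γ, e γ). Two lifts of the same η(δ) differ by an element of M, so
surjectivity and injectivity only need checking on N. In the applications b is the action on
Span(N). -/
theorem models_of_action (hM : IsDiscreteIsom M) {η : Δ →* AffOrb M} {p : Pair Δ M}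
    (b : p.Γ →* Aff m) (e : p.Γ →* Δ) (he : Function.Surjective e)
    (hker : ∀ γ, e γ = 1 ↔ (γ : Aff (m + k)) ∈ p.N)
    (hact : ∀ γ x, (η (e γ)).1 (orb M x) = orb M (b γ x))
    (hsurj : ∀ μ ∈ M, ∃ γ : p.Γ, (γ : Aff (m + k)) ∈ p.N ∧ b γ = μ)
    (hinj : ∀ γ : p.Γ, (γ : Aff (m + k)) ∈ p.N → b γ = 1 → γ = 1) : Models η p := by
  let F : p.Γ →* Model η := (b.prod e).codRestrict (Model η) fun γ => hact γ
  have hF : Function.Bijective F := by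
    constructor
    · rw [injective_iff_map_eq_one]
      intro γ hγ
      have h := congrArg Subtype.val hγ
      exact hinj γ ((hker γ).1 (congrArg Prod.snd h)) (congrArg Prod.fst h)
    · rintro ⟨⟨φ, δ⟩, hg⟩
      obtain ⟨γ, rfl⟩ := he δ
      obtain ⟨μ, hμ, rfl⟩ := exists_eq_mul_of_lift hM hg (hact γ)
      obtain ⟨ν, hν, rfl⟩ := hsurj μ hμ
      refine ⟨ν * γ, Subtype.ext (Prod.ext (map_mul b ν γ) ?_)⟩
      change e (ν * γ) = e γ
      rw [map_mul, (hker ν).2 hν, one_mul]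
  let f := MulEquiv.ofBijective F hF
  refine ⟨f.symm, fun g => ?_⟩
  rw [← hker]
  have h1 : e (f.symm g) = g.1.2 := congrArg (fun x => x.1.2) (f.apply_symm_apply g)
  rw [h1]

end model

/-! ## The infinite dihedral group -/

section dihedral

theorem e1_eq (x : E 1) : x = x 0 • EuclideanSpace.single 0 (1 : ℝ) := by
  ext i
  rw [Subsingleton.elim i 0]
  simp

/-- The translation coefficient of an affinity of the line. -/
def trn (δ : Aff 1) : ℝ := δ 0 0

/-- The linear coefficient of an affinity of the line. -/
def slope (δ : Aff 1) : ℝ := δ.linear (EuclideanSpace.single 0 (1 : ℝ)) 0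

theorem linear_one_apply (δ : Aff 1) (x : E 1) : δ.linear x 0 = slope δ * x 0 := by
  conv_lhs => rw [e1_eq x]
  rw [map_smul]
  simp [slope, mul_comm]

theorem apply_one (δ : Aff 1) (x : E 1) : δ x 0 = slope δ * x 0 + trn δ := by
  rw [apply_eq, ← linear_one_apply]; rfl

theorem trn_mul (γ δ : Aff 1) : trn (γ * δ) = trn γ + slope γ * trn δ := by
  rw [trn, mul_apply', apply_one, add_comm]; rfl

theorem slope_mul (γ δ : Aff 1) : slope (γ * δ) = slope γ * slope δ := by
  rw [slope, mul_linear, linear_one_apply]; rfl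

@[simp] theorem trn_one : trn 1 = 0 := rfl

@[simp] theorem slope_one : slope 1 = 1 := by
  change (EuclideanSpace.single 0 (1 : ℝ) : E 1) 0 = 1
  simp

@[simp] theorem trn_transl (a : E 1) : trn (transl a) = a 0 := by simp [trn]

@[simp] theorem slope_transl (a : E 1) : slope (transl a) = 1 := by simp [slope]

@[simp] theorem trn_refl₁ : trn refl₁ = 0 := by simp [trn, refl₁]

@[simp] theorem slope_refl₁ : slope refl₁ = -1 := by
  change (-(EuclideanSpace.single 0 (1 : ℝ) : E 1)) 0 = -1
  simp

@[simp] theorem trn_refl₂ : trn refl₂ = 1 := by rw [refl₂, trn_mul]; simp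

@[simp] theorem slope_refl₂ : slope refl₂ = -1 := by rw [refl₂, slope_mul]; simp

theorem aff_one_ext {γ δ : Aff 1} (ht : trn γ = trn δ) (hs : slope γ = slope δ) : γ = δ := by
  ext x i
  rw [Subsingleton.elim i 0, apply_one, apply_one, ht, hs]

theorem dih_ext {γ δ : Dih} (ht : trn γ = trn δ) (hs : slope γ = slope δ) : γ = δ :=
  Subtype.ext (aff_one_ext ht hs)

@[simp] theorem coe_δ₁ : (δ₁ : Aff 1) = refl₁ := rfl

@[simp] theorem coe_δ₂ : (δ₂ : Aff 1) = refl₂ := rfl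

theorem δ₁_mul_self : δ₁ * δ₁ = 1 := dih_ext (by simp [trn_mul]) (by simp [slope_mul])

theorem δ₂_mul_self : δ₂ * δ₂ = 1 := dih_ext (by simp [trn_mul]) (by simp [slope_mul])

/-- The generators are involutions, so words in them reach every element without inverses. -/
theorem dih_induction {p : Dih → Prop} (one : p 1) (h₁ : ∀ x, p x → p (δ₁ * x))
    (h₂ : ∀ x, p x → p (δ₂ * x)) (x : Dih) : p x := by
  have htop : Subgroup.closure ({δ₁, δ₂} : Set Dih) = ⊤ := by
    have h := Subgroup.closure_closure_coe_preimage (k := ({refl₁, refl₂} : Set (Aff 1)))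
    have hset : ({δ₁, δ₂} : Set Dih) = Subtype.val ⁻¹' {refl₁, refl₂} := by
      ext y
      simp only [Set.mem_insert_iff, Set.mem_singleton_iff, Set.mem_preimage, Subtype.ext_iff]
      rfl
    rw [hset]
    exact h
  have hx : x ∈ Subgroup.closure ({δ₁, δ₂} : Set Dih) := htop ▸ Subgroup.mem_top x
  induction hx using Subgroup.closure_induction_left with
  | one => exact one
  | mul_left y hy z _ hz =>
    rcases hy with rfl | rfl
    · exact h₁ _ hz
    · exact h₂ _ hz
  | inv_mul_cancel y hy z _ hz =>
    rcases hy with rfl | rfl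
    · rw [inv_eq_of_mul_eq_one_left δ₁_mul_self]; exact h₁ _ hz
    · rw [inv_eq_of_mul_eq_one_left δ₂_mul_self]; exact h₂ _ hz

theorem dih_hom_ext {G : Type*} [Group G] {f g : Dih →* G} (h₁ : f δ₁ = g δ₁) (h₂ : f δ₂ = g δ₂) :
    f = g := by
  ext x
  induction x using dih_induction with
  | one => simp
  | h₁ x hx => rw [map_mul, map_mul, h₁, hx]
  | h₂ x hx => rw [map_mul, map_mul, h₂, hx]

theorem dih_cases (x : Dih) : (∃ j : ℤ, trn x = j) ∧ (slope x = 1 ∨ slope x = -1) := by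
  induction x using dih_induction with
  | one => exact ⟨⟨0, by simp⟩, Or.inl (by simp)⟩
  | h₁ x hx =>
    obtain ⟨⟨j, hj⟩, hs⟩ := hx
    refine ⟨⟨-j, by simp [trn_mul, hj]⟩, ?_⟩
    rcases hs with hs | hs <;> simp [slope_mul, hs]
  | h₂ x hx =>
    obtain ⟨⟨j, hj⟩, hs⟩ := hx
    refine ⟨⟨1 - j, by simp [trn_mul, hj, sub_eq_add_neg]⟩, ?_⟩
    rcases hs with hs | hs <;> simp [slope_mul, hs]

theorem exists_dih_transl (j : ℤ) : ∃ d : Dih, trn d = j ∧ slope d = 1 := by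
  refine ⟨(δ₂ * δ₁) ^ j, ?_⟩
  have h : ((δ₂ * δ₁ : Dih) : Aff 1) = transl (EuclideanSpace.single 0 (1 : ℝ)) :=
    aff_one_ext (by simp [trn_mul]) (by simp [slope_mul])
  rw [Subgroup.coe_zpow, h, ← AffineEquiv.constVAdd_zsmul, trn_transl, slope_transl]
  simp

theorem exists_dih (j : ℤ) {σ : ℝ} (hσ : σ = 1 ∨ σ = -1) : ∃ d : Dih, trn d = j ∧ slope d = σ := by
  obtain ⟨d, hd, hs⟩ := exists_dih_transl j
  rcases hσ with rfl | rfl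
  · exact ⟨d, hd, hs⟩
  · exact ⟨d * δ₁, by simp [trn_mul, hd], by simp [slope_mul, hs]⟩

/-- A reflection x ↦ t − x is given by t. Inside the dihedral group conjugation preserves the parity
of t, which distinguishes the classes of δ₁ and δ₂. -/
theorem conj_reflection (d y : Dih) (hy : slope y = -1) :
    trn (d * y * d⁻¹ : Dih) = 2 * trn d + slope d * trn y ∧ slope (d * y * d⁻¹ : Dih) = -1 := by
  have hs := slope_mul (d : Aff 1) (d⁻¹ : Dih)
  have ht := trn_mul (d : Aff 1) (d⁻¹ : Dih)
  rw [← Subgroup.coe_mul, mul_inv_cancel] at hs ht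
  simp only [Subgroup.coe_one, slope_one, trn_one] at hs ht
  simp only [Subgroup.coe_mul, trn_mul, slope_mul, hy] at *
  constructor
  · linear_combination ht
  · linear_combination hs

/-- Every automorphism of the infinite dihedral group permutes the Coxeter generators, up to an
inner automorphism. -/
theorem exists_conj_generators (ζ : MulAut Dih) : ∃ d : Dih,
    (d * ζ δ₁ * d⁻¹ = δ₁ ∧ d * ζ δ₂ * d⁻¹ = δ₂) ∨ (d * ζ δ₁ * d⁻¹ = δ₂ ∧ d * ζ δ₂ * d⁻¹ = δ₁) := by
  have hrefl : ∀ δ : Dih, δ * δ = 1 → δ ≠ 1 → slope (ζ δ) = -1 := by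
    intro δ h h1
    rcases (dih_cases (ζ δ)).2 with hs | hs
    · refine absurd (ζ.injective (((dih_ext ?_ ?_ : ζ δ = 1)).trans (map_one ζ).symm)) h1
      · have h2 : ζ δ * ζ δ = 1 := by rw [← map_mul, h, map_one]
        have := congrArg (fun x : Dih => trn x) h2
        simp only [Subgroup.coe_mul, trn_mul, hs, Subgroup.coe_one, trn_one] at this ⊢
        linarith
      · simpa using hs
    · exact hs
  have hs₁ : slope (ζ δ₁) = -1 := hrefl _ δ₁_mul_self fun h => by
    have := congrArg (fun x : Dih => slope x) h
    norm_num at this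
  have hs₂ : slope (ζ δ₂) = -1 := hrefl _ δ₂_mul_self fun h => by
    have := congrArg (fun x : Dih => slope x) h
    norm_num at this
  obtain ⟨k₁, hk₁⟩ := (dih_cases (ζ δ₁)).1
  obtain ⟨k₂, hk₂⟩ := (dih_cases (ζ δ₂)).1
  -- Words in the two image reflections translate only by multiples of k₂ − k₁; since ζ is onto, the
  -- unit translation must occur.
  have hdiff : k₂ - k₁ = 1 ∨ k₂ - k₁ = -1 := by
    have key : ∀ x : Dih, (slope (ζ x) = 1 ∧ ∃ j : ℤ, trn (ζ x) = (j * (k₂ - k₁) : ℤ)) ∨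
        (slope (ζ x) = -1 ∧ ∃ j : ℤ, trn (ζ x) = (k₁ + j * (k₂ - k₁) : ℤ)) := by
      intro x
      induction x using dih_induction with
      | one => exact Or.inl ⟨by simp, 0, by simp⟩
      | h₁ x hx =>
        simp only [map_mul, Subgroup.coe_mul, trn_mul, slope_mul, hs₁, hk₁]
        rcases hx with ⟨hs, j, hj⟩ | ⟨hs, j, hj⟩
        · exact Or.inr ⟨by rw [hs]; norm_num, -j, by rw [hj]; push_cast; ring⟩
        · exact Or.inl ⟨by rw [hs]; norm_num, -j, by rw [hj]; push_cast; ring⟩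
      | h₂ x hx =>
        simp only [map_mul, Subgroup.coe_mul, trn_mul, slope_mul, hs₂, hk₂]
        rcases hx with ⟨hs, j, hj⟩ | ⟨hs, j, hj⟩
        · exact Or.inr ⟨by rw [hs]; norm_num, 1 - j, by rw [hj]; push_cast; ring⟩
        · exact Or.inl ⟨by rw [hs]; norm_num, 1 - j, by rw [hj]; push_cast; ring⟩
    obtain ⟨t, ht, hts⟩ := exists_dih_transl 1
    have h := key (ζ⁻¹ t)
    rw [MulAut.apply_inv_self, ht, hts] at h
    rcases h with ⟨-, j, hj⟩ | ⟨h, -⟩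
    · have hj' : (1 : ℤ) = j * (k₂ - k₁) := by exact_mod_cast hj
      exact Int.isUnit_iff.1 (IsUnit.of_mul_eq_one j (by rw [mul_comm]; exact hj'.symm))
    · norm_num at h
  have fin : ∀ (a : ℤ) (σ : ℤ), (σ = 1 ∨ σ = -1) →
      (2 * a + σ * k₁ = 0 ∧ 2 * a + σ * k₂ = 1) ∨ (2 * a + σ * k₁ = 1 ∧ 2 * a + σ * k₂ = 0) →
      ∃ d : Dih, (d * ζ δ₁ * d⁻¹ = δ₁ ∧ d * ζ δ₂ * d⁻¹ = δ₂) ∨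
        (d * ζ δ₁ * d⁻¹ = δ₂ ∧ d * ζ δ₂ * d⁻¹ = δ₁) := by
    intro a σ hσ h
    obtain ⟨d, hd, hds⟩ := exists_dih a (σ := (σ : ℝ)) (by
      rcases hσ with rfl | rfl
      · exact Or.inl (by norm_num)
      · exact Or.inr (by norm_num))
    obtain ⟨t₁, s₁⟩ := conj_reflection d _ hs₁
    obtain ⟨t₂, s₂⟩ := conj_reflection d _ hs₂
    rw [hd, hds, hk₁] at t₁
    rw [hd, hds, hk₂] at t₂
    refine ⟨d, h.imp ?_ ?_⟩
    all_goals
      rintro ⟨e₁, e₂⟩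
      have e₁' := congrArg (Int.cast : ℤ → ℝ) e₁
      have e₂' := congrArg (Int.cast : ℤ → ℝ) e₂
      push_cast at e₁' e₂'
      exact ⟨dih_ext (by rw [t₁, e₁']; simp) (by rw [s₁]; simp),
        dih_ext (by rw [t₂, e₂']; simp) (by rw [s₂]; simp)⟩
  -- The even one of the consecutive integers k₁, k₂ is sent to 0 and the odd one to 1; the
  -- orientation is reversed (σ = −1) when the even one is the larger.
  rcases Int.even_or_odd' k₁ with ⟨q, hq | hq⟩ <;> rcases hdiff with hd | hd
  · exact fin (-q) 1 (Or.inl rfl) (by omega)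
  · exact fin q (-1) (Or.inr rfl) (by omega)
  · exact fin (q + 1) (-1) (Or.inr rfl) (by omega)
  · exact fin (-q) 1 (Or.inl rfl) (by omega)

/-- The automorphism of the infinite dihedral group that exchanges the Coxeter generators. -/
theorem exists_swap : ∃ ζ : MulAut Dih, ζ δ₁ = δ₂ ∧ ζ δ₂ = δ₁ := by
  -- The reflection in the point 1/4 exchanges 0 and 1/2, the fixed points of the two generators.
  set κ : Aff 1 := transl (EuclideanSpace.single 0 (1 / 2 : ℝ)) * refl₁ with hκ
  have hκt : trn κ = 1 / 2 := by rw [hκ, trn_mul]; simp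
  have hκs : slope κ = -1 := by rw [hκ, slope_mul]; simp
  have hκ2 : κ⁻¹ = κ := inv_eq_of_mul_eq_one_left
    (aff_one_ext (by rw [trn_mul, hκt, hκs]; simp) (by rw [slope_mul, hκs]; simp))
  have h₁ : κ * refl₁ * κ⁻¹ = refl₂ := by
    rw [hκ2]
    exact aff_one_ext (by simp only [trn_mul, slope_mul, hκt, hκs]; norm_num)
      (by simp only [slope_mul, hκs]; norm_num)
  have h₂ : κ * refl₂ * κ⁻¹ = refl₁ := by
    rw [hκ2]
    exact aff_one_ext (by simp only [trn_mul, slope_mul, hκt, hκs]; norm_num)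
      (by simp only [slope_mul, hκs]; norm_num)
  have hN : κ ∈ NA Dih := by
    refine Subgroup.mem_normalizer_iff_map_conj_eq.2 ?_
    change Dih.map (MulAut.conj κ).toMonoidHom = Dih
    rw [Dih, MonoidHom.map_closure, Set.image_pair]
    change Subgroup.closure {κ * refl₁ * κ⁻¹, κ * refl₂ * κ⁻¹} = _
    rw [h₁, h₂, Set.pair_comm]
  exact ⟨Dih.normalizerMonoidHom ⟨κ, hN⟩, Subtype.ext h₁, Subtype.ext h₂⟩

end dihedral

/-! ## Invariant inner products -/

section invariant

/-- A finite monoid of linear maps is conjugate to a monoid of isometries, provided that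
multiplication by its elements is injective. -/
theorem exists_isometrizing {m : ℕ} (F : Set (E m →L[ℝ] E m)) (hF : F.Finite) (h1 : 1 ∈ F)
    (hmul : ∀ A ∈ F, ∀ B ∈ F, A * B ∈ F) (hinv : ∀ A ∈ F, ∃ B ∈ F, A * B = 1 ∧ B * A = 1) :
    ∃ C : E m ≃ₗ[ℝ] E m, ∀ A ∈ F, ∀ x, ‖C (A x)‖ = ‖C x‖ := by
  have : Fintype F := hF.fintype
  -- Recording x through the family of all A x turns the action of F into a permutation of
  -- coordinates, so the norm pulled back along J is invariant. An orthonormal basis of the range of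
  -- J leads back to E^m.
  let H := PiLp 2 (fun _ : F => E m)
  let J : E m →ₗ[ℝ] H :=
    { toFun := fun x => WithLp.toLp 2 fun A => A.1 x
      map_add' := fun x y => by ext A : 1; exact map_add A.1 x y
      map_smul' := fun c x => by ext A : 1; exact map_smul A.1 c x }
  have hJ : ∀ x, ‖J x‖ ^ 2 = ∑ A : F, ‖A.1 x‖ ^ 2 := fun x => by
    rw [PiLp.norm_sq_eq_of_L2]
    rfl
  have hinj : Function.Injective J := by
    intro x y hxy
    have := congrArg (fun z : H => z ⟨1, h1⟩) hxy
    exact this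
  have hinvJ : ∀ B ∈ F, ∀ x, ‖J (B x)‖ = ‖J x‖ := by
    intro B hB x
    obtain ⟨B', hB', e1, e2⟩ := hinv B hB
    rw [← sq_eq_sq₀ (norm_nonneg _) (norm_nonneg _), hJ, hJ]
    refine Fintype.sum_equiv
      ⟨fun A => ⟨A.1 * B, hmul _ A.2 _ hB⟩, fun A => ⟨A.1 * B', hmul _ A.2 _ hB'⟩, ?_, ?_⟩ _ _ ?_
    · intro A; simp [mul_assoc, e1]
    · intro A; simp [mul_assoc, e2]
    · intro A; rfl
  have hrank : Module.finrank ℝ (LinearMap.range J) = m := by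
    rw [LinearMap.finrank_range_of_inj hinj, finrank_euclideanSpace_fin]
  let e := LinearEquiv.ofInjective J hinj
  let b := (stdOrthonormalBasis ℝ (LinearMap.range J)).reindex (finCongr hrank)
  refine ⟨e.trans b.repr.toLinearEquiv, fun A hA x => ?_⟩
  have key : ∀ y, ‖(e.trans b.repr.toLinearEquiv) y‖ = ‖J y‖ := fun y =>
    b.repr.norm_map (e y)
  rw [key, key, hinvJ A hA]

/-- The linear parts of all lifts form a finite group, and this is where the finiteness of the image
of Ωη enters: lifts with the same outer class differ by an element of M and an affinity centralizing
M. The latter is a translation, so only the finite point group of M remains. -/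
theorem exists_invariant_conj {m k : ℕ} {Δ : Subgroup (Aff k)} {M : Subgroup (Aff m)}
    (hM : IsSpaceGroup M) (η : HomF Δ M) :
    ∃ C : E m ≃ₗ[ℝ] E m, ∀ g ∈ Model η.1, ∀ x, ‖C (g.1.linear x)‖ = ‖C x‖ := by
  let F : Set (E m →L[ℝ] E m) := {A | ∃ g ∈ Model η.1, lin g.1 = A}
  have hMfin := finite_linear hM.isDiscreteIsom fun g _ => mem_span_of_isSpaceGroup hM (g 0)
  have hF : F.Finite := by
    refine (η.2.biUnion (t := fun o => {A | ∃ (φ : Aff m) (h : φ ∈ NA M),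
      o = QuotientGroup.mk (M.normalizerMonoidHom ⟨φ, h⟩) ∧ lin φ = A}) fun o _ => ?_).subset ?_
    · rcases Set.eq_empty_or_nonempty {A | ∃ (φ : Aff m) (h : φ ∈ NA M),
        o = QuotientGroup.mk (M.normalizerMonoidHom ⟨φ, h⟩) ∧ lin φ = A} with he | ⟨_, χ, hχ, ho, -⟩
      · rw [he]; exact Set.finite_empty
      refine (hMfin.image fun A => lin χ * A).subset ?_
      rintro _ ⟨φ, hφ, ho', rfl⟩
      obtain ⟨μ, hμ⟩ := QuotientGroup.eq.1 (ho.symm.trans ho')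
      have hcomm : ∀ ν ∈ M, χ * μ * ν * (χ * (μ : Aff m))⁻¹ = φ * ν * φ⁻¹ := by
        intro ν hν
        have h := congrArg (fun a : MulAut M => ((M.normalizerMonoidHom ⟨χ, hχ⟩ * a) ⟨ν, hν⟩ : Aff m))
          hμ
        simp only [mul_inv_cancel_left] at h
        rw [show φ * ν * φ⁻¹ = _ from h.symm]
        change _ = χ * (μ * ν * (μ : Aff m)⁻¹) * χ⁻¹
        group
      obtain ⟨h1, -⟩ := centralizer_eq hM (φ := (χ * (μ : Aff m))⁻¹ * φ) fun ν hν => by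
        have := hcomm ν hν
        calc (χ * (μ : Aff m))⁻¹ * φ * ν = (χ * (μ : Aff m))⁻¹ * (φ * ν * φ⁻¹) * φ := by group
          _ = _ := by rw [← this]; group
      refine ⟨lin μ, ⟨μ, μ.2, rfl⟩, ContinuousLinearMap.ext fun x => ?_⟩
      have h2 : φ = χ * μ * ((χ * (μ : Aff m))⁻¹ * φ) := by group
      rw [h1] at h2
      change χ.linear ((μ : Aff m).linear x) = φ.linear x
      rw [h2]
      rfl
    · rintro _ ⟨⟨φ, δ⟩, hg, rfl⟩
      have hN := mem_NA_of_lift hM.isDiscreteIsom hg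
      simp only [Set.mem_iUnion]
      exact ⟨_, ⟨δ, φ, hN, eq_starNA hN hg, rfl⟩, φ, hN, rfl, rfl⟩
  obtain ⟨C, hC⟩ := exists_isometrizing F hF ⟨1, one_mem _, rfl⟩
    (by
      rintro _ ⟨g, hg, rfl⟩ _ ⟨h, hh, rfl⟩
      exact ⟨g * h, mul_mem hg hh, rfl⟩)
    (by
      rintro _ ⟨g, hg, rfl⟩
      exact ⟨_, ⟨g⁻¹, inv_mem hg, rfl⟩, ContinuousLinearMap.ext fun x => linear_apply_inv g.1 x,
        ContinuousLinearMap.ext fun x => linear_inv_apply g.1 x⟩)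
  exact ⟨C, fun g hg x => hC _ ⟨g, hg, rfl⟩ x⟩

variable {V H : Type*} [AddCommGroup V] [Module ℝ V] [NormedAddCommGroup H] [InnerProductSpace ℝ H]

theorem inner_eq_of_norm (C : V ≃ₗ[ℝ] H) {A : V →ₗ[ℝ] V} (hA : ∀ x, ‖C (A x)‖ = ‖C x‖) (x y : V) :
    inner ℝ (C (A x)) (C (A y)) = inner ℝ (C x) (C y) := by
  rw [real_inner_eq_norm_add_mul_self_sub_norm_mul_self_sub_norm_mul_self_div_two,
    real_inner_eq_norm_add_mul_self_sub_norm_mul_self_sub_norm_mul_self_div_two,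
    ← map_add, ← map_add, ← map_add, hA, hA, hA]

variable [FiniteDimensional ℝ H]

/-- Cocycles of the infinite dihedral group with values in an orthogonal representation: up to
coboundaries, they take a value in `E₁ ∩ E₂` on the second generator. -/
theorem exists_cocycle_normal_form (C : V ≃ₗ[ℝ] H) {A₁ A₂ : V →ₗ[ℝ] V}
    (h₁ : ∀ x, ‖C (A₁ x)‖ = ‖C x‖) (h₂ : ∀ x, ‖C (A₂ x)‖ = ‖C x‖) {W : Submodule ℝ V}
    (hW₁ : ∀ x ∈ W, A₁ x ∈ W) (hW₂ : ∀ x ∈ W, A₂ x ∈ W) (hs₁ : ∀ x ∈ W, A₁ (A₁ x) = x)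
    (hs₂ : ∀ x ∈ W, A₂ (A₂ x) = x) {w₁ w₂ : V} (hw₁ : w₁ ∈ W) (hw₂ : w₂ ∈ W)
    (hn₁ : A₁ w₁ = -w₁) (hn₂ : A₂ w₂ = -w₂) :
    ∃ u ∈ W, ∃ v ∈ W, A₁ v = -v ∧ A₂ v = -v ∧ u - A₁ u = w₁ ∧ u + v - A₂ u = w₂ := by
  -- The coboundary of w₁/2 removes w₁, because A₁ w₁ = −w₁; w is what it leaves of w₂.
  obtain ⟨w, hw⟩ : ∃ w, w = w₂ - (1 / 2 : ℝ) • (w₁ - A₂ w₁) := ⟨_, rfl⟩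
  have hwW : w ∈ W := hw ▸ W.sub_mem hw₂ (W.smul_mem _ (W.sub_mem hw₁ (hW₂ _ hw₁)))
  have hnw : A₂ w = -w := by
    rw [hw, map_sub, map_smul, map_sub, hs₂ _ hw₁, hn₂, neg_sub, ← neg_sub w₁ (A₂ w₁), smul_neg]
    abel
  -- Vectors fixed by A₁ have coboundaries that do not disturb the first component. Their second
  -- components make up U, onto which w is projected for the inner product ⟨C x, C y⟩.
  let U : Submodule ℝ H := (W ⊓ LinearMap.ker (A₁ - LinearMap.id)).map
    (C.toLinearMap ∘ₗ (LinearMap.id - A₂))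
  obtain ⟨u, ⟨huW, hu⟩, hup⟩ := U.starProjection_apply_mem (C w)
  have hu1 : A₁ u = u := by
    have : (A₁ - LinearMap.id : V →ₗ[ℝ] V) u = 0 := hu
    exact sub_eq_zero.1 this
  have hup : C (u - A₂ u) = U.starProjection (C w) := hup
  obtain ⟨v, hv⟩ : ∃ v, v = w - (u - A₂ u) := ⟨_, rfl⟩
  have hvW : v ∈ W := hv ▸ W.sub_mem hwW (W.sub_mem huW (hW₂ _ huW))
  have hv2 : A₂ v = -v := by
    rw [hv, map_sub, map_sub, hs₂ _ huW, hnw]; abel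
  -- As A₂ v = −v, the product of v with x − A₂ x is twice the product of v with x.
  have horth : ∀ x ∈ W, A₁ x = x → inner ℝ (C v) (C x) = 0 := by
    intro x hx hx1
    have hmem : C (x - A₂ x) ∈ U := by
      refine ⟨x, ⟨hx, ?_⟩, rfl⟩
      change (A₁ - LinearMap.id : V →ₗ[ℝ] V) x = 0
      exact sub_eq_zero.2 hx1
    have h0 : inner ℝ (C (x - A₂ x)) (C v) = 0 := by
      rw [hv, map_sub C w, hup]
      exact U.sub_starProjection_mem_orthogonal (C w) _ hmem
    rw [real_inner_comm, map_sub, inner_sub_right] at h0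
    have h3 := inner_eq_of_norm C h₂ v (A₂ x)
    rw [hs₂ _ hx, hv2, map_neg, inner_neg_left] at h3
    linarith
  -- The vector v + A₁ v is fixed by A₁ and orthogonal to v, hence to A₁ v, hence to itself.
  have hv1 : A₁ v = -v := by
    have hfix : A₁ (v + A₁ v) = v + A₁ v := by rw [map_add, hs₁ _ hvW, add_comm]
    have hmem : v + A₁ v ∈ W := W.add_mem hvW (hW₁ _ hvW)
    have ha := horth _ hmem hfix
    have hb := inner_eq_of_norm C h₁ v (v + A₁ v)
    rw [hfix, ha] at hb
    have hc : inner ℝ (C (v + A₁ v)) (C (v + A₁ v)) = 0 := by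
      conv_lhs => rw [map_add C v, inner_add_left, ← map_add C v, ha, hb]
      simp
    have hd := C.map_eq_zero_iff.1 (inner_self_eq_zero.1 hc)
    rw [add_comm] at hd
    exact eq_neg_of_add_eq_zero_left hd
  refine ⟨(1 / 2 : ℝ) • w₁ + u, W.add_mem (W.smul_mem _ hw₁) huW, v, hvW, hv1, hv2, ?_, ?_⟩
  · rw [map_add, map_smul, hn₁, hu1, smul_neg]
    have : w₁ = (1 / 2 : ℝ) • w₁ + (1 / 2 : ℝ) • w₁ := by rw [← add_smul]; norm_num
    conv_rhs => rw [this]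
    abel
  · rw [hv, hw, map_add, map_smul, smul_sub]
    abel

end invariant

/-! ## Automorphisms of space groups -/

/-- The affinities, as affine self-maps. -/
def affHom (n : ℕ) : Aff n →* (E n →ᵃ[ℝ] E n) where
  toFun φ := φ.toAffineMap
  map_one' := rfl
  map_mul' _ _ := rfl

theorem isCrystal_of_isSpaceGroup {m : ℕ} {M : Subgroup (Aff m)} (hM : IsSpaceGroup M) :
    IsCrystal ((affHom m).comp M.subtype) where
  spans := by
    rw [eq_top_iff, ← span_eq_top hM, span]
    exact Submodule.span_mono fun a ha => ⟨⟨_, ha⟩, fun x => rfl⟩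
  finite := by
    have := finite_linear hM.isDiscreteIsom fun g _ => mem_span_of_isSpaceGroup hM (g 0)
    refine (this.image fun A : E m →L[ℝ] E m => (A : E m →ₗ[ℝ] E m)).subset ?_
    rintro _ ⟨g, rfl⟩
    exact ⟨lin g, ⟨g, g.2, rfl⟩, rfl⟩
  discrete := by
    obtain ⟨ε, hε, h⟩ := hM.discrete
    refine ⟨ε, hε, fun g a hg ha => ?_⟩
    have ht : (g : Aff m) = transl a := AffineEquiv.ext hg
    refine Subtype.ext (h g g.2 ?_ fun x => ?_)
    · rw [ht, transl_apply, add_zero]; exact ha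
    · rw [ht, transl_linear, sub_self, norm_zero]; positivity

theorem IsCrystal.comp {G G' V : Type*} [Group G] [Group G'] [NormedAddCommGroup V]
    [NormedSpace ℝ V] {ρ : G →* (V →ᵃ[ℝ] V)} (h : IsCrystal ρ) (θ : G' ≃* G) :
    IsCrystal (ρ.comp θ.toMonoidHom) where
  spans := by
    rw [eq_top_iff, ← h.spans]
    refine Submodule.span_mono ?_
    rintro a ⟨g, hg⟩
    exact ⟨θ.symm g, fun x => by simpa using hg x⟩
  finite := h.finite.subset (by rintro _ ⟨g, rfl⟩; exact ⟨θ g, rfl⟩)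
  discrete := by
    obtain ⟨ε, hε, h'⟩ := h.discrete
    exact ⟨ε, hε, fun g a hg ha => (map_eq_one_iff θ θ.injective).1 (h' (θ g) a hg ha)⟩

/-- Every automorphism of a space group is conjugation by an affinity. -/
theorem exists_affinity_of_mulAut {m : ℕ} {M : Subgroup (Aff m)} (hM : IsSpaceGroup M)
    (θ : M ≃* M) : ∃ Φ : Aff m, ∀ μ : M, Φ * μ = θ μ * Φ := by
  have h := isCrystal_of_isSpaceGroup hM
  obtain ⟨Φ, hΦ⟩ := exists_affineEquiv h (h.comp θ)
  exact ⟨Φ, fun μ => AffineEquiv.ext fun x => hΦ μ x⟩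

/-! ## Isomorphisms of model extensions -/

section criterion

variable {m : ℕ} {M : Subgroup (Aff m)}

/-- The action of an isomorphism of model extensions on the subgroup `M`. -/
def fiberHom (hM : IsDiscreteIsom M) {k : ℕ} {Δ : Subgroup (Aff k)} {η₁ η₂ : Δ →* AffOrb M}
    (f : Model η₁ ≃* Model η₂) (hf : ∀ g, g.1.2 = 1 ↔ (f g).1.2 = 1) : M →* M :=
  MonoidHom.mk' (fun μ => ⟨(f ⟨(μ, 1), mk_one_mem_model η₁ μ.2⟩).1.1,
      fst_mem_of_snd_eq_one hM (f _).2 ((hf _).1 rfl)⟩) fun μ ν => Subtype.ext (by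
    have : (⟨((μ * ν : M), 1), mk_one_mem_model η₁ (μ * ν).2⟩ : Model η₁) =
        ⟨(μ, 1), mk_one_mem_model η₁ μ.2⟩ * ⟨(ν, 1), mk_one_mem_model η₁ ν.2⟩ :=
      Subtype.ext (Prod.ext rfl (one_mul 1).symm)
    simp only [this, map_mul]
    rfl)

theorem fiberHom_spec (hM : IsDiscreteIsom M) {k : ℕ} {Δ : Subgroup (Aff k)} {η₁ η₂ : Δ →* AffOrb M}
    (f : Model η₁ ≃* Model η₂) (hf : ∀ g, g.1.2 = 1 ↔ (f g).1.2 = 1) (μ : M) :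
    f ⟨(μ, 1), mk_one_mem_model η₁ μ.2⟩ =
      ⟨(fiberHom hM f hf μ, 1), mk_one_mem_model η₂ (fiberHom hM f hf μ).2⟩ :=
  Subtype.ext (Prod.ext rfl ((hf _).1 rfl))

theorem exists_fiberEquiv (hM : IsDiscreteIsom M) {k : ℕ} {Δ : Subgroup (Aff k)}
    {η₁ η₂ : Δ →* AffOrb M} (f : Model η₁ ≃* Model η₂) (hf : ∀ g, g.1.2 = 1 ↔ (f g).1.2 = 1) :
    ∃ θ : M ≃* M, ∀ μ : M, f ⟨(μ, 1), mk_one_mem_model η₁ μ.2⟩ =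
      ⟨(θ μ, 1), mk_one_mem_model η₂ (θ μ).2⟩ := by
  have hf' : ∀ g, g.1.2 = 1 ↔ (f.symm g).1.2 = 1 := fun g => by
    rw [hf, f.apply_symm_apply]
  refine ⟨MonoidHom.toMulEquiv (fiberHom hM f hf) (fiberHom hM f.symm hf') ?_ ?_,
    fiberHom_spec hM f hf⟩
  · ext1 μ
    have h := fiberHom_spec hM f.symm hf' (fiberHom hM f hf μ)
    rw [← fiberHom_spec hM f hf, f.symm_apply_apply] at h
    exact Subtype.ext (congrArg (fun g => g.1.1) h.symm)
  · ext1 μ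
    have h := fiberHom_spec hM f hf (fiberHom hM f.symm hf' μ)
    rw [← fiberHom_spec hM f.symm hf', f.apply_symm_apply] at h
    exact Subtype.ext (congrArg (fun g => g.1.1) h.symm)

/-- Elements over the Coxeter generators may be taken to elements over the Coxeter generators. -/
theorem exists_modelIso_generators {η₁ η₂ : Dih →* AffOrb M} (h : ModelIso η₁ η₂) :
    ∃ f : Model η₁ ≃* Model η₂, (∀ g, g.1.2 = 1 ↔ (f g).1.2 = 1) ∧ ∃ d₁ d₂ : Dih,
      s(d₁, d₂) = s(δ₁, δ₂) ∧ (∀ g, g.1.2 = δ₁ → (f g).1.2 = d₁) ∧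
      ∀ g, g.1.2 = δ₂ → (f g).1.2 = d₂ := by
  obtain ⟨f, hf⟩ := h
  let π : ∀ η : Dih →* AffOrb M, Model η →* Dih := fun η =>
    (MonoidHom.snd (Aff m) Dih).comp (Model η).subtype
  have hπ : ∀ η, Function.Surjective (π η) := fun η δ => by
    obtain ⟨φ, hφ⟩ := exists_mem_model η δ
    exact ⟨⟨(φ, δ), hφ⟩, rfl⟩
  let π' := (π η₂).comp f.toMonoidHom
  have hπ' : Function.Surjective π' := (hπ η₂).comp f.surjective
  have hker : (π η₁).ker = π'.ker := by
    ext g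
    exact hf g
  let ζ : MulAut Dih := ((QuotientGroup.quotientKerEquivOfSurjective _ (hπ η₁)).symm.trans
    (QuotientGroup.quotientMulEquivOfEq hker)).trans
      (QuotientGroup.quotientKerEquivOfSurjective _ hπ')
  have hζ : ∀ g : Model η₁, ζ g.1.2 = (f g).1.2 := by
    intro g
    have h1 : (QuotientGroup.quotientKerEquivOfSurjective _ (hπ η₁)).symm g.1.2 =
        QuotientGroup.mk g := by
      rw [MulEquiv.symm_apply_eq]; rfl
    change QuotientGroup.quotientKerEquivOfSurjective _ hπ' (QuotientGroup.quotientMulEquivOfEq hker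
      ((QuotientGroup.quotientKerEquivOfSurjective _ (hπ η₁)).symm g.1.2)) = _
    rw [h1]; rfl
  -- Composing f with conjugation by a lift of d absorbs the inner automorphism.
  obtain ⟨d, hd⟩ := exists_conj_generators ζ
  obtain ⟨χ, hχ⟩ := exists_mem_model η₂ d
  let F := f.trans (MulAut.conj (⟨(χ, d), hχ⟩ : Model η₂))
  have hF : ∀ g, (F g).1.2 = d * ζ g.1.2 * d⁻¹ := fun g => by rw [hζ]; rfl
  refine ⟨F, fun g => ?_, d * ζ δ₁ * d⁻¹, d * ζ δ₂ * d⁻¹, ?_, fun g hg => ?_, fun g hg => ?_⟩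
  · rw [hF, conj_eq_one_iff, map_eq_one_iff ζ ζ.injective]
  · rcases hd with ⟨h₁, h₂⟩ | ⟨h₁, h₂⟩
    · rw [h₁, h₂]
    · rw [h₁, h₂, Sym2.eq_swap]
  · rw [hF, hg]
  · rw [hF, hg]

/-- The linear parts of the lifts act on `Span(Z(M))`. -/
theorem linear_mem_span_center (hM : IsSpaceGroup M) {α : Aff m} (hα : α ∈ NA M) {w : E m}
    (hw : w ∈ span (center M)) : α.linear w ∈ span (center M) := by
  refine mem_span_center hM fun μ hμ => ?_
  have h1 : α⁻¹ * μ * α ∈ M := (Subgroup.mem_normalizer_iff''.1 hα μ).1 hμ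
  have h2 := linear_eq_of_mem_span_center hw h1
  have h3 := congrArg α.linear h2
  rw [mul_linear, mul_linear, linear_apply_inv] at h3
  exact h3

theorem mem_negEigen {α : Aff m} {v : E m} :
    v ∈ negEigen M α ↔ v ∈ span (center M) ∧ α.linear v = -v := by
  rw [negEigen, Submodule.mem_inf, Module.End.mem_eigenspace_iff, neg_one_smul]
  rfl

/-- An isomorphism of model extensions changes a lift over an involution, up to an affinity that
realizes the isomorphism on `M`, by a translation along the `(-1)`-eigenspace. -/
theorem exists_translation_change (hM : IsSpaceGroup M) {k : ℕ} {Δ : Subgroup (Aff k)}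
    {η₁ η₂ : Δ →* AffOrb M} (f : Model η₁ ≃* Model η₂) {θ : M ≃* M}
    (hθ : ∀ μ : M, f ⟨(μ, 1), mk_one_mem_model η₁ μ.2⟩ = ⟨(θ μ, 1), mk_one_mem_model η₂ (θ μ).2⟩)
    {Φ : Aff m} (hΦ : ∀ μ : M, Φ * μ = θ μ * Φ) (g : Model η₁) (hg : g.1.2 * g.1.2 = 1) :
    ∃ w ∈ negEigen M g.1.1, (f g).1.1 * Φ = Φ * (transl w * g.1.1) := by
  obtain ⟨α, hα⟩ : ∃ α, α = g.1.1 := ⟨_, rfl⟩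
  obtain ⟨β, hβ⟩ : ∃ β, β = (f g).1.1 := ⟨_, rfl⟩
  rw [← hα, ← hβ]
  have hN : α ∈ NA M := hα ▸ mem_NA_of_lift hM.isDiscreteIsom g.2
  have hconj : ∀ μ : M, ∀ h : α * μ * α⁻¹ ∈ M, β * θ μ * β⁻¹ = θ ⟨α * μ * α⁻¹, h⟩ := by
    intro μ h
    have e : (⟨(α * μ * α⁻¹, 1), mk_one_mem_model η₁ h⟩ : Model η₁) =
        g * ⟨(μ, 1), mk_one_mem_model η₁ μ.2⟩ * g⁻¹ := by
      refine Subtype.ext (Prod.ext ?_ ?_)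
      · change α * μ * α⁻¹ = g.1.1 * μ * g.1.1⁻¹
        rw [hα]
      change 1 = g.1.2 * 1 * g.1.2⁻¹
      rw [mul_one, mul_inv_cancel]
    have h1 := hθ ⟨_, h⟩
    rw [e, map_mul, map_mul, map_inv, hθ] at h1
    have h2 := congrArg (fun x : Model η₂ => x.1.1) h1
    rw [hβ]
    exact h2
  -- Since f is a homomorphism and Φ realizes θ, conjugation by β and by Φ α Φ⁻¹ agree on M. Their
  -- quotient, transported by Φ, centralizes M and so is a translation along Span(Z(M)).
  have hcent : ∀ ν ∈ M, (Φ⁻¹ * β * Φ * α⁻¹) * ν = ν * (Φ⁻¹ * β * Φ * α⁻¹) := by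
    intro ν hν
    have hμ : α⁻¹ * ν * α ∈ M := (Subgroup.mem_normalizer_iff''.1 hN ν).1 hν
    have e : α * (α⁻¹ * ν * α) * α⁻¹ = ν := by group
    have h1 := hconj ⟨_, hμ⟩ (by rw [e]; exact hν)
    have e2 : (⟨α * (α⁻¹ * ν * α) * α⁻¹, by rw [e]; exact hν⟩ : M) = ⟨ν, hν⟩ := Subtype.ext e
    rw [e2] at h1
    have h3 := hΦ ⟨ν, hν⟩
    have h4 := hΦ ⟨_, hμ⟩
    simp only at h3 h4
    rw [← h1] at h3
    have h5 : (θ ⟨α⁻¹ * ν * α, hμ⟩ : Aff m) = Φ * (α⁻¹ * ν * α) * Φ⁻¹ := by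
      rw [h4, mul_inv_cancel_right]
    rw [h5] at h3
    have h6 : ν = Φ⁻¹ * (Φ * ν) := by group
    calc _ = Φ⁻¹ * (β * (Φ * (α⁻¹ * ν * α) * Φ⁻¹) * β⁻¹ * Φ) * (Φ⁻¹ * β * Φ * α⁻¹) := by group
      _ = _ := by rw [← h3]; group
  obtain ⟨ht, hw⟩ := centralizer_eq hM hcent
  obtain ⟨w, hwe⟩ : ∃ w, w = (Φ⁻¹ * β * Φ * α⁻¹) 0 := ⟨_, rfl⟩
  rw [← hwe] at ht hw
  have hβΦ : β * Φ = Φ * (transl w * α) := by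
    rw [← ht]; group
  refine ⟨w, mem_negEigen.2 ⟨hw, ?_⟩, hβΦ⟩
  -- Over an involution α² lies in M and θ(α²) = β². In terms of Φ this reads (`transl w * α`)² =
  -- α², that is, w + A w = 0 for the linear part A of α.
  have hsq : α * α ∈ M := by
    rw [hα]
    exact fst_mem_of_snd_eq_one hM.isDiscreteIsom (mul_mem g.2 g.2) hg
  have hsqθ : (θ ⟨α * α, hsq⟩ : Aff m) = β * β := by
    have e : (⟨(α * α, 1), mk_one_mem_model η₁ hsq⟩ : Model η₁) = g * g :=
      Subtype.ext (Prod.ext (by change α * α = g.1.1 * g.1.1; rw [hα]) hg.symm)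
    have h1 := hθ ⟨_, hsq⟩
    rw [e, map_mul] at h1
    rw [hβ]
    exact (congrArg (fun x : Model η₂ => x.1.1) h1).symm
  have h2 : Φ * (α * α) = β * β * Φ := by
    rw [← hsqθ]; exact hΦ ⟨_, hsq⟩
  have h3 : Φ * (α * α) = Φ * (transl (w + α.linear w) * (α * α)) := by
    rw [h2, mul_assoc, hβΦ, ← mul_assoc β, hβΦ, ← transl_mul]
    have := mul_transl α w
    calc Φ * (transl w * α) * (transl w * α) = Φ * transl w * (α * transl w) * α := by group
      _ = _ := by rw [this]; group
  have h4 := mul_right_cancel ((one_mul (α * α)).trans (mul_left_cancel h3))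
  rw [← transl_zero] at h4
  exact (neg_eq_of_add_eq_zero_right (transl_injective h4).symm).symm

/-- The isomorphism yields Φ and translations w₁, w₂. Replacing Φ by Φ(u + I), with u from the
normal form of cocycles, absorbs w₁ entirely and w₂ up to v; this affinity induces the conjugating
element of Aff(M). -/
theorem exists_pairConj_of_modelIso (hM : IsSpaceGroup M) {η₁ : HomF Dih M} {η₂ : Dih →* AffOrb M}
    (h : ModelIso η₁.1 η₂) {α₁ α₂ : Aff m} (h₁ : α₁ ∈ NA M) (h₂ : α₂ ∈ NA M)
    (e₁ : η₁.1 δ₁ = starNA α₁ h₁) (e₂ : η₁.1 δ₂ = starNA α₂ h₂) :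
    ∃ v : span (center M), (v : E m) ∈ negEigen M α₁ ⊓ negEigen M α₂ ∧
      PairConj (η₁.1 δ₁) (translStar v * η₁.1 δ₂) (η₂ δ₁) (η₂ δ₂) := by
  have hD := hM.isDiscreteIsom
  obtain ⟨f, hf, d₁, d₂, hd, hf₁, hf₂⟩ := exists_modelIso_generators h
  obtain ⟨θ, hθ⟩ := exists_fiberEquiv hD f hf
  obtain ⟨Φ, hΦ⟩ := exists_affinity_of_mulAut hM θ
  have m₁ : (α₁, δ₁) ∈ Model η₁.1 := fun x => by rw [e₁]; rfl
  have m₂ : (α₂, δ₂) ∈ Model η₁.1 := fun x => by rw [e₂]; rfl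
  obtain ⟨w₁, hw₁, hc₁⟩ := exists_translation_change hM f hθ hΦ ⟨_, m₁⟩ δ₁_mul_self
  obtain ⟨w₂, hw₂, hc₂⟩ := exists_translation_change hM f hθ hΦ ⟨_, m₂⟩ δ₂_mul_self
  have hb₁ := (f ⟨_, m₁⟩).2
  have hb₂ := (f ⟨_, m₂⟩).2
  have hd₁ := hf₁ ⟨_, m₁⟩ rfl
  have hd₂ := hf₂ ⟨_, m₂⟩ rfl
  generalize (f ⟨(α₁, δ₁), m₁⟩).1 = b₁ at hc₁ hb₁ hd₁
  generalize (f ⟨(α₂, δ₂), m₂⟩).1 = b₂ at hc₂ hb₂ hd₂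
  obtain ⟨hw₁, hn₁⟩ := mem_negEigen.1 hw₁
  obtain ⟨hw₂, hn₂⟩ := mem_negEigen.1 hw₂
  obtain ⟨C, hC⟩ := exists_invariant_conj hM η₁
  have hC₁ : ∀ x, ‖C (α₁.linear x)‖ = ‖C x‖ := hC (α₁, δ₁) m₁
  have hC₂ : ∀ x, ‖C (α₂.linear x)‖ = ‖C x‖ := hC (α₂, δ₂) m₂
  -- The square of α₁ lies in M, which acts trivially on Span(Z(M)); hence α₁ acts there as an
  -- involution.
  have q₁ := fst_mem_of_snd_eq_one hD (mul_mem m₁ m₁) δ₁_mul_self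
  have hs₁ : ∀ x ∈ span (center M), α₁.linear (α₁.linear x) = x := fun x hx => by
    have := linear_eq_of_mem_span_center hx q₁
    exact this
  have q₂ := fst_mem_of_snd_eq_one hD (mul_mem m₂ m₂) δ₂_mul_self
  have hs₂ : ∀ x ∈ span (center M), α₂.linear (α₂.linear x) = x := fun x hx => by
    have := linear_eq_of_mem_span_center hx q₂
    exact this
  obtain ⟨u, hu, v, hv, hv₁, hv₂, hu₁, hu₂⟩ : ∃ u ∈ span (center M), ∃ v ∈ span (center M),
      α₁.linear v = -v ∧ α₂.linear v = -v ∧ u - α₁.linear u = w₁ ∧ u + v - α₂.linear u = w₂ :=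
    exists_cocycle_normal_form C (A₁ := α₁.linear.toLinearMap) (A₂ := α₂.linear.toLinearMap)
      hC₁ hC₂ (fun x hx => linear_mem_span_center hM h₁ hx)
      (fun x hx => linear_mem_span_center hM h₂ hx) hs₁ hs₂ hw₁ hw₂ hn₁ hn₂
  refine ⟨⟨v, hv⟩, Submodule.mem_inf.2 ⟨mem_negEigen.2 ⟨hv, hv₁⟩, mem_negEigen.2 ⟨hv, hv₂⟩⟩, ?_⟩
  have hΦN : Φ ∈ NA M := by
    rw [Subgroup.mem_normalizer_iff]
    intro μ
    have h : ∀ ν : M, Φ * ν * Φ⁻¹ = θ ν := fun ν => by rw [hΦ, mul_inv_cancel_right]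
    constructor
    · intro hμ
      rw [h ⟨μ, hμ⟩]
      exact (θ _).2
    · intro hμ
      obtain ⟨ν, hν⟩ := θ.surjective ⟨_, hμ⟩
      have h' := h ν
      rw [hν] at h'
      have : μ = ν := (mul_left_cancel (mul_right_cancel h')).symm
      rw [this]
      exact ν.2
  have hN : Φ * transl u ∈ NA M := mul_mem hΦN (transl_mem_NA hu)
  have t₁ : Φ * transl u * α₁ = b₁.1 * (Φ * transl u) := by
    rw [← mul_assoc, hc₁]
    change _ = Φ * (transl w₁ * α₁) * transl u
    have : transl w₁ * α₁ * transl u = transl u * α₁ := by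
      rw [mul_assoc, mul_transl, ← mul_assoc, transl_mul, ← hu₁]
      congr 2
      exact sub_add_cancel _ _
    rw [mul_assoc Φ, mul_assoc Φ, this]
  have t₂ : Φ * transl u * (transl v * α₂) = b₂.1 * (Φ * transl u) := by
    rw [← mul_assoc b₂.1, hc₂]
    change _ = Φ * (transl w₂ * α₂) * transl u
    have : transl w₂ * α₂ * transl u = transl u * (transl v * α₂) := by
      rw [mul_assoc, mul_transl, ← mul_assoc, ← mul_assoc, transl_mul, transl_mul, ← hu₂]
      congr 2
      exact sub_add_cancel _ _
    rw [mul_assoc Φ, mul_assoc Φ, this]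
  have c₁ : starNA _ hN * η₁.1 δ₁ * (starNA _ hN)⁻¹ = η₂ d₁ := by
    rw [mul_inv_eq_iff_eq_mul, e₁]
    refine perm_orb_ext fun x => ?_
    have h := hb₁ ((Φ * transl u) x)
    rw [hd₁, ← mul_apply', ← t₁] at h
    change orb M ((Φ * transl u * α₁) x) = (η₂ d₁).1 (orb M ((Φ * transl u) x))
    exact h.symm
  have c₂ : starNA _ hN * (translStar ⟨v, hv⟩ * η₁.1 δ₂) * (starNA _ hN)⁻¹ = η₂ d₂ := by
    rw [mul_inv_eq_iff_eq_mul, e₂]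
    refine perm_orb_ext fun x => ?_
    have h := hb₂ ((Φ * transl u) x)
    rw [hd₂, ← mul_apply', ← t₂] at h
    change orb M ((Φ * transl u * (transl v * α₂)) x) = (η₂ d₂).1 (orb M ((Φ * transl u) x))
    exact h.symm
  refine ⟨starNA _ hN, ?_⟩
  rw [c₁, c₂]
  exact congrArg (Sym2.map η₂) hd

/-! ### The converse -/

/-- Lifts of the identity lie in M and fix v, and each generator negates v; induction on words
follows the sign. -/
theorem linear_eq_slope_smul {η : Dih →* AffOrb M} (hM : IsDiscreteIsom M) {α₁ α₂ : Aff m}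
    (h₁ : (α₁, δ₁) ∈ Model η) (h₂ : (α₂, δ₂) ∈ Model η) {v : E m} (hv : v ∈ span (center M))
    (hv₁ : α₁.linear v = -v) (hv₂ : α₂.linear v = -v) (δ : Dih) :
    ∀ φ, (φ, δ) ∈ Model η → φ.linear v = slope δ • v := by
  have step : ∀ (α : Aff m) (d : Dih), (α, d) ∈ Model η → α.linear v = -v → slope d = -1 →
      ∀ x : Dih, (∀ φ, (φ, x) ∈ Model η → φ.linear v = slope x • v) →
      ∀ φ, (φ, d * x) ∈ Model η → φ.linear v = slope (d * x : Dih) • v := by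
    intro α d hα hαv hd x ih φ hφ
    have h : (α⁻¹ * φ, x) ∈ Model η := by
      have := mul_mem (inv_mem hα) hφ
      have e : (α, d)⁻¹ * (φ, d * x) = (α⁻¹ * φ, x) := Prod.ext rfl (inv_mul_cancel_left d x)
      rwa [e] at this
    have h' := congrArg α.linear (ih _ h)
    rw [mul_linear, linear_apply_inv, map_smul, hαv] at h'
    rw [h', Subgroup.coe_mul, slope_mul, hd]
    simp
  induction δ using dih_induction with
  | one =>
    intro φ hφ
    rw [linear_eq_of_mem_span_center hv (fst_mem_of_snd_eq_one hM hφ rfl)]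
    simp
  | h₁ x ih => exact step α₁ δ₁ h₁ hv₁ (by simp) x ih
  | h₂ x ih => exact step α₂ δ₂ h₂ hv₂ (by simp) x ih

/-- The twist of `η` by the translations `trn(δ) v`. -/
def twist (η : Dih →* AffOrb M) (v : span (center M))
    (hv : ∀ δ φ, (φ, δ) ∈ Model η → φ.linear (v : E m) = slope δ • (v : E m)) : Dih →* AffOrb M :=
  MonoidHom.mk' (fun δ => translStar (trn δ • v) * η δ) fun γ δ => perm_orb_ext fun x => by
    obtain ⟨φ, hφ⟩ := exists_mem_model η γ
    obtain ⟨χ, hχ⟩ := exists_mem_model η δ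
    have hφ' : ∀ x, (η γ).1 (orb M x) = orb M (φ x) := hφ
    have hχ' : ∀ x, (η δ).1 (orb M x) = orb M (χ x) := hχ
    rw [map_mul]
    change (translStar (trn (γ * δ : Dih) • v)).1 ((η γ).1 ((η δ).1 (orb M x))) =
      (translStar (trn γ • v)).1 ((η γ).1 ((translStar (trn δ • v)).1 ((η δ).1 (orb M x))))
    rw [hχ', hφ', translStar_orb, translStar_orb, hφ', translStar_orb, apply_add, Subgroup.coe_mul,
      trn_mul, Submodule.coe_smul, Submodule.coe_smul, Submodule.coe_smul, map_smul, hv γ φ hφ,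
      add_smul, add_assoc, smul_smul, mul_comm (slope _)]

/-- Translating first coordinates by trn(δ)v is multiplicative, because trn(γδ) = trn γ + slope γ ·
trn δ and lifts over γ scale v by slope γ. -/
theorem modelIso_twist (η : Dih →* AffOrb M) (v : span (center M))
    (hv : ∀ δ φ, (φ, δ) ∈ Model η → φ.linear (v : E m) = slope δ • (v : E m)) :
    ModelIso η (twist η v hv) := by
  let F : Aff m × Dih ≃ Aff m × Dih :=
    { toFun := fun g => (transl (trn g.2 • (v : E m)) * g.1, g.2)
      invFun := fun g => ((transl (trn g.2 • (v : E m)))⁻¹ * g.1, g.2)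
      left_inv := fun g => by simp only [inv_mul_cancel_left]
      right_inv := fun g => by simp only [mul_inv_cancel_left] }
  refine modelIso_of_equiv F (fun g => ?_) (fun g hg h _ => ?_) fun g => Iff.rfl
  · have key : ∀ x, ((twist η v hv) g.2).1 (orb M x) =
        (translStar (trn g.2 • v)).1 ((η g.2).1 (orb M x)) := fun x => rfl
    rw [mem_model, mem_model]
    change _ ↔ ∀ x, ((twist η v hv) g.2).1 (orb M x) = orb M (trn g.2 • (v : E m) + g.1 x)
    simp only [key]
    constructor
    · intro h x
      rw [h]; rfl
    · intro h x
      exact (translStar (trn g.2 • v)).1.injective (h x)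
  · refine Prod.ext ?_ rfl
    change transl (trn (g.2 * h.2 : Dih) • (v : E m)) * (g.1 * h.1) =
      transl (trn g.2 • (v : E m)) * g.1 * (transl (trn h.2 • (v : E m)) * h.1)
    rw [mul_assoc (transl _) g.1, ← mul_assoc g.1, mul_transl, map_smul, hv g.2 g.1 hg, mul_assoc,
      ← mul_assoc (transl _) (transl _), transl_mul, Subgroup.coe_mul, trn_mul, add_smul, smul_smul,
      mul_comm (slope _)]

/-- Since trn δ₁ = 0 and trn δ₂ = 1, the twist by v fixes η₁(δ₁) and multiplies η₁(δ₂) by (v + I)_⋆.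
If the unordered pairs match crosswise, the automorphism exchanging the generators corrects this. -/
theorem modelIso_of_pairConj (hM : IsSpaceGroup M) {η₁ η₂ : Dih →* AffOrb M} {α₁ α₂ : Aff m}
    (h₁ : α₁ ∈ NA M) (h₂ : α₂ ∈ NA M) (e₁ : η₁ δ₁ = starNA α₁ h₁) (e₂ : η₁ δ₂ = starNA α₂ h₂)
    {v : span (center M)} (hv : (v : E m) ∈ negEigen M α₁ ⊓ negEigen M α₂)
    (hc : PairConj (η₁ δ₁) (translStar v * η₁ δ₂) (η₂ δ₁) (η₂ δ₂)) : ModelIso η₁ η₂ := by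
  have hslope := linear_eq_slope_smul (η := η₁) hM.isDiscreteIsom (α₁ := α₁) (α₂ := α₂)
    (fun x => by rw [e₁]; rfl) (fun x => by rw [e₂]; rfl) v.2
    (mem_negEigen.1 hv.1).2 (mem_negEigen.1 hv.2).2
  refine (modelIso_twist η₁ v hslope).trans ?_
  have t₁ : twist η₁ v hslope δ₁ = η₁ δ₁ := perm_orb_ext fun x => by
    obtain ⟨φ, hφ⟩ := exists_mem_model η₁ δ₁
    change (translStar (trn δ₁ • v)).1 ((η₁ δ₁).1 (orb M x)) = (η₁ δ₁).1 (orb M x)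
    rw [hφ, translStar_orb, coe_δ₁, trn_refl₁, zero_smul, Submodule.coe_zero, zero_add]
  have t₂ : twist η₁ v hslope δ₂ = translStar v * η₁ δ₂ := by
    change translStar (trn δ₂ • v) * η₁ δ₂ = _
    rw [coe_δ₂, trn_refl₂, one_smul]
  obtain ⟨g, hg⟩ := hc
  rw [← t₁, ← t₂, Sym2.eq_iff] at hg
  have fin : ∀ ζ : MulAut Dih, g * twist η₁ v hslope (ζ δ₁) * g⁻¹ = η₂ δ₁ →
      g * twist η₁ v hslope (ζ δ₂) * g⁻¹ = η₂ δ₂ → ModelIso (twist η₁ v hslope) η₂ := by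
    intro ζ a₁ a₂
    have : η₂ = ((MulAut.conj g).toMonoidHom.comp (twist η₁ v hslope)).comp ζ.toMonoidHom :=
      dih_hom_ext a₁.symm a₂.symm
    exact modelIso_of_conj g ζ fun δ => DFunLike.congr_fun this δ
  rcases hg with ⟨a₁, a₂⟩ | ⟨a₁, a₂⟩
  · exact fin 1 a₁ a₂
  · obtain ⟨ζ, z₁, z₂⟩ := exists_swap
    exact fin ζ (by rw [z₁]; exact a₂) (by rw [z₂]; exact a₁)

end criterion

/-! ## Product coordinates -/

section coordinates

variable {m k : ℕ}

@[simp] theorem fst_join (v : E m) (w : E k) : fst (join v w) = v := by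
  ext i; simp [fst, join]

@[simp] theorem snd_join (v : E m) (w : E k) : snd (join v w) = w := by
  ext i; simp [snd, join]

@[simp] theorem join_fst_snd (x : E (m + k)) : join (fst x) (snd x) = x := by
  ext i
  refine Fin.addCases (fun i => ?_) (fun i => ?_) i <;> simp [fst, snd, join]

theorem inner_join (v v' : E m) (w w' : E k) :
    inner ℝ (join v w) (join v' w') = inner ℝ v v' + inner ℝ w w' := by
  simp [PiLp.inner_apply, join, Fin.sum_univ_add]

theorem norm_sq_join (v : E m) (w : E k) : ‖join v w‖ ^ 2 = ‖v‖ ^ 2 + ‖w‖ ^ 2 := by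
  rw [← real_inner_self_eq_norm_sq, inner_join, real_inner_self_eq_norm_sq,
    real_inner_self_eq_norm_sq]

/-- The identification `E^m × E^k = E^{m+k}`. -/
def joinEquiv (m k : ℕ) : (E m × E k) ≃ₗ[ℝ] E (m + k) where
  toFun p := join p.1 p.2
  invFun x := (fst x, snd x)
  left_inv p := by simp
  right_inv x := by simp
  map_add' p q := by
    ext i
    refine Fin.addCases (fun i => ?_) (fun i => ?_) i <;> simp [join]
  map_smul' c p := by
    ext i
    refine Fin.addCases (fun i => ?_) (fun i => ?_) i <;> simp [join]

theorem join_add (v v' : E m) (w w' : E k) : join (v + v') (w + w') = join v w + join v' w' :=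
  (joinEquiv m k).map_add (v, w) (v', w')

theorem join_sub (v v' : E m) (w w' : E k) : join (v - v') (w - w') = join v w - join v' w' :=
  (joinEquiv m k).map_sub (v, w) (v', w')

theorem join_zero : join (0 : E m) (0 : E k) = 0 := (joinEquiv m k).map_zero

theorem snd_add (x y : E (m + k)) : snd (x + y) = snd x + snd y := rfl

theorem join_injective {v v' : E m} {w w' : E k} (h : join v w = join v' w') : v = v' ∧ w = w' :=
  Prod.ext_iff.1 ((joinEquiv m k).injective (a₁ := (v, w)) (a₂ := (v', w')) h)

/-- The product of affinities. -/
def prodHom (m k : ℕ) : Aff m × Aff k →* Aff (m + k) where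
  toFun g := (joinEquiv m k).symm.toAffineEquiv.trans
    ((g.1.prodCongr g.2).trans (joinEquiv m k).toAffineEquiv)
  map_one' := by
    ext1 x
    exact (joinEquiv m k).apply_symm_apply x
  map_mul' g h := by
    ext1 x
    change (joinEquiv m k) (g.1 (h.1 (fst x)), g.2 (h.2 (snd x))) = (joinEquiv m k)
      (g.1 (fst (join (h.1 (fst x)) (h.2 (snd x)))), g.2 (snd (join (h.1 (fst x)) (h.2 (snd x)))))
    rw [fst_join, snd_join]

theorem prodHom_apply (g : Aff m × Aff k) (x : E (m + k)) :
    prodHom m k g x = join (g.1 (fst x)) (g.2 (snd x)) := rfl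

theorem prodHom_join (g : Aff m × Aff k) (v : E m) (w : E k) :
    prodHom m k g (join v w) = join (g.1 v) (g.2 w) := by
  rw [prodHom_apply, fst_join, snd_join]

theorem prodHom_linear_join (g : Aff m × Aff k) (v : E m) (w : E k) :
    (prodHom m k g).linear (join v w) = join (g.1.linear v) (g.2.linear w) := by
  change join (g.1.linear (fst (join v w))) (g.2.linear (snd (join v w))) = _
  rw [fst_join, snd_join]

theorem prodHom_zero (g : Aff m × Aff k) : prodHom m k g 0 = join (g.1 0) (g.2 0) := by
  rw [← join_zero, prodHom_join]

theorem prodHom_injective : Function.Injective (prodHom m k) := by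
  intro g h hgh
  have key := fun v w => DFunLike.congr_fun hgh (join v w)
  simp only [prodHom_join] at key
  exact Prod.ext (AffineEquiv.ext fun v => (join_injective (key v 0)).1)
    (AffineEquiv.ext fun w => (join_injective (key 0 w)).2)

end coordinates

/-! ## Linear conjugates of space groups -/

section conjugate

variable {m : ℕ} {M : Subgroup (Aff m)}

theorem sharp_orb (C : E m ≃ₗ[ℝ] E m) {β : Equiv.Perm (Orb M)} {φ : Aff m}
    (h : ∀ x, β (orb M x) = orb M (φ x)) (x : E m) :
    sharp C.toAffineEquiv rfl β (orb (conj C.toAffineEquiv M) x) =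
      orb _ ((C.toAffineEquiv * φ * C.toAffineEquiv⁻¹) x) := by
  change star C.toAffineEquiv rfl (β (orb M (C.toAffineEquiv⁻¹ x))) = _
  rw [h]; rfl

theorem isSpaceGroup_conj (hM : IsSpaceGroup M) (C : E m ≃ₗ[ℝ] E m)
    (hC : ∀ μ ∈ M, ∀ x, ‖C (μ.linear x)‖ = ‖C x‖) : IsSpaceGroup (conj C.toAffineEquiv M) where
  isometry := by
    rintro _ ⟨μ, hμ, rfl⟩
    refine isometry_of_norm_linear fun x => ?_
    change ‖C (μ.linear (C.symm x))‖ = _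
    rw [hC μ hμ, C.apply_symm_apply]
  discrete := by
    obtain ⟨ε, hε, h⟩ := hM.discrete
    let C' := C.toContinuousLinearEquiv
    -- Adding 1 keeps the constants positive even for m = 0, when the operator norms vanish.
    have h1 : ∀ x, ‖C x‖ ≤ (‖(C' : E m →L[ℝ] E m)‖ + 1) * ‖x‖ := fun x =>
      ((C' : E m →L[ℝ] E m).le_opNorm x).trans (by gcongr; linarith)
    have h2 : ∀ x, ‖x‖ ≤ (‖(C'.symm : E m →L[ℝ] E m)‖ + 1) * ‖C x‖ := fun x => by
      have := (C'.symm : E m →L[ℝ] E m).le_opNorm (C x)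
      have e : (C'.symm : E m →L[ℝ] E m) (C x) = x := C.symm_apply_apply x
      rw [e] at this
      exact this.trans (by gcongr; linarith)
    set a := ‖(C' : E m →L[ℝ] E m)‖ + 1
    set b := ‖(C'.symm : E m →L[ℝ] E m)‖ + 1
    have ha : 1 ≤ a := le_add_of_nonneg_left (norm_nonneg _)
    have hb : 1 ≤ b := le_add_of_nonneg_left (norm_nonneg _)
    have hab : 0 < a * b := by positivity
    refine ⟨ε / (a * b), by positivity, ?_⟩
    rintro _ ⟨μ, hμ, rfl⟩ h0 hl
    have : μ = 1 := by
      refine h μ hμ ?_ fun x => ?_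
      · have h0' : ‖C (μ (C.symm 0))‖ < ε / (a * b) := h0
        rw [map_zero, lt_div_iff₀ hab] at h0'
        have := h2 (μ 0)
        nlinarith [norm_nonneg (C (μ 0))]
      · have hl' : ‖C (μ.linear (C.symm (C x))) - C x‖ ≤ ε / (a * b) * ‖C x‖ := hl (C x)
        rw [C.symm_apply_apply, ← map_sub] at hl'
        refine (h2 _).trans ((mul_le_mul_of_nonneg_left (hl'.trans
          (mul_le_mul_of_nonneg_left (h1 x) (by positivity))) (by positivity)).trans_eq ?_)
        field_simp
    rw [this]
    exact map_one _
  cocompact := by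
    obtain ⟨R, hR⟩ := (compactSpace_orb_iff M).1 hM.cocompact
    refine (compactSpace_orb_iff _).2 ⟨‖(C.toContinuousLinearEquiv : E m →L[ℝ] E m)‖ * R,
      fun x => ?_⟩
    obtain ⟨μ, hμ, h⟩ := hR (C.symm x)
    refine ⟨_, ⟨μ, hμ, rfl⟩, ?_⟩
    change ‖C (μ (C.symm x))‖ ≤ _
    exact ((C.toContinuousLinearEquiv : E m →L[ℝ] E m).le_opNorm _).trans (by gcongr)

end conjugate

/-! ## The space group constructed from a homomorphism -/

section construction

variable {m k : ℕ} {Δ : Subgroup (Aff k)} {M : Subgroup (Aff m)}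

/-- The action of the model extension on `E^m × E^k`. -/
def modelAction (η : Δ →* AffOrb M) (C : E m ≃ₗ[ℝ] E m) : Model η →* Aff (m + k) :=
  (prodHom m k).comp ((((MulAut.conj C.toAffineEquiv).toMonoidHom.prodMap Δ.subtype)).comp
    (Model η).subtype)

/-- The extension of `C M C⁻¹` by the trivial action on `E^k`. -/
def fiberAction (k : ℕ) (M : Subgroup (Aff m)) (C : E m ≃ₗ[ℝ] E m) : M →* Aff (m + k) :=
  (prodHom m k).comp ((MonoidHom.inl (Aff m) (Aff k)).comp
    ((MulAut.conj C.toAffineEquiv).toMonoidHom.comp M.subtype))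

theorem modelAction_apply (η : Δ →* AffOrb M) (C : E m ≃ₗ[ℝ] E m) (g : Model η) :
    modelAction η C g =
      prodHom m k (C.toAffineEquiv * g.1.1 * C.toAffineEquiv⁻¹, (g.1.2 : Aff k)) := rfl

theorem fiberAction_apply (C : E m ≃ₗ[ℝ] E m) (μ : M) :
    fiberAction k M C μ = prodHom m k (C.toAffineEquiv * μ * C.toAffineEquiv⁻¹, 1) := rfl

theorem modelAction_injective (η : Δ →* AffOrb M) (C : E m ≃ₗ[ℝ] E m) :
    Function.Injective (modelAction η C) := by
  intro g h hgh
  have := prodHom_injective hgh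
  exact Subtype.ext (Prod.ext ((MulAut.conj C.toAffineEquiv).injective (congrArg Prod.fst this))
    (Subtype.ext (congrArg Prod.snd this)))

theorem fiberAction_injective (C : E m ≃ₗ[ℝ] E m) : Function.Injective (fiberAction k M C) := by
  intro g h hgh
  exact Subtype.ext ((MulAut.conj C.toAffineEquiv).injective
    (congrArg Prod.fst (prodHom_injective hgh)))

theorem modelAction_mem_iff (hM : IsDiscreteIsom M) (η : Δ →* AffOrb M) (C : E m ≃ₗ[ℝ] E m)
    (g : Model η) : modelAction η C g ∈ (fiberAction k M C).range ↔ g.1.2 = 1 := by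
  constructor
  · rintro ⟨μ, hμ⟩
    exact Subtype.ext (congrArg Prod.snd (prodHom_injective hμ)).symm
  · intro h
    refine ⟨⟨g.1.1, fst_mem_of_snd_eq_one hM g.2 h⟩, ?_⟩
    rw [modelAction_apply, fiberAction_apply, h]; rfl

variable {η : Δ →* AffOrb M} {C : E m ≃ₗ[ℝ] E m}

/-- Both properties are checked first over Δ and then in the fiber. An element near the identity has
trivial Δ-component, so its first component lies in C M C⁻¹. A point is made bounded in E^k by Δ,
and then in E^m by M, which does not move the E^k-coordinate. -/
theorem isSpaceGroup_modelAction (hM : IsSpaceGroup M) (hΔ : IsSpaceGroup Δ)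
    (hC : ∀ g ∈ Model η, ∀ x, ‖C (g.1.linear x)‖ = ‖C x‖) :
    IsSpaceGroup (modelAction η C).range := by
  have hM' := isSpaceGroup_conj hM C fun μ hμ => hC (μ, 1) (mk_one_mem_model η hμ)
  have hconj : ∀ g ∈ Model η, ∀ x,
      ‖(C.toAffineEquiv * g.1 * C.toAffineEquiv⁻¹).linear x‖ = ‖x‖ := fun g hg x => by
    change ‖C (g.1.linear (C.symm x))‖ = _
    rw [hC g hg, C.apply_symm_apply]
  refine ⟨?_, ?_, ?_⟩
  · rintro _ ⟨g, rfl⟩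
    refine isometry_of_norm_linear fun x => ?_
    rw [← sq_eq_sq₀ (norm_nonneg _) (norm_nonneg _), ← join_fst_snd x, modelAction_apply,
      prodHom_linear_join, norm_sq_join, norm_sq_join, hconj _ g.2,
      norm_linear hΔ.isDiscreteIsom g.1.2.2]
  · obtain ⟨ε₁, hε₁, h₁⟩ := hM'.discrete
    obtain ⟨ε₂, hε₂, h₂⟩ := hΔ.discrete
    refine ⟨min ε₁ ε₂, lt_min hε₁ hε₂, ?_⟩
    rintro _ ⟨g, rfl⟩ h0 hl
    rw [modelAction_apply] at h0 hl
    rw [prodHom_zero] at h0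
    simp only at h0
    have n1 : ∀ (v : E m) (w : E k), ‖v‖ ≤ ‖join v w‖ := fun v w => by
      rw [← sq_le_sq₀ (norm_nonneg _) (norm_nonneg _), norm_sq_join]
      exact le_add_of_nonneg_right (sq_nonneg _)
    have n2 : ∀ (v : E m) (w : E k), ‖w‖ ≤ ‖join v w‖ := fun v w => by
      rw [← sq_le_sq₀ (norm_nonneg _) (norm_nonneg _), norm_sq_join]
      exact le_add_of_nonneg_left (sq_nonneg _)
    have n3 : ∀ v : E m, ‖join v (0 : E k)‖ = ‖v‖ := fun v => by
      rw [← sq_eq_sq₀ (norm_nonneg _) (norm_nonneg _), norm_sq_join]; simp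
    have n4 : ∀ w : E k, ‖join (0 : E m) w‖ = ‖w‖ := fun w => by
      rw [← sq_eq_sq₀ (norm_nonneg _) (norm_nonneg _), norm_sq_join]; simp
    have g2 : g.1.2 = 1 := by
      refine Subtype.ext (h₂ _ g.1.2.2 ?_ fun w => ?_)
      · exact ((n2 _ _).trans_lt h0).trans_le (min_le_right _ _)
      · have := hl (join 0 w)
        rw [prodHom_linear_join, ← join_sub, n4] at this
        exact (n2 _ _).trans (this.trans (by gcongr; exact min_le_right _ _))
    have g1 : C.toAffineEquiv * g.1.1 * C.toAffineEquiv⁻¹ = 1 := by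
      refine h₁ _ ⟨g.1.1, fst_mem_of_snd_eq_one hM.isDiscreteIsom g.2 g2, rfl⟩ ?_ fun v => ?_
      · exact ((n1 _ _).trans_lt h0).trans_le (min_le_left _ _)
      · have := hl (join v 0)
        rw [prodHom_linear_join, ← join_sub, n3] at this
        exact (n1 _ _).trans (this.trans (by gcongr; exact min_le_left _ _))
    rw [modelAction_apply, g1, g2]
    exact map_one _
  · obtain ⟨R₁, h₁⟩ := (compactSpace_orb_iff _).1 hM'.cocompact
    obtain ⟨R₂, h₂⟩ := (compactSpace_orb_iff _).1 hΔ.cocompact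
    refine (compactSpace_orb_iff _).2 ⟨R₁ + R₂, fun x => ?_⟩
    obtain ⟨δ, hδ, hδR⟩ := h₂ (snd x)
    obtain ⟨φ, hφ⟩ := exists_mem_model η ⟨δ, hδ⟩
    obtain ⟨_, ⟨μ, hμ, rfl⟩, hμR⟩ := h₁ ((C.toAffineEquiv * φ * C.toAffineEquiv⁻¹) (fst x))
    refine ⟨_, ⟨⟨_, mul_mem (mk_one_mem_model η hμ) hφ⟩, rfl⟩, ?_⟩
    have e : modelAction η C ⟨_, mul_mem (mk_one_mem_model η hμ) hφ⟩ x =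
        join ((C.toAffineEquiv * μ * C.toAffineEquiv⁻¹)
          ((C.toAffineEquiv * φ * C.toAffineEquiv⁻¹) (fst x))) (δ (snd x)) := by
      rw [modelAction_apply, prodHom_apply]
      congr 1
      change _ = (C.toAffineEquiv * μ * C.toAffineEquiv⁻¹ *
        (C.toAffineEquiv * φ * C.toAffineEquiv⁻¹)) (fst x)
      congr 1
      change C.toAffineEquiv * (μ * φ) * C.toAffineEquiv⁻¹ = _
      group
    rw [e]
    have hR₁ := (norm_nonneg _).trans hμR
    have hR₂ := (norm_nonneg _).trans hδR
    refine abs_le_of_sq_le_sq' ?_ (by positivity) |>.2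
    rw [norm_sq_join]
    have a1 := pow_le_pow_left₀ (norm_nonneg _) hμR 2
    have a2 := pow_le_pow_left₀ (norm_nonneg _) hδR 2
    change ‖(C.toAffineEquiv * μ * C.toAffineEquiv⁻¹)
          ((C.toAffineEquiv * φ * C.toAffineEquiv⁻¹) (fst x))‖ ^ 2 ≤ _ at a1
    nlinarith

/-- Bieberbach's first theorem for C M C⁻¹ makes Span(N) the whole factor E^m, so the two subspaces
in the definition of completeness are the two factors. -/
theorem mem_span_fiberAction (hM' : IsSpaceGroup (conj C.toAffineEquiv M)) (x : E (m + k)) :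
    x ∈ span (fiberAction k M C).range ↔ snd x = 0 := by
  constructor
  · intro hx
    induction hx using Submodule.span_induction with
    | mem a ha =>
      obtain ⟨μ, hμ⟩ := ha
      have := DFunLike.congr_fun hμ 0
      rw [fiberAction_apply, prodHom_zero] at this
      have h2 := congrArg snd this
      rw [snd_join] at h2
      rw [transl_apply, add_zero] at h2
      exact h2.symm
    | zero => rfl
    | add a b _ _ ha hb => rw [snd_add, ha, hb, add_zero]
    | smul c a _ ha =>
      have : snd (c • a) = c • snd a := rfl
      rw [this, ha, smul_zero]
  · intro hx
    let i : E m →ₗ[ℝ] E (m + k) := (joinEquiv m k).toLinearMap ∘ₗ LinearMap.inl ℝ (E m) (E k)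
    have hle : span (conj C.toAffineEquiv M) ≤ (span (fiberAction k M C).range).comap i := by
      rw [span, Submodule.span_le]
      rintro a ⟨μ, hμ, ha⟩
      refine Submodule.subset_span ⟨⟨μ, hμ⟩, ?_⟩
      rw [fiberAction_apply]
      have ha' : C.toAffineEquiv * μ * C.toAffineEquiv⁻¹ = transl a := ha
      simp only [ha']
      ext1 y
      rw [prodHom_apply, transl_apply]
      change join (a + fst y) (snd y) = join a 0 + y
      conv_rhs => rw [← join_fst_snd y, ← join_add, zero_add]
    have := hle (mem_span_of_isSpaceGroup hM' (fst x))
    have e : i (fst x) = x := by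
      change join (fst x) 0 = x
      rw [← hx, join_fst_snd]
    rw [Submodule.mem_comap, e] at this
    exact this

theorem mem_span_orthogonal (hM' : IsSpaceGroup (conj C.toAffineEquiv M)) (x : E (m + k)) :
    x ∈ (span (fiberAction k M C).range)ᗮ ↔ fst x = 0 := by
  constructor
  · intro hx
    have h1 : join (fst x) 0 ∈ span (fiberAction k M C).range :=
      (mem_span_fiberAction hM' _).2 (snd_join _ _)
    have h2 := hx _ h1
    rw [← join_fst_snd x, fst_join, inner_join, inner_zero_left, add_zero] at h2
    exact inner_self_eq_zero.1 h2
  · intro hx y hy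
    rw [← join_fst_snd x, ← join_fst_snd y, (mem_span_fiberAction hM' y).1 hy, hx, inner_join]
    simp

theorem isCompleteNormal_modelAction (hM : IsSpaceGroup M)
    (hM' : IsSpaceGroup (conj C.toAffineEquiv M)) :
    IsCompleteNormal (modelAction η C).range (fiberAction k M C).range where
  le := by
    rintro _ ⟨μ, rfl⟩
    exact ⟨⟨(μ, 1), mk_one_mem_model η μ.2⟩, rfl⟩
  normal := by
    refine ⟨?_⟩
    rintro ⟨_, g, rfl⟩ hg ⟨_, h, rfl⟩
    rw [Subgroup.mem_subgroupOf, modelAction_mem_iff hM.isDiscreteIsom] at hg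
    rw [Subgroup.mem_subgroupOf]
    change modelAction η C h * modelAction η C g * (modelAction η C h)⁻¹ ∈ _
    rw [← map_inv, ← map_mul, ← map_mul, modelAction_mem_iff hM.isDiscreteIsom]
    change h.1.2 * g.1.2 * h.1.2⁻¹ = 1
    rw [hg, mul_one, mul_inv_cancel]
  complete := by
    rintro _ ⟨g, rfl⟩
    rw [modelAction_mem_iff hM.isDiscreteIsom, mem_span_fiberAction hM', modelAction_apply,
      prodHom_zero, snd_join]
    constructor
    · intro h
      rw [h]
      refine ⟨rfl, fun w hw => ?_⟩
      rw [← join_fst_snd w, (mem_span_orthogonal hM' w).1 hw, prodHom_linear_join, map_zero]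
      rfl
    · rintro ⟨h0, hl⟩
      refine Subtype.ext (aff_ext h0 fun w => ?_)
      have := hl (join 0 w) ((mem_span_orthogonal hM' _).2 (fst_join _ _))
      rw [prodHom_linear_join] at this
      exact (join_injective this).2

theorem exists_isConstructedFrom (hM : IsSpaceGroup M) (hΔ : IsSpaceGroup Δ) (η : HomF Δ M) :
    ∃ (C : E m ≃ₗ[ℝ] E m) (p : Pair Δ M), IsConstructedFrom η C p := by
  obtain ⟨C, hC⟩ := exists_invariant_conj hM η
  have hM' := isSpaceGroup_conj hM C fun μ hμ => hC (μ, 1) (mk_one_mem_model η.1 hμ)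
  have hcomp := isCompleteNormal_modelAction (k := k) (η := η.1) hM hM'
  let a := MonoidHom.ofInjective (modelAction_injective η.1 C)
  have ha : ∀ g, (a g : Aff (m + k)) = modelAction η.1 C g := fun g => rfl
  let e : (modelAction η.1 C).range →* Δ :=
    ((MonoidHom.snd (Aff m) Δ).comp (Model η.1).subtype).comp a.symm.toMonoidHom
  have he : Function.Surjective e := fun δ => by
    obtain ⟨φ, hφ⟩ := exists_mem_model η.1 δ
    refine ⟨a ⟨(φ, δ), hφ⟩, ?_⟩
    change (a.symm (a _)).1.2 = δ
    rw [a.symm_apply_apply]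
  have hker : e.ker = (fiberAction k M C).range.subgroupOf (modelAction η.1 C).range := by
    ext γ
    obtain ⟨g, rfl⟩ := a.surjective γ
    rw [Subgroup.mem_subgroupOf, ha, modelAction_mem_iff hM.isDiscreteIsom, MonoidHom.mem_ker]
    change (a.symm (a g)).1.2 = 1 ↔ _
    rw [a.symm_apply_apply]
  have := hcomp.normal
  refine ⟨C, ⟨_, _, isSpaceGroup_modelAction hM hΔ hC, hcomp,
    ⟨(MonoidHom.ofInjective (fiberAction_injective C)).symm⟩,
    ⟨(QuotientGroup.quotientMulEquivOfEq hker.symm).trans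
      (QuotientGroup.quotientKerEquivOfSurjective e he)⟩⟩, ?_⟩
  have hperp : ∀ g, perp (m := m) (modelAction η.1 C g) = (g.1.2 : Aff k) := fun g => by
    funext w
    rw [perp, modelAction_apply, prodHom_join, snd_join]
  refine ⟨hM', fun δ => ?_, fun γ => ?_, ?_, ?_⟩
  · obtain ⟨φ, hφ⟩ := exists_mem_model η.1 δ
    refine ⟨C.toAffineEquiv * φ * C.toAffineEquiv⁻¹, isometry_of_norm_linear fun x => ?_,
      sharp_orb C hφ⟩
    have h := hC (φ, δ) hφ (C.symm x)
    rw [C.apply_symm_apply] at h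
    exact h
  · constructor
    · rintro ⟨μ, rfl⟩
      refine ⟨_, ⟨μ, μ.2, rfl⟩, fun v w => ?_⟩
      rw [fiberAction_apply, prodHom_join]; rfl
    · rintro ⟨_, ⟨μ, hμ, rfl⟩, h⟩
      refine ⟨⟨μ, hμ⟩, AffineEquiv.ext fun x => ?_⟩
      rw [fiberAction_apply, ← join_fst_snd x, prodHom_join, h]; rfl
  · ext f
    constructor
    · rintro ⟨_, ⟨g, rfl⟩, rfl⟩
      exact ⟨g.1.2, g.1.2.2, (hperp g).symm⟩
    · rintro ⟨δ, hδ, rfl⟩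
      obtain ⟨φ, hφ⟩ := exists_mem_model η.1 ⟨δ, hδ⟩
      exact ⟨_, ⟨⟨_, hφ⟩, rfl⟩, hperp _⟩
  · rintro _ ⟨g, rfl⟩ δ hδ x
    rw [hperp] at hδ
    have : g.1.2 = δ := Subtype.ext (DFunLike.coe_injective hδ)
    subst this
    rw [sharp_orb C g.2, bar, modelAction_apply, prodHom_join, fst_join]

end construction

/-! ## Complete normal subgroups -/

section complete

variable {n : ℕ} {Γ N : Subgroup (Aff n)}

theorem conj_mem_of_complete (hc : IsCompleteNormal Γ N) {γ ν : Aff n} (hγ : γ ∈ Γ) (hν : ν ∈ N) :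
    γ * ν * γ⁻¹ ∈ N :=
  hc.normal.conj_mem ⟨ν, hc.le hν⟩ hν ⟨γ, hγ⟩

theorem linear_mem_span (hc : IsCompleteNormal Γ N) {γ : Aff n} (hγ : γ ∈ Γ) {x : E n}
    (hx : x ∈ span N) : γ.linear x ∈ span N := by
  induction hx using Submodule.span_induction with
  | mem a ha =>
    refine Submodule.subset_span ?_
    change transl (γ.linear a) ∈ N
    rw [← conj_transl]
    exact conj_mem_of_complete hc hγ ha
  | zero => rw [map_zero]; exact zero_mem _
  | add a b _ _ ha hb => rw [map_add]; exact add_mem ha hb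
  | smul c a _ ha => rw [map_smul]; exact Submodule.smul_mem _ _ ha

theorem linear_mem_orthogonal (hΓ : IsDiscreteIsom Γ) (hc : IsCompleteNormal Γ N) {γ : Aff n}
    (hγ : γ ∈ Γ) {x : E n} (hx : x ∈ (span N)ᗮ) : γ.linear x ∈ (span N)ᗮ := by
  intro y hy
  have h := (LinearMap.norm_map_iff_inner_map_map γ.linear).1 (norm_linear hΓ hγ)
    (γ⁻¹.linear y) x
  rw [linear_apply_inv] at h
  rw [h]
  exact hx _ (linear_mem_span hc (Γ.inv_mem hγ) hy)

/-- The orthogonal projection onto the span of `N`. -/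
def proj (N : Subgroup (Aff n)) : E n →L[ℝ] span N := (span N).orthogonalProjectionOnto

theorem proj_coe (x : span N) : proj N x = x :=
  Submodule.orthogonalProjectionOnto_mem_subspace_eq_self x

theorem sub_proj_mem (x : E n) : x - proj N x ∈ (span N)ᗮ :=
  Submodule.sub_starProjection_mem_orthogonal x

theorem proj_eq_zero {x : E n} (hx : x ∈ (span N)ᗮ) : proj N x = 0 :=
  Submodule.orthogonalProjectionOnto_apply_of_mem_orthogonal hx

theorem proj_linear (hΓ : IsDiscreteIsom Γ) (hc : IsCompleteNormal Γ N) {γ : Aff n} (hγ : γ ∈ Γ)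
    (x : E n) : (proj N (γ.linear x) : E n) = γ.linear (proj N x) := by
  have h1 : x = proj N x + (x - proj N x) := by abel
  have h2 : proj N (γ.linear (proj N x)) = ⟨γ.linear (proj N x),
      linear_mem_span hc hγ (proj N x).2⟩ :=
    proj_coe ⟨γ.linear (proj N x), linear_mem_span hc hγ (proj N x).2⟩
  conv_lhs => rw [h1, map_add, map_add,
    proj_eq_zero (linear_mem_orthogonal hΓ hc hγ (sub_proj_mem x)), add_zero, h2]

/-- The action of `Γ` on the span of `N`. -/
def spanRep (hΓ : IsDiscreteIsom Γ) (hc : IsCompleteNormal Γ N) :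
    Γ →* (span N →ᵃ[ℝ] span N) where
  toFun γ := (proj N).toLinearMap.toAffineMap.comp
    ((γ : Aff n).toAffineMap.comp (span N).subtype.toAffineMap)
  map_one' := by
    ext1 x
    exact proj_coe x
  map_mul' γ δ := by
    ext1 x
    refine Subtype.ext ?_
    change (proj N ((γ : Aff n) ((δ : Aff n) x)) : E n) =
      proj N ((γ : Aff n) (proj N ((δ : Aff n) x)))
    rw [apply_eq γ.1, apply_eq γ.1 (proj N _ : E n), map_add, map_add, Submodule.coe_add,
      Submodule.coe_add, proj_linear hΓ hc γ.2, proj_linear hΓ hc γ.2, proj_coe]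

theorem spanRep_apply (hΓ : IsDiscreteIsom Γ) (hc : IsCompleteNormal Γ N) (γ : Γ) (x : span N) :
    spanRep hΓ hc γ x = proj N ((γ : Aff n) x) := rfl

theorem zero_mem_span (hc : IsCompleteNormal Γ N) {ν : Aff n} (hν : ν ∈ N) : ν 0 ∈ span N :=
  ((hc.complete ν (hc.le hν)).1 hν).1

theorem spanRep_coe (hΓ : IsDiscreteIsom Γ) (hc : IsCompleteNormal Γ N) {γ : Γ} (hγ : (γ : Aff n) ∈ N)
    (x : span N) : (spanRep hΓ hc γ x : E n) = (γ : Aff n) x := by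
  have h : (γ : Aff n) x ∈ span N := by
    rw [apply_eq]
    exact add_mem (linear_mem_span hc γ.2 x.2) (zero_mem_span hc hγ)
  rw [spanRep_apply]
  exact congrArg Subtype.val (proj_coe ⟨_, h⟩)

/-- Linear parts of elements of N fix the complement of Span(N), so an element of N is determined by
its action on Span(N). -/
theorem eq_of_eq_on_span (hc : IsCompleteNormal Γ N) {ν : Aff n} (hν : ν ∈ N) {a : E n}
    (h : ∀ x ∈ span N, ν x = a + x) : ν = transl a := by
  have h0 : ν 0 = a := by simpa using h 0 (zero_mem _)
  refine aff_ext (by rw [h0, transl_apply, add_zero]) fun x => ?_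
  rw [transl_linear]
  have h1 : x = proj N x + (x - proj N x) := by abel
  have h2 := h _ (proj N x).2
  rw [apply_eq, h0, add_comm, add_right_inj] at h2
  have h3 := ((hc.complete ν (hc.le hν)).1 hν).2 _ (sub_proj_mem x)
  conv_lhs => rw [h1, map_add, h2, h3, ← h1]

/-- Needed to compare N with M by Bieberbach's second theorem, although N acts cocompactly only on a
subspace of E^n. -/
theorem isCrystal_spanRep (hΓ : IsDiscreteIsom Γ) (hc : IsCompleteNormal Γ N) :
    IsCrystal ((spanRep hΓ hc).comp (Subgroup.inclusion hc.le)) where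
  spans := by
    have htop : Submodule.span ℝ (((↑) : span N → E n) ⁻¹' {a : E n | transl a ∈ N}) = ⊤ :=
      Submodule.span_span_coe_preimage
    refine top_le_iff.1 (htop.ge.trans (Submodule.span_mono fun a ha =>
      ⟨⟨_, ha⟩, fun x => Subtype.ext ?_⟩))
    rw [MonoidHom.comp_apply, spanRep_coe hΓ hc (γ := Subgroup.inclusion hc.le ⟨_, ha⟩) ha]
    rfl
  finite := by
    have := finite_linear (hΓ.mono hc.le) fun g hg => zero_mem_span hc hg
    refine (this.image fun A : E n →L[ℝ] E n =>
      ((proj N).toLinearMap ∘ₗ A.toLinearMap ∘ₗ (span N).subtype)).subset ?_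
    rintro _ ⟨g, rfl⟩
    exact ⟨lin g, ⟨g, g.2, rfl⟩, rfl⟩
  discrete := by
    obtain ⟨ε, hε, h⟩ := hΓ.discrete
    refine ⟨ε, hε, fun ν a hν ha => ?_⟩
    have ht : (ν : Aff n) = transl (a : E n) := eq_of_eq_on_span hc ν.2 fun x hx => by
      have := congrArg Subtype.val (hν ⟨x, hx⟩)
      rw [MonoidHom.comp_apply, spanRep_coe hΓ hc (γ := Subgroup.inclusion hc.le ν) ν.2] at this
      exact this
    refine Subtype.ext (h ν (hc.le ν.2) ?_ fun x => ?_)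
    · rw [ht, transl_apply, add_zero]; exact ha
    · rw [ht, transl_linear, sub_self, norm_zero]; positivity

/-- The action of `Γ` on the span of `N`, in affine coordinates. -/
def coordAction {m : ℕ} (hΓ : IsDiscreteIsom Γ) (hc : IsCompleteNormal Γ N)
    (φ : E m ≃ᵃ[ℝ] span N) : Γ →* Aff m :=
  (AffineEquiv.equivUnitsAffineMap.symm.toMonoidHom).comp (MonoidHom.toHomUnits
    { toFun := fun γ => φ.symm.toAffineMap.comp ((spanRep hΓ hc γ).comp φ.toAffineMap)
      map_one' := by
        ext1 x
        rw [map_one]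
        exact φ.symm_apply_apply x
      map_mul' := fun γ δ => by
        ext1 x
        rw [map_mul]
        change φ.symm (spanRep hΓ hc γ (spanRep hΓ hc δ (φ x))) =
          φ.symm (spanRep hΓ hc γ (φ (φ.symm (spanRep hΓ hc δ (φ x)))))
        rw [φ.apply_symm_apply] })

theorem coordAction_apply {m : ℕ} (hΓ : IsDiscreteIsom Γ) (hc : IsCompleteNormal Γ N)
    (φ : E m ≃ᵃ[ℝ] span N) (γ : Γ) (x : E m) :
    φ (coordAction hΓ hc φ γ x) = proj N ((γ : Aff n) (φ x)) :=
  φ.apply_symm_apply _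

theorem coordAction_injOn {m : ℕ} (hΓ : IsDiscreteIsom Γ) (hc : IsCompleteNormal Γ N)
    (φ : E m ≃ᵃ[ℝ] span N) {ν : Γ} (hν : (ν : Aff n) ∈ N) (h : coordAction hΓ hc φ ν = 1) :
    ν = 1 := by
  refine Subtype.ext ((eq_of_eq_on_span hc hν (a := 0) fun x hx => ?_).trans transl_zero)
  have h1 := spanRep_coe hΓ hc hν ⟨x, hx⟩
  have h2 := coordAction_apply hΓ hc φ ν (φ.symm ⟨x, hx⟩)
  rw [h, φ.apply_symm_apply] at h2
  rw [zero_add, ← h1, spanRep_apply, ← h2]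
  change ((φ (φ.symm ⟨x, hx⟩) : span N) : E n) = x
  rw [φ.apply_symm_apply]

end complete

/-! ## The homomorphism of a group pair -/

section models

variable {m k : ℕ} {Δ : Subgroup (Aff k)} {M : Subgroup (Aff m)}

/-- The projection `Γ → Γ / N ≅ Δ` of a pair. -/
def Pair.toBase (p : Pair Δ M) : p.Γ →* Δ :=
  haveI := p.complete.normal
  p.isoΔ.some.toMonoidHom.comp (QuotientGroup.mk' (p.N.subgroupOf p.Γ))

theorem Pair.toBase_surjective (p : Pair Δ M) : Function.Surjective p.toBase := by
  have := p.complete.normal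
  exact p.isoΔ.some.surjective.comp (QuotientGroup.mk'_surjective _)

theorem Pair.toBase_eq_one_iff (p : Pair Δ M) (γ : p.Γ) :
    p.toBase γ = 1 ↔ (γ : Aff (m + k)) ∈ p.N := by
  have := p.complete.normal
  change p.isoΔ.some (QuotientGroup.mk' (p.N.subgroupOf p.Γ) γ) = 1 ↔ _
  rw [map_eq_one_iff _ (MulEquiv.injective _), QuotientGroup.mk'_apply, QuotientGroup.eq_one_iff]
  rfl

theorem finite_image_of_factor {α β γ : Type*} {S : Set α} {h : α → β} {g : α → γ}
    (hfin : (h '' S).Finite) (hg : ∀ a ∈ S, ∀ b ∈ S, h a = h b → g a = g b) : (g '' S).Finite := by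
  rcases isEmpty_or_nonempty α with hα | hα
  · rw [S.eq_empty_of_isEmpty, Set.image_empty]; exact Set.finite_empty
  refine (hfin.image fun y => g (Function.invFunOn h S y)).subset ?_
  rintro _ ⟨a, ha, rfl⟩
  refine ⟨h a, ⟨a, ha, rfl⟩, ?_⟩
  have hex : ∃ b ∈ S, h b = h a := ⟨a, ha, rfl⟩
  exact hg _ (Function.invFunOn_mem hex) _ ha (Function.invFunOn_eq hex)

/-- Up to inner automorphisms, `Γ` induces finitely many automorphisms of `N`. -/
theorem exists_finite_conj {n : ℕ} {Γ N : Subgroup (Aff n)} (hΓ : IsDiscreteIsom Γ)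
    (hc : IsCompleteNormal Γ N) : ∃ S : Set Γ,
      (∀ γ : Γ, ∃ ν : Γ, (ν : Aff n) ∈ N ∧ γ * ν ∈ S) ∧
      ∀ {β : Type} (g : Γ → β), (∀ γ δ : Γ, (∀ ν : Γ, (ν : Aff n) ∈ N →
        γ * ν * γ⁻¹ = δ * ν * δ⁻¹) → g γ = g δ) → (g '' S).Finite := by
  obtain ⟨R, hR⟩ := exists_transl_near N
  obtain ⟨R', hgen, -⟩ := exists_bounded_generators fun g hg => zero_mem_span hc hg
  have hN := hΓ.mono hc.le
  have hRle : Subgroup.closure (bounded N R) ≤ N := by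
    rw [Subgroup.closure_le]; exact fun g hg => hg.1
  -- The elements with displacement at most R along Span(N): a suitable translation in N brings any
  -- γ into this set.
  refine ⟨{γ | ‖(proj N ((γ : Aff n) 0) : E n)‖ ≤ R}, fun γ => ?_, fun {β} g hg => ?_⟩
  · obtain ⟨a, ha, haR⟩ := hR (-(γ : Aff n)⁻¹.linear (proj N ((γ : Aff n) 0)))
      (neg_mem (linear_mem_span hc (Γ.inv_mem γ.2) (proj N _).2))
    have haN := hRle ha
    refine ⟨⟨transl a, hc.le haN⟩, haN, ?_⟩
    change ‖(proj N ((γ : Aff n) (transl a 0)) : E n)‖ ≤ R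
    have e : proj N a = ⟨a, Submodule.subset_span haN⟩ :=
      proj_coe ⟨a, Submodule.subset_span haN⟩
    rw [transl_apply, add_zero, apply_eq, map_add, Submodule.coe_add, proj_linear hΓ hc γ.2, e,
      ← norm_linear hΓ (Γ.inv_mem γ.2), map_add, linear_inv_apply, ← norm_neg, neg_add,
      add_comm, ← sub_eq_add_neg]
    exact haR
  · have hX := finite_bounded hN R'
    -- Conjugates of generators by γ in S stay in this finite set. With y = γ⁻¹ 0, an element x of N
    -- moves y by at most 2‖proj y‖ + ‖x 0‖, since its linear part fixes the complement of Span(N).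
    have hY := finite_bounded hN (2 * R + R')
    have : Finite (bounded N R') := hX.to_subtype
    refine finite_image_of_factor (h := fun (γ : Γ) (x : bounded N R') =>
      (γ : Aff n) * x * (γ : Aff n)⁻¹) ?_ ?_
    · refine (Set.Finite.pi' fun _ : bounded N R' => hY).subset ?_
      rintro _ ⟨γ, hγ, rfl⟩ ⟨x, hx, hxR⟩
      refine ⟨conj_mem_of_complete hc γ.2 hx, ?_⟩
      change ‖(γ : Aff n) (x ((γ : Aff n)⁻¹ 0))‖ ≤ _
      set y := (γ : Aff n)⁻¹ 0 with hy
      have hγy : (γ : Aff n) y = 0 := apply_inv_self' _ _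
      have hγy' : y = -(γ : Aff n)⁻¹.linear ((γ : Aff n) 0) := by
        rw [apply_eq] at hγy
        have h := congrArg (γ : Aff n)⁻¹.linear hγy
        rw [map_add, linear_inv_apply] at h
        exact eq_neg_of_add_eq_zero_left (h.trans (map_zero _))
      have hyn : ‖(proj N y : E n)‖ ≤ R := by
        rw [hγy', map_neg, Submodule.coe_neg, norm_neg, proj_linear hΓ hc (Γ.inv_mem γ.2),
          norm_linear hΓ (Γ.inv_mem γ.2)]
        exact hγ
      have hfix := ((hc.complete x (hc.le hx)).1 hx).2 _ (sub_proj_mem y)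
      have e : x y = (x.linear (proj N y) - proj N y + x 0) + y := by
        have h1 : y = proj N y + (y - proj N y) := by abel
        conv_lhs => rw [apply_eq, h1, map_add, hfix]
        abel
      rw [e, apply_add, hγy, add_zero, norm_linear hΓ γ.2]
      refine (norm_add_le _ _).trans (add_le_add ((norm_sub_le _ _).trans ?_) hxR)
      rw [norm_linear hΓ (hc.le hx)]
      linarith
    · intro γ _ δ _ h
      refine hg γ δ fun ν hν => Subtype.ext ?_
      change (γ : Aff n) * ν * (γ : Aff n)⁻¹ = (δ : Aff n) * ν * (δ : Aff n)⁻¹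
      have hle : Subgroup.closure (bounded N R') ≤
          (MulAut.conj (γ : Aff n)).toMonoidHom.eqLocus (MulAut.conj (δ : Aff n)).toMonoidHom := by
        rw [Subgroup.closure_le]
        exact fun x hx => congrFun h ⟨x, hx⟩
      exact hle (hgen hν)

/-- Every pair is isomorphic to the model extension of a homomorphism in `Hom_f(Δ, Aff(M))`. -/
theorem exists_models (hM : IsSpaceGroup M) (p : Pair Δ M) : ∃ η : HomF Δ M, Models η.1 p := by
  have hΓ := p.spaceGroup.isDiscreteIsom
  have hc := p.complete
  have hD := hM.isDiscreteIsom
  obtain ⟨θ⟩ := p.isoM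
  -- The group M acts crystallographically on E^m, and through N on Span(N); φ identifies the two
  -- actions.
  obtain ⟨φ, hφ⟩ := exists_affineEquiv (isCrystal_of_isSpaceGroup hM)
    ((isCrystal_spanRep hΓ hc).comp θ.symm)
  let b := coordAction hΓ hc φ
  have hb : ∀ ν : p.N, b (Subgroup.inclusion hc.le ν) = θ ν := fun ν => by
    ext1 x
    refine φ.injective ?_
    have h := hφ (θ ν) x
    have h1 : φ (b (Subgroup.inclusion hc.le ν) x) =
      spanRep hΓ hc (Subgroup.inclusion hc.le ν) (φ x) := coordAction_apply hΓ hc φ _ x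
    rw [h1]
    have h2 : φ ((θ ν : Aff m) x) =
      spanRep hΓ hc (Subgroup.inclusion hc.le (θ.symm (θ ν))) (φ x) := h
    rw [h2, θ.symm_apply_apply]
  have hbM : ∀ ν : p.Γ, (ν : Aff (m + k)) ∈ p.N → b ν ∈ M := fun ν hν => by
    rw [show ν = Subgroup.inclusion hc.le ⟨ν, hν⟩ from rfl, hb]
    exact (θ _).2
  have hbs : ∀ μ ∈ M, ∃ ν : p.Γ, (ν : Aff (m + k)) ∈ p.N ∧ b ν = μ := fun μ hμ =>
    ⟨Subgroup.inclusion hc.le (θ.symm ⟨μ, hμ⟩), (θ.symm ⟨μ, hμ⟩).2, by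
      rw [hb, θ.apply_symm_apply]⟩
  have hconj : ∀ γ : p.Γ, ∀ μ ∈ M, b γ * μ * (b γ)⁻¹ ∈ M := fun γ μ hμ => by
    obtain ⟨ν, hν, rfl⟩ := hbs μ hμ
    rw [← map_inv, ← map_mul, ← map_mul]
    exact hbM _ (conj_mem_of_complete hc γ.2 hν)
  have hNA : ∀ γ, b γ ∈ NA M := fun γ => by
    rw [Subgroup.mem_normalizer_iff]
    refine fun μ => ⟨hconj γ μ, fun h => ?_⟩
    have h' := hconj γ⁻¹ _ h
    rw [map_inv] at h'
    have e : (b γ)⁻¹ * (b γ * μ * (b γ)⁻¹) * (b γ)⁻¹⁻¹ = μ := by group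
    rwa [e] at h'
  let B : p.Γ →* AffOrb M := MonoidHom.mk' (fun γ => starNA (b γ) (hNA γ)) fun γ δ =>
    perm_orb_ext fun x => by
      rw [starNA_orb, map_mul]; rfl
  have hBker : ∀ γ : p.Γ, (γ : Aff (m + k)) ∈ p.N → B γ = 1 := fun γ hγ =>
    perm_orb_ext fun x => orb_apply (hbM γ hγ) x
  have := hc.normal
  have hle : p.N.subgroupOf p.Γ ≤ B.ker := fun γ hγ => hBker γ hγ
  -- The action of Γ on E^m/M is trivial on N and therefore descends to Γ/N ≅ Δ.
  let η : Δ →* AffOrb M := (QuotientGroup.lift (p.N.subgroupOf p.Γ) B hle).comp p.isoΔ.some.symm.toMonoidHom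
  have hη : ∀ γ, η (p.toBase γ) = B γ := fun γ => by
    change QuotientGroup.lift (p.N.subgroupOf p.Γ) B hle (p.isoΔ.some.symm
      (p.isoΔ.some (QuotientGroup.mk' (p.N.subgroupOf p.Γ) γ))) = _
    rw [MulEquiv.symm_apply_apply]
    rfl
  obtain ⟨S, hS, hSfin⟩ := exists_finite_conj hΓ hc
  let o : p.Γ → Out M := fun γ => QuotientGroup.mk (M.normalizerMonoidHom ⟨b γ, hNA γ⟩)
  have ho : ∀ γ ν : p.Γ, (ν : Aff (m + k)) ∈ p.N → o (γ * ν) = o γ := fun γ ν hν => by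
    refine (QuotientGroup.eq.2 (MonoidHom.mem_range.2 ⟨(⟨b ν, hbM ν hν⟩ : M), ?_⟩)).symm
    rw [eq_inv_mul_iff_mul_eq]
    refine MulEquiv.ext fun μ => Subtype.ext ?_
    change b γ * (b ν * μ * (b ν)⁻¹) * (b γ)⁻¹ = b (γ * ν) * μ * (b (γ * ν))⁻¹
    rw [map_mul]
    group
  have hofin : (o '' S).Finite := hSfin o fun γ δ h => by
    refine congrArg QuotientGroup.mk (MulEquiv.ext fun μ => Subtype.ext ?_)
    change b γ * μ * (b γ)⁻¹ = b δ * μ * (b δ)⁻¹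
    obtain ⟨ν, hν, hνμ⟩ := hbs μ μ.2
    rw [← hνμ, ← map_inv, ← map_inv, ← map_mul, ← map_mul, ← map_mul, ← map_mul, h ν hν]
  refine ⟨⟨η, hofin.subset ?_⟩, models_of_action hD b p.toBase p.toBase_surjective
    p.toBase_eq_one_iff (fun γ x => by rw [hη]; rfl) hbs fun γ => coordAction_injOn hΓ hc φ⟩
  -- Every lift χ of η(δ) is the action of some element of Γ, and N can bring that element into S
  -- without changing the outer class.
  rintro _ ⟨δ, χ, hχ, hχδ, rfl⟩
  obtain ⟨γ, rfl⟩ := p.toBase_surjective δ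
  obtain ⟨μ, hμ, hχμ⟩ := exists_eq_mul_of_lift hD (β := (B γ).1) (φ := χ) (χ := b γ)
    (fun x => by rw [← hη, ← hχδ]; rfl) fun x => rfl
  obtain ⟨ν, hν, rfl⟩ := hbs μ hμ
  rw [← map_mul] at hχμ
  obtain ⟨ν', hν', hmem⟩ := hS (ν * γ)
  refine ⟨_, hmem, ?_⟩
  rw [ho _ _ hν']
  have e : (⟨b (ν * γ), hNA _⟩ : NA M) = ⟨χ, hχ⟩ := Subtype.ext hχμ.symm
  simp only [o, e]

/-- A pair constructed from `η` is isomorphic to the model extension of `η`. -/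
theorem models_of_isConstructedFrom (hM : IsSpaceGroup M) {η : HomF Δ M} {C : E m ≃ₗ[ℝ] E m}
    {p : Pair Δ M} (h : IsConstructedFrom η C p) : Models η.1 p := by
  have hΓ := p.spaceGroup.isDiscreteIsom
  have hc := p.complete
  have hN : p.N = (fiberAction k M C).range := by
    ext γ
    rw [h.extend]
    constructor
    · rintro ⟨_, ⟨μ, hμ, rfl⟩, h⟩
      refine ⟨⟨μ, hμ⟩, AffineEquiv.ext fun x => ?_⟩
      rw [fiberAction_apply, ← join_fst_snd x, prodHom_join, h]; rfl
    · rintro ⟨μ, rfl⟩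
      refine ⟨_, ⟨μ, μ.2, rfl⟩, fun v w => ?_⟩
      rw [fiberAction_apply, prodHom_join]; rfl
  have hs : ∀ x, x ∈ span p.N ↔ snd x = 0 := fun x => by
    rw [hN]; exact mem_span_fiberAction h.spaceGroup x
  have ho : ∀ x, x ∈ (span p.N)ᗮ ↔ fst x = 0 := fun x => by
    rw [hN]; exact mem_span_orthogonal h.spaceGroup x
  -- Linear parts of Γ preserve both factors, so the E^k-coordinate of γ x depends only on that of
  -- x, and γ ↦ γ' is multiplicative.
  have hfst : ∀ γ ∈ p.Γ, ∀ w, fst (γ.linear (join (0 : E m) w)) = 0 := fun γ hγ w =>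
    (ho _).1 (linear_mem_orthogonal hΓ hc hγ ((ho _).2 (fst_join _ _)))
  have hsnd : ∀ γ ∈ p.Γ, ∀ v, snd (γ.linear (join v (0 : E k))) = 0 := fun γ hγ v =>
    (hs _).1 (linear_mem_span hc hγ ((hs _).2 (snd_join _ _)))
  have hsplit : ∀ (v : E m) (w : E k), join v w = join v 0 + join 0 w := fun v w => by
    rw [← join_add, add_zero, zero_add]
  have hperp : ∀ γ ∈ p.Γ, ∀ x, snd (γ x) = perp (m := m) γ (snd x) := fun γ hγ x => by
    conv_lhs => rw [← join_fst_snd x, hsplit, apply_add, snd_add, hsnd γ hγ, zero_add]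
    rfl
  have hex : ∀ γ : p.Γ, ∃ δ : Δ, perp (m := m) (γ : Aff (m + k)) = ⇑(δ : Aff k) := fun γ => by
    have : perp (m := m) (γ : Aff (m + k)) ∈ {f : E k → E k | ∃ δ ∈ Δ, ⇑δ = f} := by
      rw [← h.perp_eq]
      exact ⟨γ, γ.2, rfl⟩
    obtain ⟨δ, hδ, e⟩ := this
    exact ⟨⟨δ, hδ⟩, e.symm⟩
  choose e₀ he₀ using hex
  have hext : ∀ {γ δ : Δ}, (∀ x, (γ : Aff k) x = (δ : Aff k) x) → γ = δ := fun h =>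
    Subtype.ext (AffineEquiv.ext h)
  let e : p.Γ →* Δ := MonoidHom.mk' e₀ fun γ δ => hext fun w => by
    rw [Subgroup.coe_mul, mul_apply', ← he₀, ← he₀, ← he₀]
    change snd ((γ : Aff (m + k)) ((δ : Aff (m + k)) (join 0 w))) = _
    rw [hperp γ γ.2]
    rfl
  have he : ∀ γ : p.Γ, perp (m := m) (γ : Aff (m + k)) = ⇑(e γ : Aff k) := he₀
  have hesurj : Function.Surjective e := fun δ => by
    have : ⇑(δ : Aff k) ∈ {f : E k → E k | ∃ γ ∈ p.Γ, perp (m := m) γ = f} := by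
      rw [h.perp_eq]
      exact ⟨δ, δ.2, rfl⟩
    obtain ⟨γ, hγ, hγδ⟩ := this
    exact ⟨⟨γ, hγ⟩, hext fun x => by rw [← he, hγδ]⟩
  have hker : ∀ γ, e γ = 1 ↔ (γ : Aff (m + k)) ∈ p.N := fun γ => by
    constructor
    · intro h1
      have hid : ∀ w, perp (m := m) (γ : Aff (m + k)) w = w := fun w => by rw [he, h1]; rfl
      refine (hc.complete γ γ.2).2 ⟨(hs _).2 ?_, fun w hw => ?_⟩
      · rw [hperp γ γ.2, hid]; rfl
      · have hw0 := (ho w).1 hw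
        have hw' : w = join 0 (snd w) := by rw [← hw0, join_fst_snd]
        have h2 : snd ((γ : Aff (m + k)).linear w) = snd w := by
          have h3 := hperp γ γ.2 w
          have h4 := hperp γ γ.2 0
          rw [hid] at h3 h4
          have h5 : snd ((γ : Aff (m + k)) w) =
              snd ((γ : Aff (m + k)).linear w) + snd ((γ : Aff (m + k)) 0) := by
            rw [apply_eq _ w, snd_add]
          rw [h3, h4] at h5
          rw [h5]
          exact (add_zero _).symm
        rw [← join_fst_snd ((γ : Aff (m + k)).linear w), h2]
        conv_rhs => rw [hw']
        congr 1
        rw [hw']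
        exact hfst γ γ.2 _
    · intro hγ
      obtain ⟨ν, -, hν⟩ := (h.extend γ).1 hγ
      refine hext fun w => ?_
      rw [← he, perp, hν, snd_join]; rfl
  -- Coordinates through C, because η takes values in affinities of E^m/M and not of the quotient by
  -- C M C⁻¹.
  let φ : E m ≃ᵃ[ℝ] span p.N := LinearEquiv.toAffineEquiv
    { toFun := fun x => ⟨join (C x) 0, (hs _).2 (snd_join _ _)⟩
      invFun := fun y => C.symm (fst (y : E (m + k)))
      map_add' := fun x y => Subtype.ext (by
        rw [map_add, Submodule.coe_add, ← join_add, add_zero])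
      map_smul' := fun c x => Subtype.ext (by
        change join (C (c • x)) 0 = c • join (C x) 0
        rw [map_smul]
        have := (joinEquiv m k).map_smul c (C x, 0)
        rw [Prod.smul_mk, smul_zero] at this
        exact this)
      left_inv := fun x => by
        change C.symm (fst (join (C x) (0 : E k))) = x
        rw [fst_join, C.symm_apply_apply]
      right_inv := fun y => Subtype.ext (by
        change join (C (C.symm (fst (y : E (m + k))))) 0 = (y : E (m + k))
        rw [C.apply_symm_apply, ← (hs _).1 y.2, join_fst_snd]) }
  have hφ : ∀ x, (φ x : E (m + k)) = join (C x) 0 := fun x => rfl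
  have hb : ∀ (γ : p.Γ) x, C (coordAction hΓ hc φ γ x) = bar (k := k) (γ : Aff (m + k)) (C x) := by
    intro γ x
    have h1 := congrArg (fun y : span p.N => fst (y : E (m + k))) (coordAction_apply hΓ hc φ γ x)
    simp only [hφ, fst_join] at h1
    rw [h1, bar]
    have h2 := (ho _).1 (sub_proj_mem (N := p.N) ((γ : Aff (m + k)) (join (C x) 0)))
    exact (sub_eq_zero.1 h2).symm
  refine models_of_action hM.isDiscreteIsom (coordAction hΓ hc φ) e hesurj hker (fun γ x => ?_)
    (fun μ hμ => ?_) fun γ => coordAction_injOn hΓ hc φ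
  · have h1 := h.action γ γ.2 (e γ) (he γ) (C x)
    rw [← hb] at h1
    have h2 : sharp C.toAffineEquiv rfl (η.1 (e γ)).1 (orb (conj C.toAffineEquiv M) (C x)) =
        star C.toAffineEquiv rfl ((η.1 (e γ)).1 (orb M (C.symm (C x)))) := rfl
    rw [h2, C.symm_apply_apply] at h1
    exact (star C.toAffineEquiv rfl).injective h1
  · have hν : fiberAction k M C ⟨μ, hμ⟩ ∈ p.N := by rw [hN]; exact ⟨_, rfl⟩
    refine ⟨⟨_, hc.le hν⟩, hν, AffineEquiv.ext fun x => C.injective ?_⟩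
    rw [hb, bar]
    change fst (fiberAction k M C ⟨μ, hμ⟩ (join (C x) 0)) = _
    rw [fiberAction_apply, prodHom_join, fst_join]
    change C (μ (C.symm (C x))) = _
    rw [C.symm_apply_apply]

end models

/-! ## The infinite dihedral group is a space group -/

theorem norm_e1 (x : E 1) : ‖x‖ = |x 0| := by
  rw [← Real.norm_eq_abs, ← sq_eq_sq₀ (norm_nonneg _) (norm_nonneg _), EuclideanSpace.norm_sq_eq]
  simp

theorem isSpaceGroup_dih : IsSpaceGroup Dih where
  isometry γ hγ := by
    refine isometry_of_norm_linear fun x => ?_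
    rw [norm_e1, norm_e1, linear_one_apply]
    rcases (dih_cases ⟨γ, hγ⟩).2 with h | h <;> simp only at h <;> rw [h] <;> simp
  discrete := by
    -- The value 1 suffices: translation coefficients are integers, and the slopes 1 and −1 differ
    -- by 2.
    refine ⟨1, one_pos, fun γ hγ h0 hl => ?_⟩
    obtain ⟨⟨j, hj⟩, hs⟩ := dih_cases ⟨γ, hγ⟩
    simp only at hj hs
    refine aff_one_ext ?_ ?_
    · rw [norm_e1] at h0
      have h0' : |trn γ| < 1 := h0
      rw [hj] at h0'
      have : |j| < 1 := by exact_mod_cast h0'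
      rw [hj, Int.abs_lt_one_iff.1 this]
      simp
    · rw [slope_one]
      refine hs.resolve_right fun h => ?_
      have := hl (EuclideanSpace.single 0 1)
      rw [norm_e1, norm_e1, PiLp.sub_apply, linear_one_apply, h] at this
      norm_num at this
  cocompact := by
    refine (compactSpace_orb_iff _).2 ⟨1, fun x => ?_⟩
    obtain ⟨d, hd, hs⟩ := exists_dih_transl (-⌊x 0⌋)
    refine ⟨d, d.2, ?_⟩
    rw [norm_e1, apply_one, hd, hs, one_mul, Int.cast_neg, ← sub_eq_add_neg, Int.self_sub_floor,
      abs_of_nonneg (Int.fract_nonneg _)]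
    exact (Int.fract_lt_one _).le

end FlatOrb

end

/-! ### The surjection ψ and its fibers -/

theorem theorem25 {m : ℕ} (M : Subgroup (FlatOrb.Aff m)) (hM : FlatOrb.IsSpaceGroup M) :
    ∃ ψ : FlatOrb.AffClass FlatOrb.Dih M → FlatOrb.IsoClass FlatOrb.Dih M,
      (∀ x c, ψ x = c ↔ FlatOrb.PsiGraph x c) ∧
      Function.Surjective ψ ∧
      ∀ (η₁ η₂ : FlatOrb.HomF FlatOrb.Dih M) (α₁ α₂ : FlatOrb.Aff m)
        (h₁ : α₁ ∈ FlatOrb.NA M) (h₂ : α₂ ∈ FlatOrb.NA M),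
        η₁.1 FlatOrb.δ₁ = FlatOrb.starNA α₁ h₁ →
        η₁.1 FlatOrb.δ₂ = FlatOrb.starNA α₂ h₂ →
        (ψ (FlatOrb.affClass η₁) = ψ (FlatOrb.affClass η₂) ↔
          ∃ v : FlatOrb.span (FlatOrb.center M),
            (v : FlatOrb.E m) ∈ FlatOrb.negEigen M α₁ ⊓ FlatOrb.negEigen M α₂ ∧
            FlatOrb.PairConj (η₁.1 FlatOrb.δ₁) (FlatOrb.translStar v * η₁.1 FlatOrb.δ₂)
              (η₂.1 FlatOrb.δ₁) (η₂.1 FlatOrb.δ₂)) := by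
  open FlatOrb in
  have hclass : ∀ η₁ η₂ : HomF Dih M, affClass η₁ = affClass η₂ → ModelIso η₁.1 η₂.1 := by
    intro η₁ η₂ h
    obtain ⟨α, ζ, h⟩ := Quotient.exact (s := affSetoid Dih M) h
    exact modelIso_of_conj α ζ h
  choose C p hp using FlatOrb.exists_isConstructedFrom hM FlatOrb.isSpaceGroup_dih
  have hmod := fun η => FlatOrb.models_of_isConstructedFrom hM (hp η)
  have hrep : ∀ x : FlatOrb.AffClass FlatOrb.Dih M, ∃ η, FlatOrb.affClass η = x :=
    Quotient.exists_rep
  choose r hr using hrep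
  -- Any pair modelled on η lies in the class chosen for [η], whatever the representative and C. The
  -- graph relation and surjectivity both follow from this.
  have hval : ∀ η q, FlatOrb.Models η.1 q →
      FlatOrb.isoClass (p (r (FlatOrb.affClass η))) = FlatOrb.isoClass q := fun η q hq =>
    (FlatOrb.isoClass_eq_iff (hmod _) hq).2 (hclass _ _ (hr _))
  refine ⟨fun x => FlatOrb.isoClass (p (r x)), fun x c => ⟨?_, ?_⟩, fun c => ?_, ?_⟩
  · rintro rfl
    exact ⟨r x, C _, p _, hr x, hp _, rfl⟩
  · rintro ⟨η, C', q, rfl, hq, rfl⟩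
    exact hval η q (FlatOrb.models_of_isConstructedFrom hM hq)
  · obtain ⟨q, rfl⟩ := Quotient.exists_rep c
    obtain ⟨η, hη⟩ := FlatOrb.exists_models hM q
    exact ⟨FlatOrb.affClass η, hval η q hη⟩
  · intro η₁ η₂ α₁ α₂ h₁ h₂ e₁ e₂
    change FlatOrb.isoClass (p (r (FlatOrb.affClass η₁))) =
      FlatOrb.isoClass (p (r (FlatOrb.affClass η₂))) ↔ _
    rw [hval η₁ _ (hmod η₁), hval η₂ _ (hmod η₂), FlatOrb.isoClass_eq_iff (hmod η₁) (hmod η₂)]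
    constructor
    · intro h
      exact FlatOrb.exists_pairConj_of_modelIso hM h h₁ h₂ e₁ e₂
    · rintro ⟨v, hv, hc⟩
      exact FlatOrb.modelIso_of_pairConj hM h₁ h₂ e₁ e₂ hv hc
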